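/- Let $K\subset S^3$ be a tame knot (unoriented, considered up to ambient isotopy). The Reidemeister graph $\mathcal G(K)$ has as vertices the planar diagrams of $K$ up to isotopy of the plane, two diagrams being adjacent whenever they are connected by a single Reidemeister move (of type $\Omega_1$, $\Omega_2$ or $\Omega_3$, performed or undone); the $S^2$-Reidemeister graph $\mathcal G_S(K)$ is defined in the same way from the diagrams of $K$ on the $2$-sphere up to isotopy of $S^2$. Both graphs carry the path metric $d$, the minimal number of Reidemeister moves connecting two diagrams. Then, for every tame knot $K$, neither $\mathcal G(K)$ nor $\mathcal G_S(K)$ is Gromov hyperbolic; that is, in neither graph is there a constant $\delta$ such that $$d(w,x)+d(y,z)\le \max\{d(w,y)+d(x,z),\ d(w,z)+d(x,y)\}+2\delta$$ for all vertices $w,x,y,z$. -/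

import Mathlib

open Set Topology

noncomputable section

namespace KnotDiagrams

/-! ## Ambient isotopy -/

/-- A self-homeomorphism of `X` is isotopic to the identity: it is the time-one map of a continuous
family of self-homeomorphisms starting at the identity. -/
def IsotopicToId {X : Type*} [TopologicalSpace X] (φ : X ≃ₜ X) : Prop :=
  ∃ H : unitInterval → (X ≃ₜ X),
    Continuous (fun p : unitInterval × X => H p.1 p.2) ∧
    Continuous (fun p : unitInterval × X => (H p.1).symm p.2) ∧
    H 0 = Homeomorph.refl X ∧ H 1 = φ

theorem IsotopicToId.refl (X : Type*) [TopologicalSpace X] :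
    IsotopicToId (Homeomorph.refl X) :=
  ⟨fun _ => Homeomorph.refl X, continuous_snd, continuous_snd, rfl, rfl⟩

theorem IsotopicToId.symm {X : Type*} [TopologicalSpace X] {φ : X ≃ₜ X}
    (h : IsotopicToId φ) : IsotopicToId φ.symm := by
  obtain ⟨H, h1, h2, h3, h4⟩ := h
  refine ⟨fun t => (H t).symm, h2, h1, ?_, ?_⟩
  · simp only [h3]; rfl
  · simp only [h4]

theorem IsotopicToId.trans {X : Type*} [TopologicalSpace X] {φ ψ : X ≃ₜ X}
    (h : IsotopicToId φ) (k : IsotopicToId ψ) : IsotopicToId (φ.trans ψ) := by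
  obtain ⟨H, h1, h2, h3, h4⟩ := h
  obtain ⟨L, k1, k2, k3, k4⟩ := k
  refine ⟨fun t => (H t).trans (L t), ?_, ?_, ?_, ?_⟩
  · exact k1.comp (continuous_fst.prodMk h1)
  · exact h2.comp (continuous_fst.prodMk k2)
  · simp only [h3, k3]; rfl
  · simp only [h4, k4]

/-- Two subsets of `X` are ambient isotopic. -/
def AmbientIsotopic {X : Type*} [TopologicalSpace X] (A B : Set X) : Prop :=
  ∃ φ : X ≃ₜ X, IsotopicToId φ ∧ φ '' A = B

/-! ## Tame knots in the 3-sphere -/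

/-- Euclidean 3-space. -/
abbrev Space : Type := EuclideanSpace ℝ (Fin 3)

/-- The 3-sphere, as the one-point compactification of Euclidean 3-space. -/
abbrev ThreeSphere : Type := OnePoint Space

/-- A polygonal knot in Euclidean 3-space: the union of the edges `[v i, v (i + 1)]` of a simple
closed polygon with `n ≥ 3` cyclically indexed vertices, distinct edges of which meet only in
common vertices. -/
def IsPolygonalKnot (L : Set Space) : Prop :=
  ∃ (n : ℕ) (v : ZMod n → Space), 3 ≤ n ∧ Function.Injective v ∧
    (∀ i j : ZMod n, i ≠ j →
      segment ℝ (v i) (v (i + 1)) ∩ segment ℝ (v j) (v (j + 1)) ⊆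
        {v i, v (i + 1)} ∩ {v j, v (j + 1)}) ∧
    L = ⋃ i : ZMod n, segment ℝ (v i) (v (i + 1))

/-- A tame embedding of the circle `ℝ / ℤ` in the 3-sphere: a continuous injective map whose image
is ambient isotopic to a polygonal knot. -/
structure IsTameKnot (K : UnitAddCircle → ThreeSphere) : Prop where
  continuous : Continuous K
  injective : Function.Injective K
  tame : ∃ L : Set Space, IsPolygonalKnot L ∧
    AmbientIsotopic (range K) ((fun x : Space => (x : ThreeSphere)) '' L)

/-! ## Diagrams on a surface -/

/-- The plane. -/
abbrev Plane : Type := ℝ × ℝ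

/-- The 2-sphere. -/
abbrev TwoSphere : Type := Metric.sphere (0 : EuclideanSpace ℝ (Fin 3)) 1

/-- A knot diagram on a surface `S`: a closed curve `curve` on `S` whose only singularities are
finitely many transverse double points, together with over/under information at the double points,
recorded by a height function `height` that separates the two strands at each of them (the greater
height is over). Only the order of the two heights at a double point matters, see `IsotopicDiagrams`.
Transversality: in a suitable coordinate chart `ψ` around the double point, the two branches of the
curve run along the two coordinate axes. -/
structure Diagram (S : Type*) [TopologicalSpace S] where
  curve : UnitAddCircle → S
  height : UnitAddCircle → ℝ
  continuous_curve : Continuous curve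
  continuous_height : Continuous height
  height_ne : ∀ s t, s ≠ t → curve s = curve t → height s ≠ height t
  finite_double : {p : UnitAddCircle × UnitAddCircle | p.1 ≠ p.2 ∧ curve p.1 = curve p.2}.Finite
  no_triple : ∀ r s t, curve r = curve s → curve s = curve t → r = s ∨ s = t ∨ r = t
  transverse : ∀ s t, s ≠ t → curve s = curve t →
    ∃ ψ : Plane → S, IsOpenEmbedding ψ ∧ ψ (0, 0) = curve s ∧
      (∀ᶠ u in 𝓝 s, ∃ x : ℝ, curve u = ψ (x, 0)) ∧
      (∀ᶠ u in 𝓝 t, ∃ y : ℝ, curve u = ψ (0, y))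

/-- Two diagrams on `S` agree up to isotopy of `S`: an isotopy of `S` takes the first (unoriented)
curve to the second and respects over and under at every double point. -/
def IsotopicDiagrams {S : Type*} [TopologicalSpace S] (D E : Diagram S) : Prop :=
  ∃ φ : S ≃ₜ S, IsotopicToId φ ∧ ∃ θ : UnitAddCircle ≃ₜ UnitAddCircle,
    (∀ t, E.curve (θ t) = φ (D.curve t)) ∧
    ∀ s t, s ≠ t → D.curve s = D.curve t →
      (D.height s < D.height t ↔ E.height (θ s) < E.height (θ t))

theorem IsotopicDiagrams.refl {S : Type*} [TopologicalSpace S] (D : Diagram S) :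
    IsotopicDiagrams D D :=
  ⟨Homeomorph.refl S, IsotopicToId.refl S, Homeomorph.refl _, fun _ => rfl, fun _ _ _ _ => Iff.rfl⟩

theorem IsotopicDiagrams.symm {S : Type*} [TopologicalSpace S] {D E : Diagram S}
    (h : IsotopicDiagrams D E) : IsotopicDiagrams E D := by
  obtain ⟨φ, hφ, θ, h1, h2⟩ := h
  have key : ∀ t, D.curve (θ.symm t) = φ.symm (E.curve t) := fun t => by
    have := h1 (θ.symm t)
    rw [θ.apply_symm_apply] at this
    rw [this, φ.symm_apply_apply]
  refine ⟨φ.symm, hφ.symm, θ.symm, key, fun s t hst he => ?_⟩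
  have := h2 (θ.symm s) (θ.symm t) (fun h => hst (θ.symm.injective h))
    (by rw [key, key, he])
  rw [θ.apply_symm_apply, θ.apply_symm_apply] at this
  exact this.symm

theorem IsotopicDiagrams.trans {S : Type*} [TopologicalSpace S] {D E F : Diagram S}
    (h : IsotopicDiagrams D E) (k : IsotopicDiagrams E F) : IsotopicDiagrams D F := by
  obtain ⟨φ, hφ, θ, h1, h2⟩ := h
  obtain ⟨ψ, hψ, η, k1, k2⟩ := k
  refine ⟨φ.trans ψ, hφ.trans hψ, θ.trans η, fun t => ?_, fun s t hst he => ?_⟩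
  · simp only [Homeomorph.trans_apply, k1, h1]
  · simp only [Homeomorph.trans_apply]
    exact (h2 s t hst he).trans
      (k2 _ _ (fun h => hst (θ.injective h)) (by rw [h1, h1, he]))

/-- Isotopy of diagrams on `S`. -/
instance diagramSetoid (S : Type*) [TopologicalSpace S] : Setoid (Diagram S) where
  r := IsotopicDiagrams
  iseqv := ⟨IsotopicDiagrams.refl, IsotopicDiagrams.symm, IsotopicDiagrams.trans⟩

/-- Diagrams on `S` up to isotopy of `S`. -/
def DiagramClass (S : Type*) [TopologicalSpace S] : Type _ := Quotient (diagramSetoid S)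

/-! ## Reidemeister moves -/

/-- The closed square in which the local pictures of the moves are drawn. -/
def square : Set Plane := Icc (-1) 1 ×ˢ Icc (-1) 1

/-- A local move: two pictures in `square`, each made of `strands` arcs parametrized by `[-1, 1]`,
the corresponding arcs having the same endpoints on the boundary of `square`. At a crossing
of either picture, the strand of greater `level` is over. -/
structure LocalMove where
  strands : ℕ
  before : Fin strands → ℝ → Plane
  after : Fin strands → ℝ → Plane
  level : Fin strands → ℝ → ℝ

/-- The first Reidemeister move: a straight strand becomes a curl, with one crossing at the
parameters `± 1 / √2`, the first passage being over. The other curls arise by reflecting the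
picture, charts being allowed to reverse orientation in `IsLocalMove`. -/
def omega1 : LocalMove where
  strands := 1
  before := ![fun u => (u, 0)]
  after := ![fun u => (2 * u ^ 3 - u, (1 - u ^ 2) / 2)]
  level := ![fun u => -u]

/-- The second Reidemeister move: two parallel strands become two strands that cross twice, the
first one being over at both crossings. -/
def omega2 : LocalMove where
  strands := 2
  before := ![fun u => (u, 1 / 2), fun u => (u, -(1 / 2))]
  after := ![fun u => (u, u ^ 2 - 1 / 2), fun u => (u, 1 / 2 - u ^ 2)]
  level := ![fun _ => 1, fun _ => 0]

/-- The third Reidemeister move: a strand moves from one side to the other of the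
crossing of two strands that both lie below it. -/
def omega3 : LocalMove where
  strands := 3
  before := ![fun u => (u, (1 - u ^ 2) / 2), fun u => (u, u), fun u => (u, -u)]
  after := ![fun u => (u, (u ^ 2 - 1) / 2), fun u => (u, u), fun u => (u, -u)]
  level := ![fun _ => 2, fun _ => 1, fun _ => 0]

/-- `E` is obtained from `D` by performing the local move `M` once: there is a coordinate chart `ψ`
of `S` and there are pairwise disjoint arcs `a i` of the circle such that, on these arcs, `D` and `E`
are the `ψ`-images of the two pictures of `M`; off these arcs, `D` and `E` coincide and do not
meet the `ψ`-image of the square. -/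
def IsLocalMove {S : Type*} [TopologicalSpace S] (M : LocalMove) (D E : Diagram S) : Prop :=
  ∃ (ψ : Plane → S) (a : Fin M.strands → Icc (-1 : ℝ) 1 → UnitAddCircle),
    IsOpenEmbedding ψ ∧
    (∀ i, Continuous (a i)) ∧
    (∀ i j u v, a i u = a j v → i = j ∧ u = v) ∧
    (∀ i u, D.curve (a i u) = ψ (M.before i u)) ∧
    (∀ i u, E.curve (a i u) = ψ (M.after i u)) ∧
    (∀ i j u v, a i u ≠ a j v → M.before i u = M.before j v →
      (D.height (a i u) < D.height (a j v) ↔ M.level i u < M.level j v)) ∧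
    (∀ i j u v, a i u ≠ a j v → M.after i u = M.after j v →
      (E.height (a i u) < E.height (a j v) ↔ M.level i u < M.level j v)) ∧
    (∀ t, (∀ i u, a i u ≠ t) → E.curve t = D.curve t ∧ D.curve t ∉ ψ '' square) ∧
    (∀ s t, (∀ i u, a i u ≠ s) → (∀ i u, a i u ≠ t) → s ≠ t → D.curve s = D.curve t →
      (D.height s < D.height t ↔ E.height s < E.height t))

/-- `D` and `E` differ by a single Reidemeister move (done or undone). -/
def ReidemeisterMove {S : Type*} [TopologicalSpace S] (D E : Diagram S) : Prop :=
  ∃ M : LocalMove, (M = omega1 ∨ M = omega2 ∨ M = omega3) ∧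
    (IsLocalMove M D E ∨ IsLocalMove M E D)

/-! ## The Reidemeister graphs -/

/-- `D` is a diagram of the knot `K`, where `ι : S × ℝ → ThreeSphere` is the embedding of the thickened
surface: the curve on `S × ℝ` above `D` is a knot of the knot type of `K`. -/
def Diagram.Represents {S : Type*} [TopologicalSpace S] (ι : S × ℝ → ThreeSphere)
    (D : Diagram S) (K : UnitAddCircle → ThreeSphere) : Prop :=
  AmbientIsotopic (range fun t => ι (D.curve t, D.height t)) (range K)

/-- The vertices of the Reidemeister graph on `S`: isotopy classes of diagrams of `K`. -/
def Vertex {S : Type*} [TopologicalSpace S] (ι : S × ℝ → ThreeSphere)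
    (K : UnitAddCircle → ThreeSphere) : Type _ :=
  {c : DiagramClass S // ∃ D : Diagram S, Quotient.mk (diagramSetoid S) D = c ∧ D.Represents ι K}

/-- The Reidemeister graph of `K` on `S`. Only adjacency is recorded: multiple edges do not
affect the path metric. -/
def graphOn {S : Type*} [TopologicalSpace S] (ι : S × ℝ → ThreeSphere)
    (K : UnitAddCircle → ThreeSphere) : SimpleGraph (Vertex ι K) :=
  SimpleGraph.fromRel fun c e => ∃ D E : Diagram S,
    Quotient.mk (diagramSetoid S) D = c.1 ∧ Quotient.mk (diagramSetoid S) E = e.1 ∧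
      ReidemeisterMove D E

/-- The thickened plane in the 3-sphere; the height is the third coordinate. -/
def planeEmbedding (p : Plane × ℝ) : ThreeSphere := ((!₂[p.1.1, p.1.2, p.2] : Space) : ThreeSphere)

/-- The thickened 2-sphere in the 3-sphere: `S² × ℝ` is the punctured 3-space, the height growing
in the outward radial direction. -/
def sphereEmbedding (p : TwoSphere × ℝ) : ThreeSphere :=
  ((Real.exp p.2 • (p.1 : Space) : Space) : ThreeSphere)

/-- The planar Reidemeister graph of the knot `K`. -/
abbrev planarGraph (K : UnitAddCircle → ThreeSphere) : SimpleGraph (Vertex planeEmbedding K) :=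
  graphOn planeEmbedding K

/-- The Reidemeister graph of the knot `K` on the 2-sphere. -/
abbrev sphericalGraph (K : UnitAddCircle → ThreeSphere) : SimpleGraph (Vertex sphereEmbedding K) :=
  graphOn sphereEmbedding K

/-! ## Gromov hyperbolicity -/

/-- The graph `G` with its path metric is Gromov hyperbolic: for some `δ` the four-point
condition holds. (The points are taken in one connected component, where the path metric is finite.) -/
def IsGromovHyperbolic {V : Type*} (G : SimpleGraph V) : Prop :=
  ∃ δ : ℝ, ∀ w x y z : V, G.Reachable w x → G.Reachable w y → G.Reachable w z →
    (G.dist w x : ℝ) + G.dist y z ≤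
      max ((G.dist w y : ℝ) + G.dist x z) ((G.dist w z : ℝ) + G.dist x y) + 2 * δ

end KnotDiagrams

end

noncomputable section

namespace KnotDiagrams

/-! ## Non-hyperbolicity from a grid -/

section Graph

variable {V : Type*} {G : SimpleGraph V}

/-! Two numerical invariants of diagrams carry the proof. The first is the crossing number, counted
as the number of over-passages. For the second, traverse the curve from a base point, give each
over-passage the sign (-1)^k, where k is the number of double point parameters met before it, and
take the absolute value of the sum of these signs (`Diagram.index`). A diagram has evenly many
double point parameters, so changing the base point or the orientation multiplies all the signs by a
common factor and the absolute value is well defined (`abs_alt_homeo`).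

A move alters the picture only along a few strands, and each strand carries an even number of double
point parameters both before and after. Hence the rest of the sum is unaffected, and each strand
contributes an alternating sum of its own (`alt_split`, `IsLocalMove.invariants`). Two over-passages
that are consecutive on a strand cancel. This gives: Ω₁ changes the crossing number by 1 and the
index by at most 1; Ω₂ changes the crossing number by 2 and leaves the index alone; Ω₃ keeps the
crossing number and changes the index by at most 2. In every case the two changes add up to at most
2 (`ReidemeisterMove.invariants`), so half the sum and half the difference of the two invariants are
1-Lipschitz functions on the Reidemeister graph.

Conversely, these two functions can be increased independently. A curl inserted in a strand adds one
crossing and adds ±1 to the alternating sum, according to whether its over-passage comes first or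
second. Inserting curls of both kinds, after enough curls of one kind to fix the sign of the sum,
gives arbitrarily large square grids whose edges are Ω₁ moves and whose coordinates are, up to
constants, the two Lipschitz functions (`exists_curl_grid`). Such grids rule out hyperbolicity
(`not_hyperbolic_of_grid`): in a hyperbolic graph a path that avoids a large ball around the
midpoint of a geodesic with the same ends is exponentially long, whereas three sides of a rectangle
have linear length.

The rest supplies the diagrams. A generic projection of a polygonal representative is a diagram with
a straight segment (`exists_diagram_with_slot`). The height along that segment is reshaped into a
steep valley (`exists_diagram_with_valley`): on the descending slope a curl has its over-passage
first, on the ascending slope second, and the steepness makes the curl a small Lipschitz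
perturbation of the space curve, which preserves the knot type (`ambientIsotopic_of_lipschitz`).
Central projection of the plane to a hemisphere carries the whole grid to the sphere
(`exists_isLift`). -/

theorem abs_sub_le_length {F : V → ℝ} (hF : ∀ u v, G.Adj u v → |F u - F v| ≤ 1) {u v : V}
    (p : G.Walk u v) : |F u - F v| ≤ p.length := by
  induction p with
  | nil => simp
  | cons h p ih =>
    have h1 := hF _ _ h
    rw [SimpleGraph.Walk.length_cons]
    push_cast
    have := abs_sub_le (F _) (F _) (F _) |>.trans (add_le_add h1 ih)
    linarith

theorem abs_sub_le_dist {F : V → ℝ} (hF : ∀ u v, G.Adj u v → |F u - F v| ≤ 1) {u v : V}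
    (h : G.Reachable u v) : |F u - F v| ≤ G.dist u v := by
  obtain ⟨p, hp⟩ := h.exists_walk_length_eq_dist
  rw [← hp]
  exact abs_sub_le_length hF p

theorem exists_walk_of_chain (p : ℕ → V) (n : ℕ)
    (hp : ∀ i < n, G.Adj (p i) (p (i + 1)) ∨ p i = p (i + 1)) :
    ∃ w : G.Walk (p 0) (p n), w.length ≤ n := by
  induction n with
  | zero => exact ⟨.nil, by simp⟩
  | succ n ih =>
    obtain ⟨w, hw⟩ := ih fun i hi => hp i (by omega)
    rcases hp n (by omega) with h | h
    · exact ⟨w.concat h, by rw [SimpleGraph.Walk.length_concat]; omega⟩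
    · exact ⟨w.copy rfl h, by simp; omega⟩

/-- Gromov products along a chain of `2 ^ k` short steps which stays far from the base point `o`. -/
theorem gromov_product_chain {δ R : ℝ}
    (hδ : ∀ w x y z : V, G.Reachable w x → G.Reachable w y → G.Reachable w z →
      (G.dist w x : ℝ) + G.dist y z ≤
        max ((G.dist w y : ℝ) + G.dist x z) ((G.dist w z : ℝ) + G.dist x y) + 2 * δ)
    (o : V) (k : ℕ) : ∀ p : ℕ → V, (∀ i ≤ 2 ^ k, G.Reachable o (p i)) →
      (∀ i < 2 ^ k, (G.dist (p i) (p (i + 1)) : ℝ) ≤ 1) →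
      (∀ i ≤ 2 ^ k, R ≤ G.dist o (p i)) →
      2 * R - 1 - 2 * δ * k ≤ (G.dist o (p 0) : ℝ) + G.dist o (p (2 ^ k)) - G.dist (p 0) (p (2 ^ k)) := by
  induction k with
  | zero =>
    intro p _ h1 h2
    have a := h2 0 (by norm_num)
    have b := h2 1 (by norm_num)
    have c := h1 0 (by norm_num)
    simp only [pow_zero, Nat.cast_zero, zero_add] at *
    linarith
  | succ k ih =>
    intro p hr h1 h2
    have e : 2 ^ (k + 1) = 2 ^ k + 2 ^ k := by ring
    have a := ih p (fun i hi => hr i (by omega)) (fun i hi => h1 i (by omega))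
      fun i hi => h2 i (by omega)
    have b := ih (fun i => p (2 ^ k + i)) (fun i hi => hr _ (by omega))
      (fun i hi => h1 (2 ^ k + i) (by omega)) fun i hi => h2 _ (by omega)
    have hpos : 0 < 2 ^ k := by positivity
    simp only [add_zero, ← e] at b
    -- Cut the chain at its midpoint: the Gromov product of the ends is at least the smaller of the
    -- products of the two halves, up to δ. So each doubling of the length costs only a constant.
    have c := hδ o (p (2 ^ k)) (p 0) (p (2 ^ (k + 1))) (hr _ (by omega)) (hr _ (Nat.zero_le _))
      (hr _ le_rfl)
    rw [G.dist_comm (u := p (2 ^ k)) (v := p 0)] at c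
    push_cast
    rcases max_cases ((G.dist o (p 0) : ℝ) + G.dist (p (2 ^ k)) (p (2 ^ (k + 1))))
      ((G.dist o (p (2 ^ (k + 1))) : ℝ) + G.dist (p 0) (p (2 ^ k))) with ⟨h, -⟩ | ⟨h, -⟩ <;>
    · rw [h] at c
      linarith

/-- A graph containing arbitrarily large grids whose coordinates are given by functions that are
`1`-Lipschitz on the graph is not hyperbolic. -/
theorem not_hyperbolic_of_grid (F₁ F₂ : V → ℝ)
    (h₁ : ∀ u v, G.Adj u v → |F₁ u - F₁ v| ≤ 1) (h₂ : ∀ u v, G.Adj u v → |F₂ u - F₂ v| ≤ 1)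
    (grid : ∀ N : ℕ, ∃ (g : ℕ → ℕ → V) (c₁ c₂ : ℝ),
      (∀ i j, i < N → j ≤ N → G.Adj (g i j) (g (i + 1) j) ∨ g i j = g (i + 1) j) ∧
      (∀ i j, i ≤ N → j < N → G.Adj (g i j) (g i (j + 1)) ∨ g i j = g i (j + 1)) ∧
      ∀ i j, i ≤ N → j ≤ N → F₁ (g i j) = c₁ + i ∧ F₂ (g i j) = c₂ + j) :
    ¬ IsGromovHyperbolic G := by
  rintro ⟨δ, hδ⟩
  -- An exponential beats a linear function. The term `l + 2` is the logarithm of the length 4m of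
  -- the path used below, with m = 2 ^ l.
  obtain ⟨l, hl⟩ : ∃ l : ℕ, 1 + 2 * δ * (l + 2 : ℕ) < 2 * (2 : ℝ) ^ l := by
    have h := (tendsto_pow_const_div_const_pow_of_one_lt 1 (one_lt_two : (1 : ℝ) < 2))
    have h0 := (tendsto_pow_const_div_const_pow_of_one_lt 0 (one_lt_two : (1 : ℝ) < 2))
    have h3 := ((h0.const_mul (1 + 4 * δ)).add (h.const_mul (2 * δ)))
    simp only [mul_zero, add_zero] at h3
    obtain ⟨l, hl⟩ := (h3.eventually (gt_mem_nhds (one_pos))).exists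
    refine ⟨l, ?_⟩
    have h2 : (0 : ℝ) < 2 ^ l := by positivity
    rw [← mul_div_assoc, ← mul_div_assoc, ← add_div, div_lt_one h2] at hl
    push_cast
    simp only [pow_zero, pow_one] at hl
    linarith
  set m := 2 ^ l with hm
  obtain ⟨g, c₁, c₂, hi, hj, hF⟩ := grid (2 * m)
  have hrow : ∀ j ≤ 2 * m, ∀ i ≤ 2 * m, ∃ w : G.Walk (g 0 j) (g i j), w.length ≤ i :=
    fun j hj' i hi' => exists_walk_of_chain (fun i => g i j) i fun i' hi'' => hi i' j (by omega) hj'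
  have hcol : ∀ i ≤ 2 * m, ∀ j ≤ 2 * m, ∃ w : G.Walk (g i 0) (g i j), w.length ≤ j :=
    fun i hi' j hj' => exists_walk_of_chain (fun j => g i j) j fun j' hj'' => hj i j' hi' (by omega)
  have reach0 : ∀ i ≤ 2 * m, ∀ j ≤ 2 * m, G.Reachable (g 0 0) (g i j) := fun i hi' j hj' => by
    obtain ⟨w, -⟩ := hrow 0 (by omega) i hi'
    obtain ⟨w', -⟩ := hcol i hi' j hj'
    exact ⟨w.append w'⟩
  have reach : ∀ i ≤ 2 * m, ∀ j ≤ 2 * m, G.Reachable (g m 0) (g i j) := fun i hi' j hj' =>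
    (reach0 m (by omega) 0 (by omega)).symm.trans (reach0 i hi' j hj')
  -- Three sides of the rectangle [0, 2m] × [0, m], in 4m steps. Each point of the path differs from
  -- the midpoint (m, 0) of the fourth side by m in at least one coordinate.
  let p : ℕ → V := fun i => if i ≤ m then g 0 i else if i ≤ 3 * m then g (i - m) m
    else g (2 * m) (4 * m - i)
  have hpg : ∀ i ≤ 4 * m, ∃ a b, a ≤ 2 * m ∧ b ≤ 2 * m ∧ p i = g a b ∧
      ((a = 0 ∨ a = 2 * m) ∨ b = m) := by
    intro i hi'
    simp only [p]
    split_ifs with h1 h2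
    · exact ⟨0, i, by omega, by omega, rfl, by simp⟩
    · exact ⟨i - m, m, by omega, by omega, rfl, by simp⟩
    · exact ⟨2 * m, 4 * m - i, by omega, by omega, rfl, by simp⟩
  have e4 : 2 ^ (l + 2) = 4 * m := by rw [hm]; ring
  have key := gromov_product_chain (R := m) hδ (g m 0) (l + 2) p ?_ ?_ ?_
  · rw [e4] at key
    have p0 : p 0 = g 0 0 := by simp [p]
    have p1 : p (4 * m) = g (2 * m) 0 := by
      have : 0 < m := by positivity
      simp only [p]
      rw [if_neg (by omega), if_neg (by omega)]
      simp
    rw [p0, p1] at key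
    have d1 : (G.dist (g m 0) (g 0 0) : ℝ) ≤ m := by
      obtain ⟨w, hw⟩ := hrow 0 (by omega) m (by omega)
      rw [G.dist_comm]
      exact_mod_cast (SimpleGraph.dist_le w).trans hw
    have d2 : (G.dist (g m 0) (g (2 * m) 0) : ℝ) ≤ m := by
      obtain ⟨w, hw⟩ := exists_walk_of_chain (G := G) (fun i => g (m + i) 0) m
        fun i' hi'' => hi (m + i') 0 (by omega) (by omega)
      have := (SimpleGraph.dist_le w).trans hw
      rw [show m + m = 2 * m by ring] at this
      exact_mod_cast this
    -- The fourth side is a geodesic because `F₁` grows by 2m along it; hence the Gromov product of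
    -- its ends at its midpoint is not positive.
    have d3 : (2 * m : ℝ) ≤ G.dist (g 0 0) (g (2 * m) 0) := by
      have := abs_sub_le_dist h₁ (reach0 (2 * m) le_rfl 0 (by omega))
      rw [(hF 0 0 (by omega) (by omega)).1, (hF (2 * m) 0 (by omega) (by omega)).1] at this
      have h' := (neg_le_abs _).trans this
      push_cast at h'
      linarith
    have hml : (m : ℝ) = 2 ^ l := by rw [hm]; push_cast; rfl
    rw [← hml] at hl
    linarith
  · intro i hi'
    obtain ⟨a, b, ha, hb, h, -⟩ := hpg i (by omega)
    rw [h]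
    exact reach a ha b hb
  · intro i hi'
    have : G.Adj (p i) (p (i + 1)) ∨ p i = p (i + 1) := by
      rw [e4] at hi'
      simp only [p]
      rcases lt_trichotomy i m with h | h | h
      · rw [if_pos (by omega), if_pos (by omega)]
        exact hj 0 i (by omega) (by omega)
      · rw [h, if_pos le_rfl, if_neg (by omega), if_pos (by omega)]
        have := hi 0 m (by omega) (by omega)
        simpa using this
      · rcases lt_trichotomy i (3 * m) with h' | h' | h'
        · rw [if_neg (by omega), if_pos (by omega), if_neg (by omega), if_pos (by omega)]
          have := hi (i - m) m (by omega) (by omega)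
          rwa [show i - m + 1 = i + 1 - m by omega] at this
        · rw [if_neg (by omega), if_pos (by omega), if_neg (by omega), if_neg (by omega)]
          have := hj (2 * m) (m - 1) (by omega) (by omega)
          rw [show m - 1 + 1 = m by omega] at this
          rw [show i - m = 2 * m by omega, show 4 * m - (i + 1) = m - 1 by omega]
          exact this.imp (·.symm) (·.symm)
        · rw [if_neg (by omega), if_neg (by omega), if_neg (by omega), if_neg (by omega)]
          have := hj (2 * m) (4 * m - (i + 1)) (by omega) (by omega)
          rw [show 4 * m - (i + 1) + 1 = 4 * m - i by omega] at this
          exact this.imp (·.symm) (·.symm)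
    rcases this with h | h
    · rw [SimpleGraph.dist_eq_one_iff_adj.2 h]; simp
    · rw [h]; simp
  · intro i hi'
    obtain ⟨a, b, ha, hb, h, hab⟩ := hpg i (by omega)
    rw [h]
    have r := reach a ha b hb
    have e1 := abs_sub_le_dist h₁ r
    have e2 := abs_sub_le_dist h₂ r
    rw [(hF m 0 (by omega) (by omega)).1, (hF a b ha hb).1] at e1
    rw [(hF m 0 (by omega) (by omega)).2, (hF a b ha hb).2] at e2
    rw [abs_le] at e1 e2
    rcases hab with (rfl | rfl) | rfl <;> push_cast at * <;> linarith

end Graph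

/-! ## Alternating sums over points of a circle -/

section Alt

open Classical

variable {α β : Type*}

/-- The sign contributed by the points of `P` lying in `A`. -/
def signIn (P : Finset α) (A : Set α) : ℤ := ∏ s ∈ P, if s ∈ A then -1 else 1

/-- The sum over `O` of the signs given by the position in `P`, for the order induced by `ρ`. -/
def alt (ρ : α → ℝ) (P O : Finset α) : ℤ := ∑ t ∈ O, signIn P {s | ρ s < ρ t}

theorem signIn_mul_self (P : Finset α) (A : Set α) : signIn P A * signIn P A = 1 := by
  rw [signIn, ← Finset.prod_mul_distrib]
  exact Finset.prod_eq_one fun s _ => by split_ifs <;> norm_num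

theorem signIn_cases (P : Finset α) (A : Set α) : signIn P A = 1 ∨ signIn P A = -1 :=
  mul_self_eq_one_iff.1 (signIn_mul_self P A)

theorem signIn_congr {P : Finset α} {A B : Set α} (h : ∀ s ∈ P, s ∈ A ↔ s ∈ B) :
    signIn P A = signIn P B :=
  Finset.prod_congr rfl fun s hs => by simp only [h s hs]

theorem signIn_map (e : α ≃ β) (P : Finset α) (A : Set α) :
    signIn (P.map e.toEmbedding) (e '' A) = signIn P A := by
  rw [signIn, Finset.prod_map]
  exact Finset.prod_congr rfl fun s _ => by simp

/-- Points before t count twice and cancel. What remains are the points strictly between and t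
itself, which is responsible for the minus sign. -/
theorem signIn_mul_of_lt {ρ : α → ℝ} (hρ : Function.Injective ρ) {P : Finset α} {t t' : α}
    (ht : t ∈ P) (h : ρ t < ρ t') :
    signIn P {s | ρ s < ρ t} * signIn P {s | ρ s < ρ t'} =
      - signIn P {s | ρ t < ρ s ∧ ρ s < ρ t'} := by
  have : (-1 : ℤ) = ∏ s ∈ P, if t = s then -1 else 1 := by simp [Finset.prod_ite_eq, ht]
  rw [neg_eq_neg_one_mul, this, signIn, signIn, signIn, ← Finset.prod_mul_distrib,
    ← Finset.prod_mul_distrib]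
  refine Finset.prod_congr rfl fun s _ => ?_
  simp only [mem_ofPred_eq]
  rcases lt_trichotomy (ρ s) (ρ t) with h1 | h1 | h1
  · have : t ≠ s := by rintro rfl; exact lt_irrefl _ h1
    simp [h1, h1.trans h, this, h1.not_gt]
  · have := hρ h1; subst this; simp [h]
  · have : t ≠ s := by rintro rfl; exact lt_irrefl _ h1
    simp [h1, h1.not_gt, this]

/-- Together A and B contain all points of P except t and t', an even number, so the parities agree.
This is what makes the choice between the two arcs joining t and t' irrelevant. -/
theorem signIn_eq_of_compl {P : Finset α} (hP : Even P.card) {t t' : α} (ht : t ∈ P) (ht' : t' ∈ P)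
    (htt : t ≠ t') {A B : Set α} (hAB : Disjoint A B) (hU : A ∪ B = {t, t'}ᶜ) :
    signIn P A = signIn P B := by
  have key : signIn P A * signIn P B * ((∏ s ∈ P, if t = s then -1 else 1) *
      ∏ s ∈ P, if t' = s then -1 else 1) = ∏ s ∈ P, (-1 : ℤ) := by
    rw [signIn, signIn, ← Finset.prod_mul_distrib, ← Finset.prod_mul_distrib,
      ← Finset.prod_mul_distrib]
    refine Finset.prod_congr rfl fun s _ => ?_
    have h1 : s ∈ A ∪ B ↔ s ∈ ({t, t'} : Set α)ᶜ := by rw [hU]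
    have h2 : s ∈ A → s ∉ B := fun h => disjoint_left.1 hAB h
    simp only [mem_union, mem_compl_iff, mem_insert_iff, mem_singleton_iff, not_or] at h1
    by_cases ha : s ∈ A
    · have h3 := h1.1 (Or.inl ha)
      simp [ha, h2 ha, Ne.symm h3.1, Ne.symm h3.2]
    · by_cases hb : s ∈ B
      · have h3 := h1.1 (Or.inr hb)
        simp [ha, hb, Ne.symm h3.1, Ne.symm h3.2]
      · simp only [ha, hb, or_self, false_iff, not_and, not_not] at h1
        by_cases hst : t = s
        · subst hst; simp [ha, hb, Ne.symm htt]
        · have := h1 (Ne.symm hst); subst this; simp [ha, hb, hst]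
  rw [Finset.prod_const, hP.neg_one_pow] at key
  simp only [Finset.prod_ite_eq, ht, ht', if_true, mul_neg, mul_one, neg_neg] at key
  rcases signIn_cases P A with h | h <;> rcases signIn_cases P B with h' | h' <;>
    rw [h, h'] at key ⊢ <;> norm_num at key

/-- The square removes the common sign: it involves only products of two signs, which depend on the
arc between two points and no longer on the base point. -/
theorem sq_alt (ρ : α → ℝ) (P O : Finset α) :
    alt ρ P O ^ 2 = ∑ t ∈ O, ∑ t' ∈ O, signIn P {s | ρ s < ρ t} * signIn P {s | ρ s < ρ t'} := by
  rw [sq, alt, Finset.sum_mul_sum]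

/-- Each piece, being preconnected, lies inside one piece of the other decomposition. The only
delicate case is that of an empty piece, which preconnectedness allows. -/
theorem eq_or_eq_of_preconnected [TopologicalSpace α] {A B A' B' : Set α}
    (hA : IsOpen A) (hB : IsOpen B) (hA' : IsOpen A') (hB' : IsOpen B')
    (cA : IsPreconnected A) (cB : IsPreconnected B) (cA' : IsPreconnected A')
    (cB' : IsPreconnected B') (hAB : Disjoint A B) (hAB' : Disjoint A' B')
    (h : A ∪ B = A' ∪ B') : A' = A ∨ A' = B := by
  have h1 := cA.subset_or_subset hA' hB' hAB' (h ▸ subset_union_left)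
  have h2 := cA'.subset_or_subset hA hB hAB (h ▸ subset_union_left)
  have h3 := cB'.subset_or_subset hA hB hAB (h ▸ subset_union_right)
  have h4 := cB.subset_or_subset hA' hB' hAB' (h ▸ subset_union_right)
  have hempty : A' ⊆ B' → A' = A ∨ A' = B := fun h5 => by
    have e : A' = ∅ := disjoint_self.1 (hAB'.mono_right h5)
    rw [e, empty_union] at h
    rcases h3 with h3 | h3
    · exact Or.inr (e.trans (disjoint_self.1 (hAB.mono_left
        ((subset_union_right.trans h.subset).trans h3))).symm)
    · exact Or.inl (e.trans (disjoint_self.1 (hAB.mono_right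
        ((subset_union_left.trans h.subset).trans h3))).symm)
  rcases h2 with h2 | h2
  · rcases h1 with h1 | h1
    · exact Or.inl (h2.antisymm h1)
    · exact hempty (h2.trans h1)
  · rcases h4 with h4 | h4
    · exact Or.inr (h2.antisymm h4)
    · exact hempty (h2.trans h4)

/-- The complement of the union of the sets `I i`. -/
def offSet {ι : Type*} (I : ι → Set α) : Set α := {t | ∀ i, t ∉ I i}

theorem mem_offSet {ι : Type*} {I : ι → Set α} {t : α} : t ∈ offSet I ↔ ∀ i, t ∉ I i := Iff.rfl

/-- Splitting off disjoint intervals containing evenly many points. -/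
theorem alt_split {ι : Type*} [Fintype ι] (ρ : α → ℝ) (P O : Finset α) (I : ι → Set α) (x : ι → α)
    (hx : ∀ i, x i ∈ I i) (hdisj : ∀ i j t, t ∈ I i → t ∈ I j → i = j)
    (hconv : ∀ i, ∀ t ∉ I i, ∀ y ∈ I i, ∀ z ∈ I i, (ρ y < ρ t ↔ ρ z < ρ t))
    (hconv' : ∀ i, ∀ t ∉ I i, ∀ y ∈ I i, ∀ z ∈ I i, (ρ t < ρ y ↔ ρ t < ρ z))
    (heven : ∀ i, Even (P.filter (· ∈ I i)).card) :
    alt ρ P O = alt ρ (P.filter (· ∈ offSet I)) (O.filter (· ∈ offSet I)) +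
      ∑ i, signIn (P.filter (· ∈ offSet I)) {s | ρ s < ρ (x i)} *
        alt ρ (P.filter (· ∈ I i)) (O.filter (· ∈ I i)) := by
  -- Stated for a general commutative monoid so as to serve twice: for the products of signs, and
  -- through `Multiplicative ℤ` for the sum over O.
  have split : ∀ {M : Type} [CommMonoid M] (Q : Finset α) (g : α → M),
      ∏ t ∈ Q, g t = (∏ t ∈ Q.filter (· ∈ offSet I), g t) *
        ∏ i, ∏ t ∈ Q.filter (· ∈ I i), g t := by
    intro M _ Q g
    rw [← Finset.prod_filter_mul_prod_filter_not Q (· ∈ offSet I)]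
    congr 1
    rw [← Finset.prod_biUnion]
    · refine Finset.prod_congr ?_ fun _ _ => rfl
      ext t
      simp [mem_offSet]
    · intro i _ j _ hij
      refine Finset.disjoint_left.2 fun t h1 h2 => hij ?_
      exact hdisj i j t (Finset.mem_filter.1 h1).2 (Finset.mem_filter.1 h2).2
  have splitS : ∀ (Q : Finset α) (g : α → ℤ),
      ∑ t ∈ Q, g t = (∑ t ∈ Q.filter (· ∈ offSet I), g t) +
        ∑ i, ∑ t ∈ Q.filter (· ∈ I i), g t := fun Q g => by
    have := split (M := Multiplicative ℤ) Q fun t => Multiplicative.ofAdd (g t)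
    rw [← ofAdd_sum, ← ofAdd_sum] at this
    simp only [← ofAdd_sum] at this
    exact this
  -- Seen from outside, an interval lies entirely before or entirely after t; as it contains evenly
  -- many points of P, it contributes the sign 1 either way.
  have one : ∀ i, ∀ t ∉ I i, signIn (P.filter (· ∈ I i)) {s | ρ s < ρ t} = 1 := by
    intro i t ht
    by_cases h : ρ (x i) < ρ t
    · rw [signIn, Finset.prod_congr rfl (g := fun _ => (-1 : ℤ)), Finset.prod_const,
        (heven i).neg_one_pow]
      intro s hs
      have := (hconv i t ht s (Finset.mem_filter.1 hs).2 (x i) (hx i)).2 h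
      simp [this]
    · refine Finset.prod_eq_one fun s hs => ?_
      have := mt (hconv i t ht s (Finset.mem_filter.1 hs).2 (x i) (hx i)).1 h
      simp [this]
  have hs : ∀ t, signIn P {s | ρ s < ρ t} =
      signIn (P.filter (· ∈ offSet I)) {s | ρ s < ρ t} *
        ∏ i, signIn (P.filter (· ∈ I i)) {s | ρ s < ρ t} := fun t => split P _
  rw [alt, splitS O]
  congr 1
  · refine Finset.sum_congr rfl fun t ht => ?_
    rw [hs, Finset.prod_eq_one fun i _ => one i t (mem_offSet.1 (Finset.mem_filter.1 ht).2 i), mul_one]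
  · refine Finset.sum_congr rfl fun i _ => ?_
    rw [alt, Finset.mul_sum]
    refine Finset.sum_congr rfl fun t ht => ?_
    have ht' := (Finset.mem_filter.1 ht).2
    rw [hs, Finset.prod_eq_single i]
    · congr 1
      refine signIn_congr fun s hs => ?_
      exact hconv' i s (mem_offSet.1 (Finset.mem_filter.1 hs).2 i) t ht' (x i) (hx i)
    · exact fun j _ hj => one j t fun h => hj (hdisj j i t h ht')
    · simp

theorem alt_empty (ρ : α → ℝ) (P : Finset α) : alt ρ P ∅ = 0 := by simp [alt]

/-- The earlier point has sign 1 and the later one sign -1, whichever comes first. This is the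
cancellation along the upper strand in Ω₂ and along the top strand in Ω₃. -/
theorem alt_pair [DecidableEq α] {ρ : α → ℝ} (hρ : Function.Injective ρ) {p q : α} (h : p ≠ q) :
    alt ρ {p, q} {p, q} = 0 := by
  have h' : ρ p ≠ ρ q := fun e => h (hρ e)
  rcases lt_or_gt_of_ne h' with h1 | h1 <;>
    simp [alt, signIn, Finset.sum_pair h, Finset.prod_pair h, h1, h1.not_gt]

theorem alt_pair_single [DecidableEq α] {ρ : α → ℝ} {p q : α} (h : p ≠ q) :
    alt ρ {p, q} {p} = if ρ q < ρ p then -1 else 1 := by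
  simp [alt, signIn, Finset.prod_pair h]

theorem abs_alt_pair_single [DecidableEq α] {ρ : α → ℝ} {p q : α} (h : p ≠ q) :
    |alt ρ {p, q} {p}| = 1 := by
  rw [alt_pair_single h]; split_ifs <;> norm_num

end Alt

/-! ### Cyclic order on the circle and independence of the base point. -/

section Circle

open Classical

/-- The representative in `[0, 1)` of the position of `t` after the base point `b`. -/
def rep (b t : UnitAddCircle) : ℝ := (AddCircle.equivIco 1 0 (t - b) : ℝ)

theorem rep_mem (b t : UnitAddCircle) : rep b t ∈ Ico (0 : ℝ) 1 := by
  have := (AddCircle.equivIco 1 0 (t - b)).2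
  exact ⟨this.1, this.2.trans_eq (zero_add 1)⟩

theorem coe_rep (b t : UnitAddCircle) : ((rep b t : ℝ) : UnitAddCircle) = t - b :=
  (AddCircle.equivIco 1 0).symm_apply_apply (t - b)

theorem rep_injective (b : UnitAddCircle) : Function.Injective (rep b) := fun s t h => by
  have := congrArg (fun x : ℝ => (x : UnitAddCircle)) h
  simpa [coe_rep] using this

theorem rep_eq {b : UnitAddCircle} {x : ℝ} (hx : x ∈ Ico (0 : ℝ) 1) : rep b (x + b) = x := by
  rw [rep, add_sub_cancel_right, AddCircle.coe_equivIco_mk_apply]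
  simp [Int.fract_eq_self.2 hx]

theorem rep_zero_eq {x : ℝ} (hx : x ∈ Ico (0 : ℝ) 1) : rep 0 x = x := by
  simpa using rep_eq (b := 0) hx

theorem coe_rep_zero (t : UnitAddCircle) : ((rep 0 t : ℝ) : UnitAddCircle) = t := by
  rw [coe_rep, sub_zero]

theorem rep_self (b : UnitAddCircle) : rep b b = 0 := by
  simpa using rep_eq (b := b) (x := 0) (by simp)

/-- The open arc between the positions `x` and `y` after `b`. -/
def arc (b : UnitAddCircle) (x y : ℝ) : Set UnitAddCircle :=
  (fun r : ℝ => (r : UnitAddCircle) + b) '' Ioo x y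

theorem isOpen_arc (b : UnitAddCircle) (x y : ℝ) : IsOpen (arc b x y) := by
  have : IsOpenMap (fun r : ℝ => (r : UnitAddCircle) + b) :=
    (Homeomorph.addRight b).isOpenMap.comp QuotientAddGroup.isOpenMap_coe
  exact this _ isOpen_Ioo

theorem isPreconnected_arc (b : UnitAddCircle) (x y : ℝ) : IsPreconnected (arc b x y) :=
  isPreconnected_Ioo.image _ (Continuous.continuousOn (by
    have : Continuous fun r : ℝ => (r : UnitAddCircle) := AddCircle.continuous_mk' 1
    fun_prop))

theorem mem_arc {b : UnitAddCircle} {x y : ℝ} (hx : 0 ≤ x) (hy : y ≤ 1) {s : UnitAddCircle} :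
    s ∈ arc b x y ↔ x < rep b s ∧ rep b s < y := by
  constructor
  · rintro ⟨r, hr, rfl⟩
    rw [rep_eq ⟨hx.trans hr.1.le, hr.2.trans_le hy⟩]
    exact hr
  · intro h
    exact ⟨rep b s, h, by simp [coe_rep]⟩

/-- The arc that passes through the base point: positions beyond 1 are those at the beginning of the
next turn. -/
theorem mem_arc_wrap {b : UnitAddCircle} {x y : ℝ} (hx : 0 ≤ x) (hxy : x < y) (hy : y < 1)
    {s : UnitAddCircle} : s ∈ arc b y (x + 1) ↔ rep b s < x ∨ y < rep b s := by
  constructor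
  · rintro ⟨r, hr, rfl⟩
    rcases lt_or_ge r 1 with h | h
    · rw [rep_eq ⟨(hx.trans hxy.le).trans hr.1.le, h⟩]
      exact Or.inr hr.1
    · have e : ((r : ℝ) : UnitAddCircle) = ((r - 1 : ℝ) : UnitAddCircle) := by
        rw [AddCircle.coe_sub, AddCircle.coe_period, sub_zero]
      simp only [e]
      rw [rep_eq ⟨by linarith, by linarith [hr.2]⟩]
      exact Or.inl (by linarith [hr.2])
  · have h0 := rep_mem b s
    rintro (h | h)
    · refine ⟨rep b s + 1, ⟨by linarith [h0.1], by linarith⟩, ?_⟩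
      simp only
      rw [AddCircle.coe_add, AddCircle.coe_period, coe_rep]; simp
    · exact ⟨rep b s, ⟨h, by linarith [h0.2]⟩, by simp [coe_rep]⟩

/-- The product of the signs at two points is read off an arc between them, and that arc is one of
the two components of the complement, a notion that refers neither to a base point nor to an
orientation. -/
theorem exists_arcs (P : Finset UnitAddCircle) (b : UnitAddCircle) {t t' : UnitAddCircle}
    (ht : t ∈ P) (ht' : t' ∈ P) (htt : t ≠ t') :
    ∃ A B : Set UnitAddCircle, IsOpen A ∧ IsOpen B ∧ IsPreconnected A ∧ IsPreconnected B ∧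
      Disjoint A B ∧ A ∪ B = {t, t'}ᶜ ∧
      signIn P {s | rep b s < rep b t} * signIn P {s | rep b s < rep b t'} = - signIn P A := by
  wlog h : rep b t < rep b t' generalizing t t'
  · rw [mul_comm, pair_comm]
    exact this ht' ht htt.symm
      (lt_of_le_of_ne (not_lt.1 h) fun e => htt (rep_injective b e.symm))
  have m1 : ∀ s, s ∈ arc b (rep b t) (rep b t') ↔ _ := fun s =>
    mem_arc (rep_mem b t).1 (rep_mem b t').2.le
  have m2 : ∀ s, s ∈ arc b (rep b t') (rep b t + 1) ↔ _ := fun s =>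
    mem_arc_wrap (rep_mem b t).1 h (rep_mem b t').2
  refine ⟨_, _, isOpen_arc b (rep b t) (rep b t'), isOpen_arc b (rep b t') (rep b t + 1),
    isPreconnected_arc _ _ _, isPreconnected_arc _ _ _, ?_, ?_, ?_⟩
  · refine disjoint_left.2 fun s h1 h2 => ?_
    rw [m1] at h1; rw [m2] at h2
    rcases h2 with h2 | h2 <;> linarith [h1.1, h1.2]
  · ext s
    rw [mem_union, m1, m2]
    simp only [mem_compl_iff, mem_insert_iff, mem_singleton_iff, not_or]
    rw [← (rep_injective b).eq_iff (a := s), ← (rep_injective b).eq_iff (a := s)]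
    constructor
    · rintro (⟨h1, h3⟩ | h1 | h1) <;> constructor <;> intro h2 <;> linarith
    · rintro ⟨h1, h2⟩
      rcases lt_or_gt_of_ne h1 with h1 | h1
      · exact Or.inr (Or.inl h1)
      · rcases lt_or_gt_of_ne h2 with h2 | h2
        · exact Or.inl ⟨h1, h2⟩
        · exact Or.inr (Or.inr h2)
  · rw [signIn_mul_of_lt (rep_injective b) ht h]
    congr 2
    ext s
    exact (m1 s).symm

/-- A homeomorphism takes the two complementary arcs of t and t' to those of their images. They may
be exchanged, by a reversal of orientation or a change of base point, and then the evenness of P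
compensates. -/
theorem signIn_mul_homeo {P : Finset UnitAddCircle} (hP : Even P.card)
    (θ : UnitAddCircle ≃ₜ UnitAddCircle) (b b' : UnitAddCircle) {t t' : UnitAddCircle}
    (ht : t ∈ P) (ht' : t' ∈ P) (htt : t ≠ t') :
    signIn (P.map θ.toEquiv.toEmbedding) {s | rep b' s < rep b' (θ t)} *
      signIn (P.map θ.toEquiv.toEmbedding) {s | rep b' s < rep b' (θ t')} =
    signIn P {s | rep b s < rep b t} * signIn P {s | rep b s < rep b t'} := by
  obtain ⟨A, B, oA, oB, cA, cB, d, u, e⟩ := exists_arcs P b ht ht' htt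
  obtain ⟨A', B', oA', oB', cA', cB', d', u', e'⟩ :=
    exists_arcs (P.map θ.toEquiv.toEmbedding) b' (t := θ t) (t' := θ t')
      (by simpa using ht) (by simpa using ht') (θ.injective.ne htt)
  rw [e, e']
  have hun : θ '' A ∪ θ '' B = {θ t, θ t'}ᶜ := by
    rw [← image_union, u, image_compl_eq θ.bijective, image_pair]
  rcases eq_or_eq_of_preconnected (θ.isOpenMap _ oA) (θ.isOpenMap _ oB) oA' oB'
    (cA.image _ θ.continuous.continuousOn) (cB.image _ θ.continuous.continuousOn) cA' cB'
    ((disjoint_image_iff θ.injective).2 d) d' (hun.trans u'.symm) with h | h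
  · rw [h]; exact congrArg _ (signIn_map θ.toEquiv P A)
  · rw [h, signIn_eq_of_compl hP ht ht' htt d u]
    exact congrArg _ (signIn_map θ.toEquiv P B)

/-- Up to sign, the alternating sum does not depend on the base point and is invariant under
homeomorphisms of the circle. -/
theorem abs_alt_homeo {P O : Finset UnitAddCircle} (hP : Even P.card) (hO : O ⊆ P)
    (θ : UnitAddCircle ≃ₜ UnitAddCircle) (b b' : UnitAddCircle) :
    |alt (rep b') (P.map θ.toEquiv.toEmbedding) (O.map θ.toEquiv.toEmbedding)| =
      |alt (rep b) P O| := by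
  -- Comparing squares reduces the claim to pairs of points, where the invariance holds exactly and
  -- not only up to sign.
  rw [← sq_eq_sq_iff_abs_eq_abs, sq_alt, sq_alt, Finset.sum_map]
  refine Finset.sum_congr rfl fun t ht => ?_
  rw [Finset.sum_map]
  refine Finset.sum_congr rfl fun t' ht' => ?_
  rcases eq_or_ne t t' with rfl | hne
  · rw [signIn_mul_self, signIn_mul_self]
  · exact signIn_mul_homeo hP θ b b' (hO ht) (hO ht') hne

theorem abs_alt_base {P O : Finset UnitAddCircle} (hP : Even P.card) (hO : O ⊆ P)
    (b b' : UnitAddCircle) : |alt (rep b') P O| = |alt (rep b) P O| := by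
  have e : ∀ Q : Finset UnitAddCircle,
      Q.map (Homeomorph.refl UnitAddCircle).toEquiv.toEmbedding = Q := fun Q => by
    ext; simp
  simpa only [e] using abs_alt_homeo hP hO (Homeomorph.refl _) b b'

/-- A connected set avoiding the base point is convex for the order seen from the base point. -/
theorem rep_lt_iff_of_preconnected {I : Set UnitAddCircle} (hI : IsPreconnected I)
    {b t : UnitAddCircle} (hb : b ∉ I) (ht : t ∉ I) {y z : UnitAddCircle} (hy : y ∈ I)
    (hz : z ∈ I) : (rep b y < rep b t ↔ rep b z < rep b t) := by
  have h0 : ∀ s ∈ I, 0 < rep b s := fun s hs => lt_of_le_of_ne (rep_mem b s).1 fun e => by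
    rw [← rep_self b] at e
    exact hb (rep_injective b e ▸ hs)
  have m1 : ∀ s, s ∈ arc b 0 (rep b t) ↔ _ := fun s => mem_arc le_rfl (rep_mem b t).2.le
  have m2 : ∀ s, s ∈ arc b (rep b t) 1 ↔ _ := fun s => mem_arc (rep_mem b t).1 le_rfl
  rcases hI.subset_or_subset (isOpen_arc b 0 (rep b t)) (isOpen_arc b (rep b t) 1)
    (disjoint_left.2 fun s h1 h2 => by
      rw [m1] at h1; rw [m2] at h2; linarith [h1.2, h2.1])
    (fun s hs => by
      rw [mem_union, m1, m2]
      rcases lt_trichotomy (rep b s) (rep b t) with h | h | h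
      · exact Or.inl ⟨h0 s hs, h⟩
      · exact absurd (rep_injective b h ▸ hs) ht
      · exact Or.inr ⟨h, (rep_mem b s).2⟩) with h | h
  · exact iff_of_true ((m1 _).1 (h hy)).2 ((m1 _).1 (h hz)).2
  · exact iff_of_false ((m2 _).1 (h hy)).1.not_gt ((m2 _).1 (h hz)).1.not_gt

end Circle

/-! ## Crossing invariants of diagrams -/

section DiagramInvariants

open Classical

variable {S : Type*} [TopologicalSpace S]

theorem Diagram.finite_doublePts (D : Diagram S) :
    {t | ∃ s, s ≠ t ∧ D.curve s = D.curve t}.Finite :=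
  (D.finite_double.image Prod.snd).subset fun t ⟨s, h1, h2⟩ => ⟨(s, t), ⟨h1, h2⟩, rfl⟩

/-- The parameters of the double points. -/
def Diagram.doublePts (D : Diagram S) : Finset UnitAddCircle := D.finite_doublePts.toFinset

/-- The parameters of the over-passages. -/
def Diagram.overPts (D : Diagram S) : Finset UnitAddCircle :=
  D.doublePts.filter fun t => ∃ s, s ≠ t ∧ D.curve s = D.curve t ∧ D.height s < D.height t

theorem Diagram.mem_doublePts {D : Diagram S} {t : UnitAddCircle} :
    t ∈ D.doublePts ↔ ∃ s, s ≠ t ∧ D.curve s = D.curve t := by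
  simp [doublePts]

theorem Diagram.mem_overPts {D : Diagram S} {t : UnitAddCircle} :
    t ∈ D.overPts ↔ ∃ s, s ≠ t ∧ D.curve s = D.curve t ∧ D.height s < D.height t := by
  rw [overPts, Finset.mem_filter, mem_doublePts]
  exact ⟨fun h => h.2, fun ⟨s, h⟩ => ⟨⟨s, h.1, h.2.1⟩, s, h⟩⟩

theorem Diagram.overPts_subset (D : Diagram S) : D.overPts ⊆ D.doublePts :=
  Finset.filter_subset _ _

/-- Sending a parameter to the other parameter of the same crossing is a fixed-point-free
involution; that it is an involution is the absence of triple points. -/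
theorem Diagram.even_card_doublePts (D : Diagram S) : Even D.doublePts.card := by
  choose! g hg using fun t (h : t ∈ D.doublePts) => Diagram.mem_doublePts.1 h
  have hmem : ∀ t ∈ D.doublePts, g t ∈ D.doublePts := fun t ht =>
    Diagram.mem_doublePts.2 ⟨t, (hg t ht).1.symm, (hg t ht).2.symm⟩
  have := Finset.sum_involution (s := D.doublePts) (f := fun _ => (1 : ZMod 2)) (fun t _ => g t)
    (fun _ _ => by decide) (fun t ht _ => (hg t ht).1) hmem (fun t ht => by
      have h1 := hg t ht
      have h2 := hg (g t) (hmem t ht)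
      rcases D.no_triple t (g t) (g (g t)) h1.2.symm h2.2.symm with h | h | h
      · exact absurd h.symm h1.1
      · exact absurd h.symm h2.1
      · exact h.symm)
  rw [Finset.sum_const, nsmul_eq_mul, mul_one] at this
  exact ZMod.natCast_eq_zero_iff_even.1 this

/-- The absolute value of the alternating sum over the over-passages of a diagram. -/
def Diagram.index (D : Diagram S) : ℤ := |alt (rep 0) D.doublePts D.overPts|

theorem Diagram.index_eq (D : Diagram S) (b : UnitAddCircle) :
    D.index = |alt (rep b) D.doublePts D.overPts| :=
  abs_alt_base D.even_card_doublePts D.overPts_subset b 0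

/-- The reparametrization θ matches double points and over-passages. It may reverse the orientation,
which the absolute value in the index absorbs. -/
theorem IsotopicDiagrams.card_eq_and_index_eq {D E : Diagram S} (h : IsotopicDiagrams D E) :
    D.overPts.card = E.overPts.card ∧ D.index = E.index := by
  obtain ⟨φ, -, θ, h1, h2⟩ := h
  have hd : ∀ s t, E.curve (θ s) = E.curve (θ t) ↔ D.curve s = D.curve t := fun s t => by
    rw [h1, h1, φ.injective.eq_iff]
  have e1 : E.doublePts = D.doublePts.map θ.toEquiv.toEmbedding := by
    ext t
    obtain ⟨t, rfl⟩ := θ.surjective t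
    rw [Diagram.mem_doublePts, ← θ.surjective.exists.symm]
    simp only [Finset.mem_map, Diagram.mem_doublePts, Equiv.coe_toEmbedding,
      Homeomorph.coe_toEquiv, θ.injective.eq_iff, exists_eq_right, hd, θ.injective.ne_iff]
  have e2 : E.overPts = D.overPts.map θ.toEquiv.toEmbedding := by
    ext t
    obtain ⟨t, rfl⟩ := θ.surjective t
    rw [Diagram.mem_overPts, ← θ.surjective.exists.symm]
    simp only [Finset.mem_map, Diagram.mem_overPts, Equiv.coe_toEmbedding,
      Homeomorph.coe_toEquiv, θ.injective.eq_iff, exists_eq_right, hd, θ.injective.ne_iff]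
    refine exists_congr fun s => and_congr_right fun hs => and_congr_right fun hc => ?_
    exact (h2 s t hs hc).symm
  refine ⟨by rw [e2, Finset.card_map], ?_⟩
  rw [Diagram.index, Diagram.index, e1, e2,
    abs_alt_homeo D.even_card_doublePts D.overPts_subset θ 0 0]

theorem alt_map {α β : Type*} (ρ : β → ℝ) (e : α ↪ β) (P O : Finset α) :
    alt ρ (P.map e) (O.map e) = alt (ρ ∘ e) P O := by
  simp [alt, signIn]

/-- The double points and the over-passages of a local picture, and bounds for the alternating sums
along its strands. -/
structure PicturePoints {k : ℕ} (X : Fin k → ℝ → Plane) (lev : Fin k → ℝ → ℝ)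
    (DP OP : Fin k → Finset (Icc (-1 : ℝ) 1)) (c : Fin k → ℤ) : Prop where
  mem_square : ∀ i (u : Icc (-1 : ℝ) 1), X i u ∈ square
  mem_double : ∀ i (u : Icc (-1 : ℝ) 1), u ∈ DP i ↔
    ∃ j, ∃ v : Icc (-1 : ℝ) 1, (j = i → v ≠ u) ∧ X j v = X i u
  mem_over : ∀ i (u : Icc (-1 : ℝ) 1), u ∈ OP i ↔
    ∃ j, ∃ v : Icc (-1 : ℝ) 1, (j = i → v ≠ u) ∧ X j v = X i u ∧ lev j v < lev i u
  interior : ∀ i, ∀ u ∈ DP i, (u : ℝ) ∈ Ioo (-1 : ℝ) 1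
  even : ∀ i, Even (DP i).card
  bound : ∀ i (ρ : Icc (-1 : ℝ) 1 → ℝ), Function.Injective ρ → |alt ρ (DP i) (OP i)| ≤ c i

/-! ### Comparing a diagram with the local picture of a move. -/

section Local

variable {k : ℕ} {X : Fin k → ℝ → Plane} {lev : Fin k → ℝ → ℝ}
  {DP OP : Fin k → Finset (Icc (-1 : ℝ) 1)} {c : Fin k → ℤ}
  {ψ : Plane → S} {a : Fin k → Icc (-1 : ℝ) 1 → UnitAddCircle} {D : Diagram S}

/-- The rest of the diagram avoids the image of the square, so a point on a strand can only coincide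
with points on strands, and these coincidences are visible in the picture. -/
theorem strand_mem_doublePts (hX : PicturePoints X lev DP OP c) (hψ : Function.Injective ψ)
    (ha : ∀ i j u v, a i u = a j v → i = j ∧ u = v)
    (hD : ∀ i u, D.curve (a i u) = ψ (X i u))
    (hoff : ∀ t, (∀ i u, a i u ≠ t) → D.curve t ∉ ψ '' square) (i : Fin k) (u : Icc (-1 : ℝ) 1) :
    a i u ∈ D.doublePts ↔ u ∈ DP i := by
  rw [hX.mem_double, Diagram.mem_doublePts]
  constructor
  · rintro ⟨s, hs, he⟩
    by_cases h : ∀ j v, a j v ≠ s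
    · exact absurd ⟨X i u, hX.mem_square i u, (hD i u).symm.trans he.symm⟩ (hoff s h)
    · push Not at h
      obtain ⟨j, v, rfl⟩ := h
      refine ⟨j, v, ?_, hψ (by rw [← hD, ← hD, he])⟩
      rintro rfl rfl
      exact hs rfl
  · rintro ⟨j, v, hne, he⟩
    refine ⟨a j v, fun h => ?_, by rw [hD, hD, he]⟩
    obtain ⟨h1, h2⟩ := ha _ _ _ _ h
    exact hne h1 h2

theorem strand_mem_overPts (hX : PicturePoints X lev DP OP c) (hψ : Function.Injective ψ)
    (ha : ∀ i j u v, a i u = a j v → i = j ∧ u = v)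
    (hD : ∀ i u, D.curve (a i u) = ψ (X i u))
    (hh : ∀ i j (u v : Icc (-1 : ℝ) 1), a i u ≠ a j v → X i u = X j v →
      (D.height (a i u) < D.height (a j v) ↔ lev i u < lev j v))
    (hoff : ∀ t, (∀ i u, a i u ≠ t) → D.curve t ∉ ψ '' square) (i : Fin k) (u : Icc (-1 : ℝ) 1) :
    a i u ∈ D.overPts ↔ u ∈ OP i := by
  rw [hX.mem_over, Diagram.mem_overPts]
  constructor
  · rintro ⟨s, hs, he, hl⟩
    by_cases h : ∀ j v, a j v ≠ s
    · exact absurd ⟨X i u, hX.mem_square i u, (hD i u).symm.trans he.symm⟩ (hoff s h)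
    · push Not at h
      obtain ⟨j, v, rfl⟩ := h
      have e : X j v = X i u := hψ (by rw [← hD, ← hD, he])
      refine ⟨j, v, ?_, e, (hh _ _ _ _ hs e).1 hl⟩
      rintro rfl rfl
      exact hs rfl
  · rintro ⟨j, v, hne, he, hl⟩
    have hne' : a j v ≠ a i u := fun h => by
      obtain ⟨h1, h2⟩ := ha _ _ _ _ h
      exact hne h1 h2
    exact ⟨a j v, hne', by rw [hD, hD, he], (hh _ _ _ _ hne' he).2 hl⟩

/-- The interior of the `i`-th strand. -/
def strandInterior (a : Fin k → Icc (-1 : ℝ) 1 → UnitAddCircle) (i : Fin k) : Set UnitAddCircle :=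
  a i '' {u | (u : ℝ) ∈ Ioo (-1 : ℝ) 1}

theorem filter_strandInterior {P : Finset UnitAddCircle} {Q : Finset (Icc (-1 : ℝ) 1)} {i : Fin k}
    (hinj : Function.Injective (a i)) (hQ : ∀ u ∈ Q, (u : ℝ) ∈ Ioo (-1 : ℝ) 1)
    (h : ∀ u, a i u ∈ P ↔ u ∈ Q) :
    P.filter (· ∈ strandInterior a i) = Q.map ⟨a i, hinj⟩ := by
  ext t
  rw [Finset.mem_filter, Finset.mem_map]
  constructor
  · rintro ⟨ht, u, -, rfl⟩
    exact ⟨u, (h u).1 ht, rfl⟩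
  · rintro ⟨u, hu, rfl⟩
    exact ⟨(h u).2 hu, u, hQ u hu, rfl⟩

/-- Only the interiors of the strands are removed. The end points remain, but they belong to neither
set, because the marked points of the pictures are interior. -/
theorem filter_off_strands {P P' : Finset UnitAddCircle} {Q Q' : Fin k → Finset (Icc (-1 : ℝ) 1)}
    (hQ : ∀ i, ∀ u ∈ Q i, (u : ℝ) ∈ Ioo (-1 : ℝ) 1) (h : ∀ i u, a i u ∈ P ↔ u ∈ Q i)
    (hQ' : ∀ i, ∀ u ∈ Q' i, (u : ℝ) ∈ Ioo (-1 : ℝ) 1) (h' : ∀ i u, a i u ∈ P' ↔ u ∈ Q' i)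
    (hPP : ∀ t, (∀ i u, a i u ≠ t) → (t ∈ P ↔ t ∈ P')) :
    P.filter (· ∈ offSet (strandInterior a)) =
      P'.filter (· ∈ offSet (strandInterior a)) := by
  ext t
  rw [Finset.mem_filter, Finset.mem_filter]
  refine and_congr_left fun ht => ?_
  by_cases h0 : ∀ i u, a i u ≠ t
  · exact hPP t h0
  · push Not at h0
    obtain ⟨i, u, rfl⟩ := h0
    rw [h, h']
    exact iff_of_false (fun hu => ht i ⟨u, hQ i u hu, rfl⟩) fun hu => ht i ⟨u, hQ' i u hu, rfl⟩

theorem card_split {ι : Type*} [Fintype ι] (O : Finset UnitAddCircle) (I : ι → Set UnitAddCircle)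
    (hdisj : ∀ i j t, t ∈ I i → t ∈ I j → i = j) :
    O.card = (O.filter (· ∈ offSet I)).card + ∑ i, (O.filter (· ∈ I i)).card := by
  rw [← Finset.card_filter_add_card_filter_not (s := O) (· ∈ offSet I)]
  congr 1
  rw [← Finset.card_biUnion]
  · congr 1
    ext t
    simp [mem_offSet]
  · intro i _ j _ hij
    refine Finset.disjoint_left.2 fun t h1 h2 => hij ?_
    exact hdisj i j t (Finset.mem_filter.1 h1).2 (Finset.mem_filter.1 h2).2

end Local

theorem double_off {k : ℕ} {X : Fin k → ℝ → Plane} {lev : Fin k → ℝ → ℝ}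
    {DP OP : Fin k → Finset (Icc (-1 : ℝ) 1)} {c : Fin k → ℤ} {ψ : Plane → S}
    {a : Fin k → Icc (-1 : ℝ) 1 → UnitAddCircle} {D : Diagram S}
    (hX : PicturePoints X lev DP OP c) (hD : ∀ i u, D.curve (a i u) = ψ (X i u))
    (hoff : ∀ t, (∀ i u, a i u ≠ t) → D.curve t ∉ ψ '' square)
    {s t : UnitAddCircle} (ht : ∀ i u, a i u ≠ t) (he : D.curve s = D.curve t) :
    ∀ i u, a i u ≠ s := by
  rintro i u rfl
  exact hoff t ht ⟨X i u, hX.mem_square i u, (hD i u).symm.trans he⟩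

/-- Off the strands both diagrams have the same double points and over-passages. By `alt_split` the
alternating sums therefore differ only by the sums along the single strands, and each strand enters
with the same sign in both diagrams, since that sign is determined by the common points off the
strands. The bounds in `PicturePoints` hold for every injective order, so the direction in which a
strand is traversed does not matter. -/
theorem IsLocalMove.invariants {M : LocalMove} {D E : Diagram S} (h : IsLocalMove M D E)
    (i₀ : Fin M.strands) {DP OP DP' OP' : Fin M.strands → Finset (Icc (-1 : ℝ) 1)}
    {c c' : Fin M.strands → ℤ} (hB : PicturePoints M.before M.level DP OP c)
    (hA : PicturePoints M.after M.level DP' OP' c') :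
    |D.index - E.index| ≤ ∑ i, (c i + c' i) ∧
      D.overPts.card + ∑ i, (OP' i).card = E.overPts.card + ∑ i, (OP i).card := by
  obtain ⟨ψ, a, hψ, hac, ha, hD, hE, hhD, hhE, hoff, hhoff⟩ := h
  have hoffD : ∀ t, (∀ i u, a i u ≠ t) → D.curve t ∉ ψ '' square := fun t ht => (hoff t ht).2
  have hoffE : ∀ t, (∀ i u, a i u ≠ t) → E.curve t ∉ ψ '' square := fun t ht => by
    rw [(hoff t ht).1]; exact (hoff t ht).2
  have dD := strand_mem_doublePts hB hψ.injective ha hD hoffD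
  have dE := strand_mem_doublePts hA hψ.injective ha hE hoffE
  have oD := strand_mem_overPts hB hψ.injective ha hD hhD hoffD
  have oE := strand_mem_overPts hA hψ.injective ha hE hhE hoffE
  have hinj : ∀ i, Function.Injective (a i) := fun i u v huv => (ha i i u v huv).2
  have subB : ∀ i, ∀ u ∈ OP i, u ∈ DP i := fun i u hu => by
    rw [hB.mem_over] at hu; rw [hB.mem_double]
    obtain ⟨j, v, h1, h2, -⟩ := hu; exact ⟨j, v, h1, h2⟩
  have subA : ∀ i, ∀ u ∈ OP' i, u ∈ DP' i := fun i u hu => by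
    rw [hA.mem_over] at hu; rw [hA.mem_double]
    obtain ⟨j, v, h1, h2, -⟩ := hu; exact ⟨j, v, h1, h2⟩
  have intO : ∀ i, ∀ u ∈ OP i, (u : ℝ) ∈ Ioo (-1 : ℝ) 1 := fun i u hu =>
    hB.interior i u (subB i u hu)
  have intO' : ∀ i, ∀ u ∈ OP' i, (u : ℝ) ∈ Ioo (-1 : ℝ) 1 := fun i u hu =>
    hA.interior i u (subA i u hu)
  have offP := filter_off_strands hB.interior dD hA.interior dE fun t ht => by
    rw [Diagram.mem_doublePts, Diagram.mem_doublePts]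
    constructor
    · rintro ⟨s, h1, h2⟩
      have hs := double_off hB hD hoffD ht h2
      exact ⟨s, h1, by rw [(hoff s hs).1, (hoff t ht).1, h2]⟩
    · rintro ⟨s, h1, h2⟩
      have hs := double_off hA hE hoffE ht h2
      exact ⟨s, h1, by rw [← (hoff s hs).1, ← (hoff t ht).1, h2]⟩
  have offO := filter_off_strands intO oD intO' oE fun t ht => by
    rw [Diagram.mem_overPts, Diagram.mem_overPts]
    constructor
    · rintro ⟨s, h1, h2, h3⟩
      have hs := double_off hB hD hoffD ht h2
      exact ⟨s, h1, by rw [(hoff s hs).1, (hoff t ht).1, h2], (hhoff s t hs ht h1 h2).1 h3⟩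
    · rintro ⟨s, h1, h2, h3⟩
      have hs := double_off hA hE hoffE ht h2
      have h2' : D.curve s = D.curve t := by rw [← (hoff s hs).1, ← (hoff t ht).1, h2]
      exact ⟨s, h1, h2', (hhoff s t hs ht h1 h2').2 h3⟩
  have hdisj : ∀ i j t, t ∈ strandInterior a i → t ∈ strandInterior a j → i = j := by
    rintro i j _ ⟨u, -, rfl⟩ ⟨v, -, h2⟩
    exact (ha _ _ _ _ h2).1.symm
  let zero : Icc (-1 : ℝ) 1 := ⟨0, by norm_num⟩
  let one : Icc (-1 : ℝ) 1 := ⟨1, by norm_num⟩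
  -- An end of a strand as base point: it lies in no strand interior, so every strand interior
  -- becomes an interval for the order seen from it. This is the reason for requiring a strand `i₀`.
  set b := a i₀ one
  have hbI : ∀ i, b ∉ strandInterior a i := by
    rintro i ⟨u, hu, h2⟩
    have := (ha _ _ _ _ h2).2
    subst this
    exact lt_irrefl _ hu.2
  have hpre : ∀ i, IsPreconnected (strandInterior a i) := fun i => by
    refine IsPreconnected.image ?_ _ (hac i).continuousOn
    rw [← IsInducing.subtypeVal.isPreconnected_image]
    convert isPreconnected_Ioo (a := (-1 : ℝ)) (b := 1) using 1
    ext u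
    exact ⟨fun ⟨v, hv, e⟩ => e ▸ hv, fun h => ⟨⟨u, Ioo_subset_Icc_self h⟩, h, rfl⟩⟩
  have hconv : ∀ i, ∀ t ∉ strandInterior a i, ∀ y ∈ strandInterior a i,
      ∀ z ∈ strandInterior a i, (rep b y < rep b t ↔ rep b z < rep b t) := fun i t ht y hy z hz =>
    rep_lt_iff_of_preconnected (hpre i) (hbI i) ht hy hz
  have hconv' : ∀ i, ∀ t ∉ strandInterior a i, ∀ y ∈ strandInterior a i,
      ∀ z ∈ strandInterior a i, (rep b t < rep b y ↔ rep b t < rep b z) := by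
    intro i t ht y hy z hz
    have n1 : ∀ y ∈ strandInterior a i, (rep b t < rep b y ↔ ¬ rep b y < rep b t) := fun y hy =>
      ⟨fun h => h.not_gt, fun h => lt_of_le_of_ne (not_lt.1 h) fun e =>
        ht (rep_injective b e ▸ hy)⟩
    rw [n1 y hy, n1 z hz, hconv i t ht y hy z hz]
  have filD := fun i => filter_strandInterior (hinj i) (hB.interior i) (dD i)
  have filE := fun i => filter_strandInterior (hinj i) (hA.interior i) (dE i)
  have filoD := fun i => filter_strandInterior (hinj i) (intO i) (oD i)
  have filoE := fun i => filter_strandInterior (hinj i) (intO' i) (oE i)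
  constructor
  · have sD := alt_split (rep b) D.doublePts D.overPts (strandInterior a) (fun i => a i zero)
      (fun i => ⟨zero, by norm_num [zero], rfl⟩) hdisj hconv hconv' (fun i => by
        rw [filD, Finset.card_map]; exact hB.even i)
    have sE := alt_split (rep b) E.doublePts E.overPts (strandInterior a) (fun i => a i zero)
      (fun i => ⟨zero, by norm_num [zero], rfl⟩) hdisj hconv hconv' (fun i => by
        rw [filE, Finset.card_map]; exact hA.even i)
    rw [← offP, ← offO] at sE
    simp only [filD, filoD, alt_map] at sD
    simp only [filE, filoE, alt_map] at sE
    rw [D.index_eq b, E.index_eq b]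
    refine (abs_abs_sub_abs_le_abs_sub _ _).trans ?_
    rw [sD, sE, add_sub_add_left_eq_sub, ← Finset.sum_sub_distrib]
    refine (Finset.abs_sum_le_sum_abs _ _).trans (Finset.sum_le_sum fun i _ => ?_)
    rw [← mul_sub, abs_mul]
    have h1 : ∀ (P : Finset UnitAddCircle) A, |signIn P A| = 1 := fun P A => by
      rcases signIn_cases P A with h | h <;> simp [h]
    rw [h1, one_mul]
    exact (abs_sub _ _).trans (add_le_add (hB.bound i _ ((rep_injective b).comp (hinj i)))
      (hA.bound i _ ((rep_injective b).comp (hinj i))))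
  · rw [card_split D.overPts (strandInterior a) hdisj, card_split E.overPts (strandInterior a) hdisj,
      offO]
    simp only [filoD, filoE, Finset.card_map]
    ring

end DiagramInvariants

/-! ### Pictures of the three moves and the resulting Lipschitz bounds. -/

section Pictures

open Classical

theorem sqrt_two_bounds : 1 < √(2 : ℝ) ∧ √(2 : ℝ) < 3 / 2 ∧ √(2 : ℝ) * √2 = 2 := by
  refine ⟨?_, ?_, Real.mul_self_sqrt (by norm_num)⟩
  · rw [Real.lt_sqrt] <;> norm_num
  · rw [Real.sqrt_lt'] <;> norm_num

/-- The parameter `1 / √2` of the crossing of a curl. -/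
def curlPt : Icc (-1 : ℝ) 1 := ⟨√2 / 2, by
  obtain ⟨h1, h2, -⟩ := sqrt_two_bounds
  constructor <;> linarith⟩

/-- The parameter of a crossing of the third move. -/
def triPt : Icc (-1 : ℝ) 1 := ⟨√2 - 1, by
  obtain ⟨h1, h2, -⟩ := sqrt_two_bounds
  constructor <;> linarith⟩

/-- The reflection of the parameter interval. -/
def flip (u : Icc (-1 : ℝ) 1) : Icc (-1 : ℝ) 1 := ⟨-u, by
  obtain ⟨h1, h2⟩ := u.2
  constructor <;> linarith⟩

/-- The middle of the parameter interval. -/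
def midPt : Icc (-1 : ℝ) 1 := ⟨0, by norm_num⟩

theorem coe_curlPt : (curlPt : ℝ) = √2 / 2 := rfl
theorem coe_triPt : (triPt : ℝ) = √2 - 1 := rfl
theorem coe_flip (u : Icc (-1 : ℝ) 1) : (flip u : ℝ) = -u := rfl
theorem coe_midPt : (midPt : ℝ) = 0 := rfl

theorem eq_curlPt_iff {u : Icc (-1 : ℝ) 1} : u = curlPt ∨ u = flip curlPt ↔ (u : ℝ) ^ 2 = 1 / 2 := by
  obtain ⟨h1, h2, h3⟩ := sqrt_two_bounds
  rw [Subtype.ext_iff, Subtype.ext_iff, coe_flip, coe_curlPt,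
    ← sq_eq_sq_iff_eq_or_eq_neg, div_pow, sq √2, h3]
  norm_num

/-- The second coordinate is injective in u ^ 2, which forces v = -u; the first one is odd, so it
must vanish there, and u = 0 is excluded. -/
theorem curl_eq_iff {u v : ℝ} (h : v ≠ u) :
    (2 * v ^ 3 - v, (1 - v ^ 2) / 2) = (2 * u ^ 3 - u, (1 - u ^ 2) / 2) ↔
      v = -u ∧ u ^ 2 = 1 / 2 := by
  rw [Prod.mk.injEq]
  constructor
  · rintro ⟨h1, h2⟩
    have hv : v = -u := by
      rcases sq_eq_sq_iff_eq_or_eq_neg.1 (by linarith : v ^ 2 = u ^ 2) with h' | h'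
      · exact absurd h' h
      · exact h'
    refine ⟨hv, ?_⟩
    subst hv
    have hu : u ≠ 0 := by rintro rfl; simp at h
    have : u * (2 * u ^ 2 - 1) = 0 := by linarith
    rcases mul_eq_zero.1 this with h3 | h3
    · exact absurd h3 hu
    · linarith
  · rintro ⟨rfl, h2⟩
    constructor
    · linear_combination -4 * u * h2
    · ring

theorem curlPt_ne_flip : curlPt ≠ flip curlPt := by
  obtain ⟨h1, h2, h3⟩ := sqrt_two_bounds
  intro h
  have := congrArg Subtype.val h
  rw [coe_flip, coe_curlPt] at this
  linarith

theorem curlPt_interior : (curlPt : ℝ) ∈ Ioo (-1 : ℝ) 1 ∧ (flip curlPt : ℝ) ∈ Ioo (-1 : ℝ) 1 := by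
  obtain ⟨h1, h2, h3⟩ := sqrt_two_bounds
  rw [coe_flip, coe_curlPt]
  refine ⟨⟨?_, ?_⟩, ?_, ?_⟩ <;> linarith

theorem curl_mem_square {u : ℝ} (h1 : -1 ≤ u) (h2 : u ≤ 1) :
    (2 * u ^ 3 - u, (1 - u ^ 2) / 2) ∈ square := by
  refine ⟨⟨?_, ?_⟩, ?_, ?_⟩ <;> simp only <;> nlinarith [sq_nonneg (2 * u + 1), sq_nonneg (2 * u - 1),
    sq_nonneg (u + 1), sq_nonneg (u - 1), mul_nonneg (sub_nonneg.2 h2) (neg_le_iff_add_nonneg.1 h1),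
    mul_nonneg (sub_nonneg.2 h2) (sq_nonneg (2 * u + 1)),
    mul_nonneg (neg_le_iff_add_nonneg.1 h1) (sq_nonneg (2 * u - 1)), sq_nonneg u]

theorem picturePoints_omega1_before :
    PicturePoints omega1.before omega1.level (fun _ => ∅) (fun _ => ∅) (fun _ => 0) where
  mem_square i u := by
    have := u.2
    fin_cases i; constructor <;> simp_all [omega1]
  mem_double i u := by
    fin_cases i; simp [omega1, Subtype.ext_iff]
  mem_over i u := by
    fin_cases i; simp [omega1, Subtype.ext_iff]
  interior := by simp
  even := by simp
  bound := by simp [alt_empty]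

/-- One crossing has one over-passage and one under-passage on the same strand, so its contribution
is ±1. The level -u puts the over-passage at the negative parameter. -/
theorem picturePoints_curl {X : Fin 1 → ℝ → Plane} {lev : Fin 1 → ℝ → ℝ}
    (hX : ∀ u, X 0 u = (2 * u ^ 3 - u, (1 - u ^ 2) / 2)) (hl : ∀ u, lev 0 u = -u) :
    PicturePoints X lev (fun _ => {flip curlPt, curlPt}) (fun _ => {flip curlPt})
      (fun _ => 1) where
  mem_square i u := by
    rw [Subsingleton.elim i 0, hX]; exact curl_mem_square u.2.1 u.2.2
  mem_double i u := by
    rw [Subsingleton.elim i 0, Finset.mem_insert, Finset.mem_singleton, or_comm, eq_curlPt_iff]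
    constructor
    · intro h
      have hu : (u : ℝ) ≠ 0 := fun hu => by rw [hu] at h; norm_num at h
      have hf : (flip u : ℝ) ≠ u := fun h' => hu (by rw [coe_flip] at h'; linarith)
      refine ⟨0, flip u, fun _ h' => hf (congrArg Subtype.val h'), ?_⟩
      rw [hX, hX]
      exact (curl_eq_iff hf).2 ⟨coe_flip u, h⟩
    · rintro ⟨j, v, h1, h2⟩
      rw [Subsingleton.elim j 0, hX, hX] at h2
      exact ((curl_eq_iff fun h => h1 (Subsingleton.elim _ _) (Subtype.ext h)).1 h2).2
  mem_over i u := by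
    obtain ⟨b1, b2, b3⟩ := sqrt_two_bounds
    rw [Subsingleton.elim i 0, Finset.mem_singleton]
    constructor
    · rintro rfl
      refine ⟨0, curlPt, fun _ => curlPt_ne_flip, ?_, ?_⟩
      · rw [hX, hX]
        refine (curl_eq_iff fun h => curlPt_ne_flip (Subtype.ext h)).2 ⟨?_, ?_⟩
        · rw [coe_flip, neg_neg]
        · exact eq_curlPt_iff.1 (Or.inr rfl)
      · rw [hl, hl, coe_flip, coe_curlPt]
        linarith
    · rintro ⟨j, v, h1, h2, h3⟩
      rw [Subsingleton.elim j 0] at h2 h3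
      rw [hX, hX] at h2
      rw [hl, hl] at h3
      have h4 := (curl_eq_iff fun h => h1 (Subsingleton.elim _ _) (Subtype.ext h)).1 h2
      rcases eq_curlPt_iff.2 h4.2 with h5 | h5
      · rw [h4.1, h5, coe_curlPt] at h3
        linarith
      · exact h5
  interior i u hu := by
    rw [Finset.mem_insert, Finset.mem_singleton] at hu
    rcases hu with rfl | rfl
    · exact curlPt_interior.2
    · exact curlPt_interior.1
  even i := by rw [Finset.card_pair curlPt_ne_flip.symm]; exact even_two
  bound i ρ hρ := (abs_alt_pair_single curlPt_ne_flip.symm).le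

theorem picturePoints_omega1_after :
    PicturePoints omega1.after omega1.level (fun _ => {flip curlPt, curlPt})
      (fun _ => {flip curlPt}) (fun _ => 1) :=
  picturePoints_curl (fun _ => rfl) (fun _ => rfl)

theorem picturePoints_omega2_before :
    PicturePoints omega2.before omega2.level (fun _ => ∅) (fun _ => ∅) (fun _ => 0) where
  mem_square i u := by
    have := u.2
    fin_cases i <;> constructor <;> simp_all [omega2] <;> norm_num
  mem_double i u := by
    fin_cases i <;> simp [omega2, Fin.exists_fin_succ, Subtype.ext_iff] <;> norm_num
  mem_over i u := by
    fin_cases i <;> simp [omega2, Fin.exists_fin_succ, Subtype.ext_iff] <;> norm_num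
  interior := by simp
  even := by simp
  bound := by simp [alt_empty]

/-- Both over-passages lie on the upper strand, where they are consecutive and cancel; the lower
strand has none. Hence the bound 0. -/
theorem picturePoints_bigon {X : Fin 2 → ℝ → Plane} {lev : Fin 2 → ℝ → ℝ}
    (h0 : ∀ u, X 0 u = (u, u ^ 2 - 1 / 2)) (h1 : ∀ u, X 1 u = (u, 1 / 2 - u ^ 2))
    (l0 : ∀ u, lev 0 u = 1) (l1 : ∀ u, lev 1 u = 0) :
    PicturePoints X lev (fun _ => {curlPt, flip curlPt}) ![{curlPt, flip curlPt}, ∅]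
      (fun _ => 0) where
  mem_square i u := by
    have h := u.2
    have : (u : ℝ) ^ 2 ≤ 1 := by nlinarith [h.1, h.2]
    have := sq_nonneg (u : ℝ)
    obtain rfl | rfl : i = 0 ∨ i = 1 := by omega
    · rw [h0]; refine ⟨h, ?_, ?_⟩ <;> simp only <;> linarith
    · rw [h1]; refine ⟨h, ?_, ?_⟩ <;> simp only <;> linarith
  mem_double i u := by
    rw [Finset.mem_insert, Finset.mem_singleton, eq_curlPt_iff]
    obtain rfl | rfl : i = 0 ∨ i = 1 := by omega
    · constructor
      · intro h
        exact ⟨1, u, by simp, by rw [h0, h1, Prod.mk.injEq]; exact ⟨rfl, by linarith⟩⟩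
      · rintro ⟨j, v, n, e⟩
        obtain rfl | rfl : j = 0 ∨ j = 1 := by omega
        · rw [h0, h0, Prod.mk.injEq] at e
          exact absurd (Subtype.ext e.1) (n rfl)
        · rw [h0, h1, Prod.mk.injEq] at e
          rw [e.1] at e; linarith [e.2]
    · constructor
      · intro h
        exact ⟨0, u, by simp, by rw [h0, h1, Prod.mk.injEq]; exact ⟨rfl, by linarith⟩⟩
      · rintro ⟨j, v, n, e⟩
        obtain rfl | rfl : j = 0 ∨ j = 1 := by omega
        · rw [h0, h1, Prod.mk.injEq] at e
          rw [e.1] at e; linarith [e.2]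
        · rw [h1, h1, Prod.mk.injEq] at e
          exact absurd (Subtype.ext e.1) (n rfl)
  mem_over i u := by
    obtain rfl | rfl : i = 0 ∨ i = 1 := by omega
    · rw [Matrix.cons_val_zero, Finset.mem_insert, Finset.mem_singleton, eq_curlPt_iff]
      constructor
      · intro h
        exact ⟨1, u, by simp, by rw [h0, h1, Prod.mk.injEq]; exact ⟨rfl, by linarith⟩,
          by rw [l0, l1]; norm_num⟩
      · rintro ⟨j, v, n, e, -⟩
        obtain rfl | rfl : j = 0 ∨ j = 1 := by omega
        · rw [h0, h0, Prod.mk.injEq] at e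
          exact absurd (Subtype.ext e.1) (n rfl)
        · rw [h0, h1, Prod.mk.injEq] at e
          rw [e.1] at e; linarith [e.2]
    · simp only [Matrix.cons_val_one, Matrix.cons_val_fin_one, Finset.notMem_empty, false_iff]
      rintro ⟨j, v, n, e, l⟩
      obtain rfl | rfl : j = 0 ∨ j = 1 := by omega
      · rw [l0, l1] at l; norm_num at l
      · rw [l1, l1] at l; norm_num at l
  interior i u hu := by
    rw [Finset.mem_insert, Finset.mem_singleton] at hu
    rcases hu with rfl | rfl
    · exact curlPt_interior.1
    · exact curlPt_interior.2
  even i := by rw [Finset.card_pair curlPt_ne_flip]; exact even_two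
  bound i ρ hρ := by
    obtain rfl | rfl : i = 0 ∨ i = 1 := by omega
    · exact (abs_eq_zero.2 (alt_pair hρ curlPt_ne_flip)).le
    · exact (abs_eq_zero.2 (alt_empty _ _)).le

theorem picturePoints_omega2_after :
    PicturePoints omega2.after omega2.level (fun _ => {curlPt, flip curlPt})
      ![{curlPt, flip curlPt}, ∅] (fun _ => 0) :=
  picturePoints_bigon (fun _ => rfl) (fun _ => rfl) (fun _ => rfl) (fun _ => rfl)

theorem eq_triPt_iff {u : Icc (-1 : ℝ) 1} : u = triPt ↔ (u : ℝ) ^ 2 + 2 * u = 1 := by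
  obtain ⟨h1, h2, h3⟩ := sqrt_two_bounds
  obtain ⟨u1, u2⟩ := u.2
  rw [Subtype.ext_iff, coe_triPt]
  constructor
  · intro h; rw [h]; linear_combination h3
  · intro h
    have : ((u : ℝ) + 1 - √2) * (u + 1 + √2) = 0 := by linear_combination h - h3
    rcases mul_eq_zero.1 this with h' | h' <;> linarith

theorem eq_flip_triPt_iff {u : Icc (-1 : ℝ) 1} : u = flip triPt ↔ (u : ℝ) ^ 2 - 2 * u = 1 := by
  have h : u = flip triPt ↔ flip u = triPt := by
    rw [Subtype.ext_iff, Subtype.ext_iff, coe_flip, coe_flip]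
    constructor <;> intro h <;> linarith
  rw [h, eq_triPt_iff, coe_flip, neg_sq]
  constructor <;> intro h <;> linarith

theorem eq_midPt_iff {u : Icc (-1 : ℝ) 1} : u = midPt ↔ (u : ℝ) = 0 := by
  rw [Subtype.ext_iff, coe_midPt]

theorem triPt_ne_flip : triPt ≠ flip triPt := by
  obtain ⟨h1, h2, h3⟩ := sqrt_two_bounds
  intro h
  have := congrArg Subtype.val h
  rw [coe_flip, coe_triPt] at this
  linarith

theorem triPt_ne_mid : triPt ≠ midPt ∧ flip triPt ≠ midPt := by
  obtain ⟨h1, h2, h3⟩ := sqrt_two_bounds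
  constructor <;> intro h <;> have := congrArg Subtype.val h <;>
    simp only [coe_flip, coe_triPt, coe_midPt] at this <;> linarith

/-- Both pictures of the third move, for `σ = 1` and `σ = -1`. -/
theorem picturePoints_triangle (X : Fin 3 → ℝ → Plane) (lev : Fin 3 → ℝ → ℝ)
    (l0 : ∀ u, lev 0 u = 2) (l1 : ∀ u, lev 1 u = 1) (l2 : ∀ u, lev 2 u = 0) (σ : ℝ) (hσ : σ = 1 ∨ σ = -1)
    (p : Icc (-1 : ℝ) 1) (hp : ∀ u, u = p ↔ (u : ℝ) ^ 2 + 2 * σ * u = 1)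
    (hp' : ∀ u, u = flip p ↔ (u : ℝ) ^ 2 - 2 * σ * u = 1)
    (h0 : ∀ u, X 0 u = (u, σ * (1 - u ^ 2) / 2)) (h1 : ∀ u, X 1 u = (u, u))
    (h2 : ∀ u, X 2 u = (u, -u)) (hpf : p ≠ flip p) (hpm : p ≠ midPt) (hfm : flip p ≠ midPt)
    (hpi : ∀ u, (u = p ∨ u = flip p ∨ u = midPt) → (u : ℝ) ∈ Ioo (-1 : ℝ) 1) :
    PicturePoints X lev ![{p, flip p}, {midPt, p}, {midPt, flip p}]
      ![{p, flip p}, {midPt}, ∅] ![0, 1, 0] where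
  mem_square i u := by
    have h := u.2
    have : (u : ℝ) ^ 2 ≤ 1 := by nlinarith [h.1, h.2]
    have := sq_nonneg (u : ℝ)
    have := h.1
    have := h.2
    obtain rfl | rfl | rfl : i = 0 ∨ i = 1 ∨ i = 2 := by omega
    · rw [h0]; refine ⟨h, ?_, ?_⟩ <;> rcases hσ with rfl | rfl <;> simp only <;> linarith
    · rw [h1]; exact ⟨h, h⟩
    · rw [h2]; refine ⟨h, ?_, ?_⟩ <;> simp only <;> linarith
  mem_double i u := by
    obtain rfl | rfl | rfl : i = 0 ∨ i = 1 ∨ i = 2 := by omega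
    · simp only [Matrix.cons_val_zero, Finset.mem_insert, Finset.mem_singleton,
        hp u, hp' u]
      constructor
      · rintro (h | h)
        · refine ⟨1, u, by simp, ?_⟩
          rw [h1, h0, Prod.mk.injEq]
          rcases hσ with rfl | rfl <;> exact ⟨rfl, by linarith⟩
        · refine ⟨2, u, by simp, ?_⟩
          rw [h2, h0, Prod.mk.injEq]
          rcases hσ with rfl | rfl <;> exact ⟨rfl, by linarith⟩
      · rintro ⟨j, v, n, e⟩
        obtain rfl | rfl | rfl : j = 0 ∨ j = 1 ∨ j = 2 := by omega
        all_goals simp only [h0, h1, h2, Prod.mk.injEq] at e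
        · exact absurd (Subtype.ext e.1) (n rfl)
        · left; rw [e.1] at e; rcases hσ with rfl | rfl <;> linarith [e.2]
        · right; rw [e.1] at e; rcases hσ with rfl | rfl <;> linarith [e.2]
    · simp only [Matrix.cons_val_one, Matrix.cons_val_zero, Finset.mem_insert,
        Finset.mem_singleton, hp u, eq_midPt_iff]
      constructor
      · rintro (h | h)
        · refine ⟨2, u, by simp, ?_⟩
          rw [h1, h2, Prod.mk.injEq]
          exact ⟨rfl, by linarith⟩
        · refine ⟨0, u, by simp, ?_⟩
          rw [h1, h0, Prod.mk.injEq]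
          rcases hσ with rfl | rfl <;> exact ⟨rfl, by linarith⟩
      · rintro ⟨j, v, n, e⟩
        obtain rfl | rfl | rfl : j = 0 ∨ j = 1 ∨ j = 2 := by omega
        all_goals simp only [h0, h1, h2, Prod.mk.injEq] at e
        · right; rw [e.1] at e; rcases hσ with rfl | rfl <;> linarith [e.2]
        · exact absurd (Subtype.ext e.1) (n rfl)
        · left; linarith [e.1, e.2]
    · simp only [Matrix.cons_val, Finset.mem_insert,
        Finset.mem_singleton, hp' u, eq_midPt_iff]
      constructor
      · rintro (h | h)
        · refine ⟨1, u, by simp, ?_⟩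
          rw [h1, h2, Prod.mk.injEq]
          exact ⟨rfl, by linarith⟩
        · refine ⟨0, u, by simp, ?_⟩
          rw [h2, h0, Prod.mk.injEq]
          rcases hσ with rfl | rfl <;> exact ⟨rfl, by linarith⟩
      · rintro ⟨j, v, n, e⟩
        obtain rfl | rfl | rfl : j = 0 ∨ j = 1 ∨ j = 2 := by omega
        all_goals simp only [h0, h1, h2, Prod.mk.injEq] at e
        · right; rw [e.1] at e; rcases hσ with rfl | rfl <;> linarith [e.2]
        · left; linarith [e.1, e.2]
        · exact absurd (Subtype.ext e.1) (n rfl)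
  mem_over i u := by
    obtain rfl | rfl | rfl : i = 0 ∨ i = 1 ∨ i = 2 := by omega
    · simp only [Matrix.cons_val_zero, Finset.mem_insert, Finset.mem_singleton,
        hp u, hp' u]
      constructor
      · rintro (h | h)
        · refine ⟨1, u, by simp, ?_, by simp only [l0, l1]; norm_num⟩
          rw [h1, h0, Prod.mk.injEq]
          rcases hσ with rfl | rfl <;> exact ⟨rfl, by linarith⟩
        · refine ⟨2, u, by simp, ?_, by simp only [l0, l2]; norm_num⟩
          rw [h2, h0, Prod.mk.injEq]
          rcases hσ with rfl | rfl <;> exact ⟨rfl, by linarith⟩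
      · rintro ⟨j, v, n, e, -⟩
        obtain rfl | rfl | rfl : j = 0 ∨ j = 1 ∨ j = 2 := by omega
        all_goals simp only [h0, h1, h2, Prod.mk.injEq] at e
        · exact absurd (Subtype.ext e.1) (n rfl)
        · left; rw [e.1] at e; rcases hσ with rfl | rfl <;> linarith [e.2]
        · right; rw [e.1] at e; rcases hσ with rfl | rfl <;> linarith [e.2]
    · simp only [Matrix.cons_val_one, Matrix.cons_val_zero, Finset.mem_singleton,
        eq_midPt_iff]
      constructor
      · intro h
        refine ⟨2, u, by simp, ?_, by simp only [l1, l2]; norm_num⟩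
        rw [h1, h2, Prod.mk.injEq]
        exact ⟨rfl, by linarith⟩
      · rintro ⟨j, v, n, e, l⟩
        obtain rfl | rfl | rfl : j = 0 ∨ j = 1 ∨ j = 2 := by omega
        all_goals simp only [h0, h1, h2, Prod.mk.injEq] at e
        · rw [l0, l1] at l
          linarith
        · exact absurd (Subtype.ext e.1) (n rfl)
        · linarith [e.1, e.2]
    · simp only [Matrix.cons_val, Finset.notMem_empty, false_iff]
      rintro ⟨j, v, n, e, l⟩
      obtain rfl | rfl | rfl : j = 0 ∨ j = 1 ∨ j = 2 := by omega
      all_goals simp only [l0, l1, l2] at l; linarith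
  interior i u hu := by
    refine hpi u ?_
    obtain rfl | rfl | rfl : i = 0 ∨ i = 1 ∨ i = 2 := by omega
    all_goals simp at hu; tauto
  even i := by
    obtain rfl | rfl | rfl : i = 0 ∨ i = 1 ∨ i = 2 := by omega
    · exact (Finset.card_pair hpf).symm ▸ even_two
    · exact (Finset.card_pair hpm.symm).symm ▸ even_two
    · exact (Finset.card_pair hfm.symm).symm ▸ even_two
  -- The top strand carries a cancelling pair and the bottom strand no over-passage. Only the middle
  -- strand, over once and under once, contributes ±1.
  bound i ρ hρ := by
    obtain rfl | rfl | rfl : i = 0 ∨ i = 1 ∨ i = 2 := by omega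
    · exact (abs_eq_zero.2 (alt_pair hρ hpf)).le
    · exact (abs_alt_pair_single hpm.symm).le
    · exact (abs_eq_zero.2 (alt_empty _ _)).le

theorem triPt_interior (u : Icc (-1 : ℝ) 1) (h : u = triPt ∨ u = flip triPt ∨ u = midPt) :
    (u : ℝ) ∈ Ioo (-1 : ℝ) 1 := by
  obtain ⟨h1, h2, h3⟩ := sqrt_two_bounds
  rcases h with rfl | rfl | rfl <;> simp only [coe_flip, coe_triPt, coe_midPt] <;>
    constructor <;> linarith

theorem flip_flip (u : Icc (-1 : ℝ) 1) : flip (flip u) = u :=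
  Subtype.ext (by rw [coe_flip, coe_flip, neg_neg])

theorem picturePoints_omega3_before :
    PicturePoints omega3.before omega3.level ![{triPt, flip triPt}, {midPt, triPt}, {midPt, flip triPt}]
      ![{triPt, flip triPt}, {midPt}, ∅] ![0, 1, 0] :=
  picturePoints_triangle omega3.before omega3.level (fun _ => rfl) (fun _ => rfl) (fun _ => rfl) 1 (Or.inl rfl) triPt
    (fun u => by rw [eq_triPt_iff, mul_one]) (fun u => by rw [eq_flip_triPt_iff, mul_one])
    (fun u => by rw [one_mul]; rfl) (fun _ => rfl) (fun _ => rfl)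
    triPt_ne_flip triPt_ne_mid.1 triPt_ne_mid.2 triPt_interior

theorem picturePoints_omega3_after :
    PicturePoints omega3.after omega3.level
      ![{flip triPt, flip (flip triPt)}, {midPt, flip triPt}, {midPt, flip (flip triPt)}]
      ![{flip triPt, flip (flip triPt)}, {midPt}, ∅] ![0, 1, 0] :=
  picturePoints_triangle omega3.after omega3.level (fun _ => rfl) (fun _ => rfl) (fun _ => rfl) (-1) (Or.inr rfl) (flip triPt)
    (fun u => by rw [eq_flip_triPt_iff]; ring_nf)
    (fun u => by rw [flip_flip, eq_triPt_iff]; ring_nf)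
    (fun u => by rw [neg_one_mul, neg_sub]; rfl) (fun _ => rfl) (fun _ => rfl)
    (by rw [flip_flip]; exact triPt_ne_flip.symm) triPt_ne_mid.2
    (by rw [flip_flip]; exact triPt_ne_mid.1)
    (fun u h => triPt_interior u (by rw [flip_flip] at h; tauto))

variable {S : Type*} [TopologicalSpace S]

theorem IsLocalMove.omega1_invariants {D E : Diagram S} (h : IsLocalMove omega1 D E) :
    |D.index - E.index| ≤ 1 ∧ E.overPts.card = D.overPts.card + 1 := by
  have := h.invariants (0 : Fin 1) picturePoints_omega1_before picturePoints_omega1_after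
  have e : ∑ _i : Fin 1, (0 + 1 : ℤ) = 1 := by simp
  erw [e] at this
  refine ⟨this.1, ?_⟩
  have h2 := this.2
  erw [Fin.sum_univ_one, Fin.sum_univ_one] at h2
  simpa using h2.symm

theorem IsLocalMove.omega2_invariants {D E : Diagram S} (h : IsLocalMove omega2 D E) :
    D.index = E.index ∧ E.overPts.card = D.overPts.card + 2 := by
  have := h.invariants (0 : Fin 2) picturePoints_omega2_before picturePoints_omega2_after
  have h2 : ∑ i : Fin 2, Finset.card ((![{curlPt, flip curlPt}, ∅] : Fin 2 → Finset (Icc (-1 : ℝ) 1)) i) = 2 := by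
    simp [Fin.sum_univ_two, Finset.card_pair curlPt_ne_flip]
  constructor
  · have h1 := this.1
    simp only [add_zero, Finset.sum_const_zero, abs_nonpos_iff] at h1
    linarith
  · have h1 := this.2
    erw [h2] at h1
    simpa using h1.symm

theorem IsLocalMove.omega3_invariants {D E : Diagram S} (h : IsLocalMove omega3 D E) :
    |D.index - E.index| ≤ 2 ∧ E.overPts.card = D.overPts.card := by
  have := h.invariants (0 : Fin 3) picturePoints_omega3_before picturePoints_omega3_after
  constructor
  · refine this.1.trans (le_of_eq ?_)
    exact (Fin.sum_univ_three _).trans (by simp)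
  · have h1 := this.2
    have e : ∀ q : Icc (-1 : ℝ) 1, q ≠ flip q → ∑ i : Fin 3, Finset.card
        ((![{q, flip q}, {midPt}, ∅] : Fin 3 → Finset (Icc (-1 : ℝ) 1)) i) = 3 := fun q hq => by
      simp [Fin.sum_univ_three, Finset.card_pair hq]
    erw [e _ triPt_ne_flip, e _ (by rw [flip_flip]; exact triPt_ne_flip.symm)] at h1
    omega

/-- The changes of (index, crossing number) are bounded by (1, 1), (0, 2) and (2, 0) for the three
moves. It is the bound on the sum that makes both half-sum and half-difference 1-Lipschitz. -/
theorem ReidemeisterMove.invariants {D E : Diagram S} (h : ReidemeisterMove D E) :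
    |D.index - E.index| + |(D.overPts.card : ℤ) - E.overPts.card| ≤ 2 := by
  obtain ⟨M, hM, hDE⟩ := h
  wlog h : IsLocalMove M D E generalizing D E
  · have := this hDE.symm (hDE.resolve_left h)
    rwa [abs_sub_comm, abs_sub_comm (E.overPts.card : ℤ)] at this
  rcases hM with rfl | rfl | rfl
  · obtain ⟨h1, h2⟩ := h.omega1_invariants
    rw [h2]; push_cast; simp; linarith
  · obtain ⟨h1, h2⟩ := h.omega2_invariants
    rw [h1, h2]; push_cast; simp
  · obtain ⟨h1, h2⟩ := h.omega3_invariants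
    rw [h2]; simpa using h1

/-- Half the sum of the crossing number and the index. -/
def classMax (c : DiagramClass S) : ℝ :=
  Quotient.lift (fun D : Diagram S => ((D.overPts.card : ℝ) + D.index) / 2)
    (fun D E h => by
      obtain ⟨h1, h2⟩ := IsotopicDiagrams.card_eq_and_index_eq h
      simp only [h1, h2]) c

/-- Half the difference of the crossing number and the index. -/
def classMin (c : DiagramClass S) : ℝ :=
  Quotient.lift (fun D : Diagram S => ((D.overPts.card : ℝ) - D.index) / 2)
    (fun D E h => by
      obtain ⟨h1, h2⟩ := IsotopicDiagrams.card_eq_and_index_eq h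
      simp only [h1, h2]) c

theorem graphOn_lipschitz (ι : S × ℝ → ThreeSphere) (K : UnitAddCircle → ThreeSphere)
    {c e : Vertex ι K} (h : (graphOn ι K).Adj c e) :
    |classMax c.1 - classMax e.1| ≤ 1 ∧ |classMin c.1 - classMin e.1| ≤ 1 := by
  have main : ∀ D E : Diagram S, ReidemeisterMove D E →
      |classMax (Quotient.mk (diagramSetoid S) D) - classMax (Quotient.mk (diagramSetoid S) E)| ≤ 1 ∧
      |classMin (Quotient.mk (diagramSetoid S) D) -
        classMin (Quotient.mk (diagramSetoid S) E)| ≤ 1 := by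
    intro D E hDE
    have := hDE.invariants
    have h' : |(D.index : ℝ) - E.index| + |(D.overPts.card : ℝ) - E.overPts.card| ≤ 2 := by
      exact_mod_cast this
    simp only [classMax, classMin, Quotient.lift_mk]
    have a1 := le_abs_self ((D.index : ℝ) - E.index)
    have a2 := neg_le_abs ((D.index : ℝ) - E.index)
    have a3 := le_abs_self ((D.overPts.card : ℝ) - E.overPts.card)
    have a4 := neg_le_abs ((D.overPts.card : ℝ) - E.overPts.card)
    constructor <;> rw [abs_le] <;> constructor <;> linarith
  rw [graphOn, SimpleGraph.fromRel_adj] at h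
  rcases h.2 with ⟨D, E, h1, h2, h3⟩ | ⟨D, E, h1, h2, h3⟩
  · rw [← h1, ← h2]; exact main D E h3
  · rw [abs_sub_comm (classMax c.1), abs_sub_comm (classMin c.1), ← h1, ← h2]
    exact main D E h3

end Pictures

/-! ## Ambient isotopies of the 3-sphere -/

theorem AmbientIsotopic.symm {X : Type*} [TopologicalSpace X] {A B : Set X}
    (h : AmbientIsotopic A B) : AmbientIsotopic B A := by
  obtain ⟨φ, hφ, rfl⟩ := h
  refine ⟨φ.symm, hφ.symm, ?_⟩
  rw [← image_comp]
  simp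

theorem AmbientIsotopic.trans {X : Type*} [TopologicalSpace X] {A B C : Set X}
    (h : AmbientIsotopic A B) (k : AmbientIsotopic B C) : AmbientIsotopic A C := by
  obtain ⟨φ, hφ, rfl⟩ := h
  obtain ⟨ψ, hψ, rfl⟩ := k
  exact ⟨φ.trans ψ, hφ.trans hψ, by rw [← image_comp]; rfl⟩

/-- On a compact Hausdorff space, the continuity of the inverses in an isotopy is automatic. -/
theorem exists_isotopicToId {X : Type*} [TopologicalSpace X] [CompactSpace X] [T2Space X]
    (F : unitInterval → X → X) (hF : Continuous fun p : unitInterval × X => F p.1 p.2)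
    (hb : ∀ s, Function.Bijective (F s)) (h0 : ∀ x, F 0 x = x) :
    ∃ φ : X ≃ₜ X, IsotopicToId φ ∧ ∀ x, φ x = F 1 x := by
  have hc : ∀ s, Continuous (F s) := fun s => hF.comp (Continuous.prodMk_right s)
  let H : unitInterval → X ≃ₜ X := fun s =>
    Continuous.homeoOfEquivCompactToT2 (f := Equiv.ofBijective (F s) (hb s)) (hc s)
  have hH : ∀ s x, H s x = F s x := fun s x => rfl
  -- The track of the isotopy is a continuous bijection of a compact Hausdorff space, hence a
  -- homeomorphism; the second component of its inverse gives all the inverse maps at once.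
  let T : unitInterval × X → unitInterval × X := fun p => (p.1, F p.1 p.2)
  have hT : Function.Bijective T := by
    constructor
    · rintro ⟨s, x⟩ ⟨s', x'⟩ h
      obtain ⟨h1, h2⟩ := Prod.mk.inj h
      simp only at h1 h2
      subst h1
      rw [(hb s).1 h2]
    · rintro ⟨s, y⟩
      obtain ⟨x, hx⟩ := (hb s).2 y
      exact ⟨(s, x), Prod.ext rfl hx⟩
  let TH := Continuous.homeoOfEquivCompactToT2 (f := Equiv.ofBijective T hT)
    (continuous_fst.prodMk hF)
  refine ⟨H 1, ⟨H, hF, ?_, ?_, rfl⟩, fun x => rfl⟩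
  · have : (fun p : unitInterval × X => (H p.1).symm p.2) = fun p => (TH.symm p).2 := by
      funext ⟨s, y⟩
      obtain ⟨x, rfl⟩ := (H s).surjective y
      have : TH (s, x) = (s, H s x) := rfl
      rw [← this, TH.symm_apply_apply, this]
      exact (H s).symm_apply_apply x
    rw [this]
    exact continuous_snd.comp TH.symm.continuous
  · ext x
    exact h0 x

/-- A proper family of bijections of Euclidean space gives an ambient isotopy of the 3-sphere. -/
theorem ambientIsotopic_of_family {ι : Type*} (G : unitInterval → Space → Space)
    (hG : Continuous fun p : unitInterval × Space => G p.1 p.2)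
    (hb : ∀ s, Function.Bijective (G s)) (h0 : ∀ x, G 0 x = x)
    (hp : ∃ C C' : ℝ, 0 ≤ C ∧ ∀ s x, ‖x‖ ≤ C * ‖G s x‖ + C') (Γ Γ' : ι → Space)
    (hΓ : ∀ t, G 1 (Γ t) = Γ' t) :
    AmbientIsotopic (range fun t => (Γ t : ThreeSphere)) (range fun t => (Γ' t : ThreeSphere)) := by
  obtain ⟨C, C', hC, hp⟩ := hp
  have hcont : Continuous fun p : unitInterval × ThreeSphere => OnePoint.map (G p.1) p.2 := by
    rw [continuous_iff_continuousAt]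
    rintro ⟨s, z⟩
    induction z using OnePoint.rec with
    | infty =>
      rw [ContinuousAt, OnePoint.map_infty]
      intro U hU
      obtain ⟨V, hVU, hV, hVi⟩ := mem_nhds_iff.1 hU
      obtain ⟨-, hK⟩ := (OnePoint.isOpen_iff_of_mem hVi).1 hV
      -- Continuity at infinity: a point sent by some member of the family into the ball of radius R
      -- lies in the ball of radius C * R + C', uniformly in the time.
      obtain ⟨R, hR⟩ := hK.isBounded.subset_closedBall (0 : Space)
      have hW : IsOpen (((↑) '' Metric.closedBall (0 : Space) (C * R + C'))ᶜ : Set ThreeSphere) :=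
        OnePoint.isOpen_compl_image_coe.2
          ⟨Metric.isClosed_closedBall, isCompact_closedBall _ _⟩
      have hmem : (univ : Set unitInterval) ×ˢ
          (((↑) '' Metric.closedBall (0 : Space) (C * R + C'))ᶜ : Set ThreeSphere) ∈
          𝓝 (s, (OnePoint.infty : ThreeSphere)) :=
        prod_mem_nhds Filter.univ_mem (hW.mem_nhds OnePoint.infty_notMem_image_coe)
      refine Filter.mem_map.2 (Filter.mem_of_superset hmem ?_)
      rintro ⟨s', z⟩ ⟨-, hz⟩
      refine hVU ?_
      induction z using OnePoint.rec with
      | infty => exact hVi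
      | coe x =>
        simp only [OnePoint.map_some]
        by_contra h
        refine hz ⟨x, ?_, rfl⟩
        have h1 := hR (a := G s' x) h
        rw [mem_closedBall_zero_iff] at h1 ⊢
        have h2 := mul_le_mul_of_nonneg_left h1 hC
        linarith [hp s' x]
    | coe x =>
      have he : IsOpenEmbedding (Prod.map id (↑) : unitInterval × Space → unitInterval × ThreeSphere) :=
        IsOpenEmbedding.id.prodMap OnePoint.isOpenEmbedding_coe
      refine (he.continuousAt_iff (x := (s, x))).1 ?_
      exact (OnePoint.continuous_coe.comp hG).continuousAt
  have hbij : ∀ s, Function.Bijective (OnePoint.map (G s) : ThreeSphere → ThreeSphere) := by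
    intro s
    constructor
    · intro x y h
      induction x using OnePoint.rec <;> induction y using OnePoint.rec <;>
        simp_all [(hb s).1.eq_iff]
    · intro y
      induction y using OnePoint.rec with
      | infty => exact ⟨OnePoint.infty, rfl⟩
      | coe y =>
        obtain ⟨x, rfl⟩ := (hb s).2 y
        exact ⟨x, rfl⟩
  obtain ⟨φ, hφ, e⟩ := exists_isotopicToId (fun s => OnePoint.map (G s)) hcont hbij fun x => by
    induction x using OnePoint.rec with
    | infty => rfl
    | coe x => rw [OnePoint.map_some, h0]
  refine ⟨φ, hφ, ?_⟩
  rw [← range_comp]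
  congr 1
  funext t
  rw [Function.comp_apply, e, OnePoint.map_some, hΓ]

/-- The point of space with given coordinates. -/
abbrev vec (x y z : ℝ) : Space := !₂[x, y, z]

theorem vec_eta (x : Space) : vec (x 0) (x 1) (x 2) = x := by
  ext i; fin_cases i <;> rfl

theorem vec_injective {x y z x' y' z' : ℝ} (h : vec x y z = vec x' y' z') :
    x = x' ∧ y = y' ∧ z = z' :=
  ⟨congrArg (fun v : Space => v 0) h, congrArg (fun v : Space => v 1) h,
    congrArg (fun v : Space => v 2) h⟩

theorem abs_coord_le (x : Space) (i : Fin 3) : |x i| ≤ ‖x‖ := PiLp.norm_apply_le x i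

theorem norm_vec_le (x y z : ℝ) : ‖vec x y z‖ ≤ |x| + |y| + |z| := by
  have e : vec x y z = vec x 0 0 + vec 0 y 0 + vec 0 0 z := by
    ext i; fin_cases i <;> simp
  rw [e]
  refine (norm_add₃_le).trans (le_of_eq ?_)
  simp [EuclideanSpace.norm_eq, Fin.sum_univ_three, Real.sqrt_sq_eq_abs]

theorem norm_le_of_coords {x : Space} {R : ℝ} (h : ∀ i, |x i| ≤ R) : ‖x‖ ≤ 3 * R := by
  rw [← vec_eta x]
  refine (norm_vec_le _ _ _).trans ?_
  linarith [h 0, h 1, h 2]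

theorem continuous_vec {X : Type*} [TopologicalSpace X] {f g h : X → ℝ} (hf : Continuous f)
    (hg : Continuous g) (hh : Continuous h) : Continuous fun t => vec (f t) (g t) (h t) := by
  refine (PiLp.continuous_toLp 2 _).comp (continuous_pi fun i => ?_)
  fin_cases i <;> assumption

theorem continuous_coord (i : Fin 3) : Continuous fun x : Space => x i := by fun_prop

/-- Horizontal shears. -/
theorem ambientIsotopic_shear {ι : Type*} (a b : ℝ) (Γ : ι → Space) :
    AmbientIsotopic (range fun t => (Γ t : ThreeSphere))
      (range fun t => (vec (Γ t 0 + a * Γ t 2) (Γ t 1 + b * Γ t 2) (Γ t 2) : ThreeSphere)) := by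
  have c0 := (continuous_coord 0).comp (continuous_snd (X := unitInterval))
  have c1 := (continuous_coord 1).comp (continuous_snd (X := unitInterval))
  have c2 := (continuous_coord 2).comp (continuous_snd (X := unitInterval))
  have cs : Continuous fun p : unitInterval × Space => (p.1 : ℝ) :=
    continuous_subtype_val.comp continuous_fst
  refine ambientIsotopic_of_family
    (fun s x => vec (x 0 + s * (a * x 2)) (x 1 + s * (b * x 2)) (x 2)) ?_ (fun s => ⟨?_, ?_⟩) ?_
    ⟨3 * (1 + |a| + |b|), 0, by positivity, ?_⟩ _ _ ?_
  · exact continuous_vec (c0.add (cs.mul (continuous_const.mul c2)))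
      (c1.add (cs.mul (continuous_const.mul c2))) c2
  · intro x y h
    obtain ⟨h1, h2, h3⟩ := vec_injective h
    rw [h3] at h1 h2
    rw [← vec_eta x, ← vec_eta y, add_right_cancel h1, add_right_cancel h2, h3]
  · intro y
    refine ⟨vec (y 0 - s * (a * y 2)) (y 1 - s * (b * y 2)) (y 2), ?_⟩
    ext i; fin_cases i <;> simp
  · intro x
    ext i; fin_cases i <;> simp
  · intro s x
    rw [add_zero, mul_assoc]
    refine norm_le_of_coords ?_
    set y := vec (x 0 + s * (a * x 2)) (x 1 + s * (b * x 2)) (x 2) with hy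
    have y0 : x 0 = y 0 - s * (a * y 2) := by simp [hy]
    have y1 : x 1 = y 1 - s * (b * y 2) := by simp [hy]
    have y2 : x 2 = y 2 := by simp [hy]
    have hs : |(s : ℝ)| ≤ 1 := by rw [abs_of_nonneg s.2.1]; exact s.2.2
    have n0 := abs_coord_le y 0
    have n1 := abs_coord_le y 1
    have n2 := abs_coord_le y 2
    have key : ∀ c : ℝ, |(s : ℝ) * (c * y 2)| ≤ |c| * ‖y‖ := fun c => by
      rw [abs_mul, abs_mul]
      calc |(s : ℝ)| * (|c| * |y 2|) ≤ 1 * (|c| * ‖y‖) := by gcongr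
        _ = _ := one_mul _
    have k1 := key a
    have k2 := key b
    have p1 : 0 ≤ |a| * ‖y‖ := by positivity
    have p2 : 0 ≤ |b| * ‖y‖ := by positivity
    intro i
    fin_cases i
    · change |x 0| ≤ _
      rw [y0]; refine (abs_sub _ _).trans ?_; linarith
    · change |x 1| ≤ _
      rw [y1]; refine (abs_sub _ _).trans ?_; linarith
    · change |x 2| ≤ _
      rw [y2]; linarith
  · intro t
    simp

/-- Vertical translations by a bounded function of the horizontal coordinates. -/
theorem ambientIsotopic_vertical {ι : Type*} {k : Plane → ℝ} (hk : Continuous k) {B : ℝ}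
    (hB : ∀ p, |k p| ≤ B) (Γ : ι → Space) :
    AmbientIsotopic (range fun t => (Γ t : ThreeSphere))
      (range fun t => (vec (Γ t 0) (Γ t 1) (Γ t 2 + k (Γ t 0, Γ t 1)) : ThreeSphere)) := by
  have c0 := (continuous_coord 0).comp (continuous_snd (X := unitInterval))
  have c1 := (continuous_coord 1).comp (continuous_snd (X := unitInterval))
  have c2 := (continuous_coord 2).comp (continuous_snd (X := unitInterval))
  have cs : Continuous fun p : unitInterval × Space => (p.1 : ℝ) :=
    continuous_subtype_val.comp continuous_fst
  refine ambientIsotopic_of_family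
    (fun s x => vec (x 0) (x 1) (x 2 + s * k (x 0, x 1))) ?_ (fun s => ⟨?_, ?_⟩) ?_
    ⟨3, 3 * B, by norm_num, ?_⟩ _ _ ?_
  · exact continuous_vec c0 c1 (c2.add (cs.mul (hk.comp (c0.prodMk c1))))
  · intro x y h
    obtain ⟨h1, h2, h3⟩ := vec_injective h
    rw [h1, h2] at h3
    rw [← vec_eta x, ← vec_eta y, h1, h2, add_right_cancel h3]
  · intro y
    refine ⟨vec (y 0) (y 1) (y 2 - s * k (y 0, y 1)), ?_⟩
    ext i; fin_cases i <;> simp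
  · intro x
    ext i; fin_cases i <;> simp
  · intro s x
    rw [← mul_add]
    refine norm_le_of_coords ?_
    set y := vec (x 0) (x 1) (x 2 + s * k (x 0, x 1)) with hy
    have y0 : x 0 = y 0 := by simp [hy]
    have y1 : x 1 = y 1 := by simp [hy]
    have y2 : x 2 = y 2 - s * k (x 0, x 1) := by simp [hy]
    have n0 := abs_coord_le y 0
    have n1 := abs_coord_le y 1
    have n2 := abs_coord_le y 2
    have key : |(s : ℝ) * k (x 0, x 1)| ≤ B := by
      rw [abs_mul, abs_of_nonneg s.2.1]
      calc (s : ℝ) * |k (x 0, x 1)| ≤ 1 * |k (x 0, x 1)| := by gcongr; exact s.2.2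
        _ ≤ B := by rw [one_mul]; exact hB _
    have hB0 : 0 ≤ B := (abs_nonneg _).trans (hB 0)
    intro i
    fin_cases i
    · change |x 0| ≤ _
      rw [y0]; linarith
    · change |x 1| ≤ _
      rw [y1]; linarith
    · change |x 2| ≤ _
      rw [y2]; refine (abs_sub _ _).trans ?_; linarith
  · intro t
    simp

/-- Scaling the horizontal planes: the cylinder over the plane becomes a cone. -/
theorem ambientIsotopic_cone {ι : Type*} (Γ : ι → Space) (hΓ : ∀ t, 1 ≤ Γ t 2) :
    AmbientIsotopic (range fun t => (Γ t : ThreeSphere))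
      (range fun t => (vec (Γ t 2 * Γ t 0) (Γ t 2 * Γ t 1) (Γ t 2) : ThreeSphere)) := by
  have c0 := (continuous_coord 0).comp (continuous_snd (X := unitInterval))
  have c1 := (continuous_coord 1).comp (continuous_snd (X := unitInterval))
  have c2 := (continuous_coord 2).comp (continuous_snd (X := unitInterval))
  have cs : Continuous fun p : unitInterval × Space => (p.1 : ℝ) :=
    continuous_subtype_val.comp continuous_fst
  -- The scaling factor interpolates between 1 and max z 1. The maximum keeps it at least 1 on all
  -- of space, so that each map is bijective and proper, and does not affect the curve, where z ≥ 1.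
  let m : unitInterval → ℝ → ℝ := fun s z => 1 - s + s * max z 1
  have hm : ∀ s z, 1 ≤ m s z := fun s z => by
    have := mul_le_mul_of_nonneg_left (le_max_right z 1) s.2.1
    simp only [m]; linarith
  have cm : Continuous fun p : unitInterval × Space => m p.1 (p.2 2) :=
    (continuous_const.sub cs).add (cs.mul (c2.max continuous_const))
  refine ambientIsotopic_of_family
    (fun s x => vec (m s (x 2) * x 0) (m s (x 2) * x 1) (x 2)) ?_ (fun s => ⟨?_, ?_⟩) ?_
    ⟨3, 0, by norm_num, ?_⟩ _ _ ?_
  · exact continuous_vec (cm.mul c0) (cm.mul c1) c2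
  · intro x y h
    obtain ⟨h1, h2, h3⟩ := vec_injective h
    rw [h3] at h1 h2
    have h4 : m s (y 2) ≠ 0 := by linarith [hm s (y 2)]
    rw [← vec_eta x, ← vec_eta y, mul_left_cancel₀ h4 h1, mul_left_cancel₀ h4 h2, h3]
  · intro y
    refine ⟨vec ((m s (y 2))⁻¹ * y 0) ((m s (y 2))⁻¹ * y 1) (y 2), ?_⟩
    have h4 : m s (y 2) ≠ 0 := by linarith [hm s (y 2)]
    ext i; fin_cases i <;> simp [h4]
  · intro x
    ext i; fin_cases i <;> simp [m]
  · intro s x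
    rw [add_zero]
    refine norm_le_of_coords ?_
    set y := vec (m s (x 2) * x 0) (m s (x 2) * x 1) (x 2) with hy
    have key : ∀ c, |c| ≤ |m s (x 2) * c| := fun c => by
      rw [abs_mul]
      exact le_mul_of_one_le_left (abs_nonneg c) ((hm s _).trans (le_abs_self _))
    have n0 := abs_coord_le y 0
    have n1 := abs_coord_le y 1
    have n2 := abs_coord_le y 2
    intro i
    fin_cases i
    · exact (key _).trans n0
    · exact (key _).trans n1
    · exact n2
  · intro t
    simp [m, max_eq_left (hΓ t)]

/-- A perturbation of a knot whose displacement is horizontal and Lipschitz with a small constant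
does not change its isotopy class. -/
theorem ambientIsotopic_of_lipschitz {ι : Type*} (Γ : ι → Space) (α β : ι → ℝ)
    (hα : ∀ t t', |α t - α t'| ≤ 1 / 4 * ‖Γ t - Γ t'‖)
    (hβ : ∀ t t', |β t - β t'| ≤ 1 / 4 * ‖Γ t - Γ t'‖) :
    AmbientIsotopic (range fun t => (Γ t : ThreeSphere))
      (range fun t => (Γ t + vec (α t) (β t) 0 : ThreeSphere)) := by
  -- A Lipschitz function on the curve extends to space with the same constant. The hypothesis also
  -- shows that α depends only on the point Γ t, since the bound is 0 when two such points agree.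
  have ext : ∀ α : ι → ℝ, (∀ t t', |α t - α t'| ≤ 1 / 4 * ‖Γ t - Γ t'‖) →
      ∃ g : Space → ℝ, LipschitzWith (1 / 4) g ∧ ∀ t, g (Γ t) = α t := by
    intro α hα
    rcases isEmpty_or_nonempty ι with hι | hι
    · exact ⟨fun _ => 0, LipschitzWith.const' 0, fun t => hι.elim t⟩
    have hinv : ∀ t, Γ (Function.invFun Γ (Γ t)) = Γ t := fun t =>
      Function.invFun_eq ⟨t, rfl⟩
    have hl : LipschitzOnWith (1 / 4) (α ∘ Function.invFun Γ) (range Γ) := by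
      refine LipschitzOnWith.of_dist_le_mul ?_
      rintro _ ⟨t, rfl⟩ _ ⟨t', rfl⟩
      rw [Real.dist_eq, dist_eq_norm]
      have := hα (Function.invFun Γ (Γ t)) (Function.invFun Γ (Γ t'))
      rw [hinv, hinv] at this
      simpa using this
    obtain ⟨g, hg, e⟩ := hl.extend_real
    refine ⟨g, hg, fun t => ?_⟩
    rw [← e ⟨t, rfl⟩]
    have := hα (Function.invFun Γ (Γ t)) t
    rw [hinv, sub_self, norm_zero, mul_zero] at this
    exact sub_eq_zero.1 (abs_nonpos_iff.1 this)
  obtain ⟨g, hg, eg⟩ := ext α hα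
  obtain ⟨h, hh, eh⟩ := ext β hβ
  let κ : Space → Space := fun x => vec (g x) (h x) 0
  have hκ : ∀ x y, ‖κ x - κ y‖ ≤ 1 / 2 * ‖x - y‖ := by
    intro x y
    have e : κ x - κ y = vec (g x - g y) (h x - h y) 0 := by
      ext i; fin_cases i <;> simp [κ]
    have h1 := hg.dist_le_mul x y
    have h2 := hh.dist_le_mul x y
    rw [Real.dist_eq, dist_eq_norm] at h1 h2
    push_cast at h1 h2
    rw [e]
    refine (norm_vec_le _ _ _).trans ?_
    rw [abs_zero]
    linarith
  have hκs : ∀ (s : unitInterval) x y, ‖(s : ℝ) • κ x - (s : ℝ) • κ y‖ ≤ 1 / 2 * ‖x - y‖ := by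
    intro s x y
    rw [← smul_sub, norm_smul, Real.norm_of_nonneg s.2.1]
    calc (s : ℝ) * ‖κ x - κ y‖ ≤ 1 * ‖κ x - κ y‖ := by gcongr; exact s.2.2
      _ ≤ _ := by rw [one_mul]; exact hκ x y
  refine ambientIsotopic_of_family (fun s x => x + (s : ℝ) • κ x) ?_ (fun s => ⟨?_, ?_⟩) ?_
    ⟨2, 2 * ‖κ 0‖, by norm_num, ?_⟩ _ _ ?_
  · have : Continuous κ := continuous_vec hg.continuous hh.continuous continuous_const
    fun_prop
  · intro x y hxy
    have h1 := hκs s y x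
    have h2 : (s : ℝ) • κ y - (s : ℝ) • κ x = x - y := by
      have : x + (s : ℝ) • κ x = y + (s : ℝ) • κ y := hxy
      rw [sub_eq_sub_iff_add_eq_add, add_comm, ← this, add_comm]
    rw [h2, norm_sub_rev y x] at h1
    have h3 : ‖x - y‖ = 0 := le_antisymm (by linarith) (norm_nonneg _)
    exact sub_eq_zero.1 (norm_eq_zero.1 h3)
  · intro y
    -- Solving x + s • κ x = y amounts to finding a fixed point of x ↦ y - s • κ x. The two
    -- Lipschitz constants 1/4 add up to the contraction constant 1/2.
    have hc : ContractingWith (1 / 2) fun x => y - (s : ℝ) • κ x := by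
      refine ⟨by rw [← NNReal.coe_lt_coe]; norm_num, LipschitzWith.of_dist_le_mul fun x x' => ?_⟩
      rw [dist_eq_norm, dist_eq_norm, sub_sub_sub_cancel_left, norm_sub_rev x x']
      push_cast
      exact hκs s x' x
    refine ⟨ContractingWith.fixedPoint _ hc, ?_⟩
    have := hc.fixedPoint_isFixedPt
    exact (eq_sub_iff_add_eq.1 this.symm)
  · intro x
    simp
  · intro s x
    have h1 := hκs s x 0
    have h2 : ‖(s : ℝ) • κ 0‖ ≤ ‖κ 0‖ := by
      rw [norm_smul, Real.norm_of_nonneg s.2.1]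
      exact mul_le_of_le_one_left (norm_nonneg _) s.2.2
    rw [sub_zero] at h1
    have h3 : ‖x‖ ≤ ‖x + (s : ℝ) • κ x‖ + ‖(s : ℝ) • κ x - (s : ℝ) • κ 0‖ + ‖(s : ℝ) • κ 0‖ := by
      have e : x = (x + (s : ℝ) • κ x) - ((s : ℝ) • κ x - (s : ℝ) • κ 0) - (s : ℝ) • κ 0 := by abel
      calc ‖x‖ = ‖(x + (s : ℝ) • κ x) - ((s : ℝ) • κ x - (s : ℝ) • κ 0) - (s : ℝ) • κ 0‖ := by
            rw [← e]
        _ ≤ _ := (norm_sub_le _ _).trans (by gcongr; exact norm_sub_le _ _)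
    linarith
  · intro t
    simp [κ, eg, eh]

/-! ## Transverse crossings of differentiable curves -/

/-- The map (x, y) ↦ γ₁ (s + x) + γ₂ (t + y) - γ₁ s takes the axes to the two curves. Its derivative
at the origin has columns v and w, so the inverse function theorem makes it a local homeomorphism.
-/
theorem exists_chart_of_transverse {γ₁ γ₂ : ℝ → Plane} {s t : ℝ} {v w : Plane}
    (h₁ : HasStrictDerivAt γ₁ v s) (h₂ : HasStrictDerivAt γ₂ w t) (he : γ₁ s = γ₂ t)
    (hdet : v.1 * w.2 - v.2 * w.1 ≠ 0) :
    ∃ ψ : Plane → Plane, IsOpenEmbedding ψ ∧ ψ (0, 0) = γ₁ s ∧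
      (∀ᶠ u in 𝓝 s, ∃ x : ℝ, γ₁ u = ψ (x, 0)) ∧ (∀ᶠ u in 𝓝 t, ∃ y : ℝ, γ₂ u = ψ (0, y)) := by
  let L : Plane →ₗ[ℝ] Plane :=
    { toFun := fun p => p.1 • v + p.2 • w
      map_add' := fun p q => by simp only [Prod.fst_add, Prod.snd_add, add_smul]; abel
      map_smul' := fun c p => by simp [smul_smul] }
  have hLinj : Function.Injective L := by
    rw [← LinearMap.ker_eq_bot, LinearMap.ker_eq_bot']
    intro p hp
    have h1 : p.1 * v.1 + p.2 * w.1 = 0 := congrArg Prod.fst hp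
    have h2 : p.1 * v.2 + p.2 * w.2 = 0 := congrArg Prod.snd hp
    have e1 : p.1 * (v.1 * w.2 - v.2 * w.1) = 0 := by linear_combination w.2 * h1 - w.1 * h2
    have e2 : p.2 * (v.1 * w.2 - v.2 * w.1) = 0 := by linear_combination v.1 * h2 - v.2 * h1
    exact Prod.ext ((mul_eq_zero.1 e1).resolve_right hdet) ((mul_eq_zero.1 e2).resolve_right hdet)
  let Le : Plane ≃L[ℝ] Plane := (LinearEquiv.ofInjectiveEndo L hLinj).toContinuousLinearEquiv
  let Ψ : Plane → Plane := fun p => γ₁ (s + p.1) + γ₂ (t + p.2) - γ₁ s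
  have hΨ : HasStrictFDerivAt Ψ (Le : Plane →L[ℝ] Plane) (0, 0) := by
    have a1 : HasStrictFDerivAt (fun p : Plane => s + p.1) (ContinuousLinearMap.fst ℝ ℝ ℝ) (0, 0) :=
      (hasStrictFDerivAt_fst).const_add s
    have a2 : HasStrictFDerivAt (fun p : Plane => t + p.2) (ContinuousLinearMap.snd ℝ ℝ ℝ) (0, 0) :=
      (hasStrictFDerivAt_snd).const_add t
    have b1 := HasStrictFDerivAt.comp (0, 0) (f := fun p : Plane => s + p.1) (g := γ₁)
      (by simpa using h₁.hasStrictFDerivAt) a1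
    have b2 := HasStrictFDerivAt.comp (0, 0) (f := fun p : Plane => t + p.2) (g := γ₂)
      (by simpa using h₂.hasStrictFDerivAt) a2
    refine ((b1.add b2).sub_const (γ₁ s)).congr_fderiv ?_
    ext <;> simp [Le, L]
  let e := hΨ.toOpenPartialHomeomorph Ψ
  have hsrc : ((0, 0) : Plane) ∈ e.source := hΨ.mem_toOpenPartialHomeomorph_source
  obtain ⟨ε, hε, hball⟩ := Metric.isOpen_iff.1 e.open_source _ hsrc
  -- The chart has to be defined on the whole plane: each axis is squeezed into (-ε, ε), which
  -- preserves the axes and the origin.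
  let φ := OpenPartialHomeomorph.univBall (0 : ℝ) ε
  have φs : φ.source = univ := OpenPartialHomeomorph.univBall_source 0 ε
  have φt : φ.target = Metric.ball 0 ε := OpenPartialHomeomorph.univBall_target 0 hε
  have φ0 : φ 0 = 0 := OpenPartialHomeomorph.univBall_apply_zero 0 ε
  have φm : ∀ x, φ x ∈ Metric.ball (0 : ℝ) ε := fun x => φt ▸ φ.map_source (by rw [φs]; trivial)
  let E := (φ.prod φ).trans e
  have hE : E.source = univ := by
    rw [OpenPartialHomeomorph.trans_source, OpenPartialHomeomorph.prod_source, φs, univ_prod_univ,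
      univ_inter]
    refine eq_univ_of_forall fun p => hball ?_
    rw [← ball_prod_same]
    exact ⟨φm p.1, φm p.2⟩
  have hE' : ∀ x y, E (x, y) = Ψ (φ x, φ y) := fun x y => rfl
  refine ⟨E, E.isOpenEmbedding hE, ?_, ?_, ?_⟩
  · rw [hE', φ0]
    simp [Ψ, ← he]
  · have : ∀ᶠ u in 𝓝 s, u - s ∈ Metric.ball (0 : ℝ) ε :=
      (continuous_sub_right s).continuousAt.eventually_mem (by simpa using Metric.ball_mem_nhds _ hε)
    filter_upwards [this] with u hu
    refine ⟨φ.symm (u - s), ?_⟩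
    rw [hE', φ0, φ.right_inv (by rwa [φt])]
    simp [Ψ, ← he]
  · have : ∀ᶠ u in 𝓝 t, u - t ∈ Metric.ball (0 : ℝ) ε :=
      (continuous_sub_right t).continuousAt.eventually_mem (by simpa using Metric.ball_mem_nhds _ hε)
    filter_upwards [this] with u hu
    refine ⟨φ.symm (u - t), ?_⟩
    rw [hE', φ0, φ.right_inv (by rwa [φt])]
    simp [Ψ]

/-! ## Generic projections -/

/-- The determinant of three vectors. -/
def det3 (u v w : Space) : ℝ :=
  w 0 * (u 1 * v 2 - u 2 * v 1) + w 1 * (u 2 * v 0 - u 0 * v 2) + w 2 * (u 0 * v 1 - u 1 * v 0)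

/-- Directions of projection on a curve not contained in a conic. -/
def dir (τ : ℝ) : Space := vec (-τ) (-τ ^ 3) 1

/-- The projection along `dir τ` to the horizontal plane. -/
def proj (τ : ℝ) (x : Space) : Plane := (x 0 + τ * x 2, x 1 + τ ^ 3 * x 2)

/-- The determinant of two vectors of the plane. -/
def det2 (p q : Plane) : ℝ := p.1 * q.2 - p.2 * q.1

theorem det2_proj (τ : ℝ) (u v : Space) : det2 (proj τ u) (proj τ v) = det3 u v (dir τ) := by
  simp [det2, proj, det3, dir, vec]; ring

/-- On `dir τ` the six quadratic monomials become, up to sign, τ to the powers 2, 6, 0, 4, 1, 3.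
These are distinct, so a nonzero quadratic form restricts to a nonzero polynomial in τ. The exponent
3 in `dir` is chosen for this. -/
theorem finite_zeros_of_quadratic {F : Space → ℝ}
    (hF : ∃ a b c d e f : ℝ, ∀ w : Space, F w = a * w 0 ^ 2 + b * w 1 ^ 2 + c * w 2 ^ 2 +
      d * (w 0 * w 1) + e * (w 0 * w 2) + f * (w 1 * w 2)) (hne : ∃ w, F w ≠ 0) :
    {τ : ℝ | F (dir τ) = 0}.Finite := by
  obtain ⟨a, b, c, d, e, f, hF⟩ := hF
  obtain ⟨w, hw⟩ := hne
  open Polynomial in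
  let p : ℝ[X] := C c + C (-e) * X + C a * X ^ 2 + C (-f) * X ^ 3 + C d * X ^ 4 + C b * X ^ 6
  have hp : p ≠ 0 := by
    intro h
    have hc : ∀ n, p.coeff n = 0 := fun n => by rw [h, Polynomial.coeff_zero]
    have h0 := hc 0
    have h1 := hc 1
    have h2 := hc 2
    have h3 := hc 3
    have h4 := hc 4
    have h6 := hc 6
    simp only [p, Polynomial.coeff_add, Polynomial.coeff_C_mul, Polynomial.coeff_C,
      Polynomial.coeff_X, Polynomial.coeff_X_pow] at h0 h1 h2 h3 h4 h6
    norm_num at h0 h1 h2 h3 h4 h6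
    apply hw
    rw [hF, h0, h1, h2, h3, h4, h6]
    ring
  refine (Polynomial.finite_setOfPred_isRoot hp).subset fun τ hτ => ?_
  have : F (dir τ) = p.eval τ := by
    rw [hF]
    simp [p, dir, vec]
    ring
  rw [mem_ofPred_eq, this] at hτ
  exact hτ

/-- The determinant is linear in its last argument; its square is a quadratic form with the same
zeros. -/
theorem finite_zeros_det3 {u v : Space} (h : ∃ w, det3 u v w ≠ 0) :
    {τ : ℝ | det3 u v (dir τ) = 0}.Finite := by
  have := finite_zeros_of_quadratic (F := fun w => det3 u v w ^ 2)
    ⟨(u 1 * v 2 - u 2 * v 1) ^ 2, (u 2 * v 0 - u 0 * v 2) ^ 2, (u 0 * v 1 - u 1 * v 0) ^ 2,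
      2 * (u 1 * v 2 - u 2 * v 1) * (u 2 * v 0 - u 0 * v 2),
      2 * (u 1 * v 2 - u 2 * v 1) * (u 0 * v 1 - u 1 * v 0),
      2 * (u 2 * v 0 - u 0 * v 2) * (u 0 * v 1 - u 1 * v 0), fun w => by simp only [det3]; ring⟩
    (h.imp fun w hw => pow_ne_zero 2 hw)
  simpa using this

/-- The quadratic form expressing that three lines have concurrent projections. -/
def concur (p d p' d' p'' d'' w : Space) : ℝ :=
  det3 p d w * det3 d' d'' w + det3 p' d' w * det3 d'' d w + det3 p'' d'' w * det3 d d' w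

theorem exists_quadratic_det3_mul (u v u' v' : Space) : ∃ a b c d e f : ℝ, ∀ w : Space,
    det3 u v w * det3 u' v' w = a * w 0 ^ 2 + b * w 1 ^ 2 + c * w 2 ^ 2 +
      d * (w 0 * w 1) + e * (w 0 * w 2) + f * (w 1 * w 2) := by
  refine ⟨(u 1 * v 2 - u 2 * v 1) * (u' 1 * v' 2 - u' 2 * v' 1),
    (u 2 * v 0 - u 0 * v 2) * (u' 2 * v' 0 - u' 0 * v' 2),
    (u 0 * v 1 - u 1 * v 0) * (u' 0 * v' 1 - u' 1 * v' 0),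
    (u 1 * v 2 - u 2 * v 1) * (u' 2 * v' 0 - u' 0 * v' 2) +
      (u' 1 * v' 2 - u' 2 * v' 1) * (u 2 * v 0 - u 0 * v 2),
    (u 1 * v 2 - u 2 * v 1) * (u' 0 * v' 1 - u' 1 * v' 0) +
      (u' 1 * v' 2 - u' 2 * v' 1) * (u 0 * v 1 - u 1 * v 0),
    (u 2 * v 0 - u 0 * v 2) * (u' 0 * v' 1 - u' 1 * v' 0) +
      (u' 2 * v' 0 - u' 0 * v' 2) * (u 0 * v 1 - u 1 * v 0), fun w => ?_⟩
  simp only [det3]; ring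

theorem finite_zeros_concur {p d p' d' p'' d'' : Space}
    (h : ∃ w, concur p d p' d' p'' d'' w ≠ 0) :
    {τ : ℝ | concur p d p' d' p'' d'' (dir τ) = 0}.Finite := by
  obtain ⟨a, b, c, e, f, g, h1⟩ := exists_quadratic_det3_mul p d d' d''
  obtain ⟨a', b', c', e', f', g', h2⟩ := exists_quadratic_det3_mul p' d' d'' d
  obtain ⟨a'', b'', c'', e'', f'', g'', h3⟩ := exists_quadratic_det3_mul p'' d'' d d'
  refine finite_zeros_of_quadratic ⟨a + a' + a'', b + b' + b'', c + c' + c'', e + e' + e'',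
    f + f' + f'', g + g' + g'', fun w => ?_⟩ h
  rw [concur, h1, h2, h3]; ring

theorem det3_add_left (u u' v w : Space) : det3 (u + u') v w = det3 u v w + det3 u' v w := by
  simp [det3]; ring

theorem det3_smul_left (c : ℝ) (u v w : Space) : det3 (c • u) v w = c * det3 u v w := by
  simp [det3]; ring

theorem det3_self (u w : Space) : det3 u u w = 0 := by simp [det3]; ring

/-- A Plücker relation. It removes the common base point a from `concur`, so that only the relative
positions b and c along the transversal remain. -/
theorem det3_pluecker (a d d' d'' w : Space) :
    det3 a d w * det3 d' d'' w + det3 a d' w * det3 d'' d w + det3 a d'' w * det3 d d' w = 0 := by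
  simp only [det3]; ring

/-- The form `concur` at three lines meeting a line of direction `w₀` at `a`, `a + b • w₀` and
`a + c • w₀`. -/
theorem concur_eq {p d p' d' p'' d'' a w₀ : Space} {x x' x'' b c : ℝ} (h : p + x • d = a)
    (h' : p' + x' • d' = a + b • w₀) (h'' : p'' + x'' • d'' = a + c • w₀) (w : Space) :
    concur p d p' d' p'' d'' w =
      b * det3 w₀ d' w * det3 d'' d w + c * det3 w₀ d'' w * det3 d d' w := by
  have e : ∀ (p d q : Space) (x : ℝ), p + x • d = q → ∀ w, det3 p d w = det3 q d w := by
    rintro p d _ x rfl w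
    rw [det3_add_left, det3_smul_left, det3_self, mul_zero, add_zero]
  rw [concur, e _ _ _ _ h, e _ _ _ _ h', e _ _ _ _ h'']
  simp only [det3_add_left, det3_smul_left]
  linear_combination det3_pluecker a d d' d'' w

/-- At w₀ + d the form factors as (b - c) times two determinants. So three lines met by one
transversal at suitable points do not project to concurrent lines in every direction. -/
theorem concur_ne_zero {p d p' d' p'' d'' a w₀ : Space} {x x' x'' b c : ℝ} (h : p + x • d = a)
    (h' : p' + x' • d' = a + b • w₀) (h'' : p'' + x'' • d'' = a + c • w₀) (hbc : b ≠ c)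
    (h1 : det3 d d' w₀ ≠ 0) (h2 : det3 d d'' w₀ ≠ 0) :
    concur p d p' d' p'' d'' (w₀ + d) ≠ 0 := by
  rw [concur_eq h h' h'']
  have e1 : det3 w₀ d' (w₀ + d) = - det3 d d' w₀ := by simp [det3]; ring
  have e2 : det3 d'' d (w₀ + d) = - det3 d d'' w₀ := by simp [det3]; ring
  have e3 : det3 w₀ d'' (w₀ + d) = - det3 d d'' w₀ := by simp [det3]; ring
  have e4 : det3 d d' (w₀ + d) = det3 d d' w₀ := by simp [det3]; ring
  rw [e1, e2, e3, e4]
  have : b * -det3 d d' w₀ * -det3 d d'' w₀ + c * -det3 d d'' w₀ * det3 d d' w₀ =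
    (b - c) * (det3 d d' w₀ * det3 d d'' w₀) := by ring
  rw [this]
  exact mul_ne_zero (sub_ne_zero.2 hbc) (mul_ne_zero h1 h2)

theorem concur_eq_zero {p d p' d' p'' d'' a w₀ : Space} {x x' x'' b c : ℝ} (h : p + x • d = a)
    (h' : p' + x' • d' = a + b • w₀) (h'' : p'' + x'' • d'' = a + c • w₀) :
    concur p d p' d' p'' d'' w₀ = 0 := by
  rw [concur_eq h h' h'']
  have e : ∀ d', det3 w₀ d' w₀ = 0 := fun d' => by simp only [det3]; ring
  rw [e, e]; ring

/-- A direction which is generic for finitely many vectors and lines. -/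
theorem exists_generic_dir {ι κ : Type*} [Finite ι] [Finite κ] (u : ι → Space) (p d : κ → Space) :
    ∃ τ, (∀ i j, (∃ w, det3 (u i) (u j) w ≠ 0) → det3 (u i) (u j) (dir τ) ≠ 0) ∧
      ∀ i j k, (∃ w, concur (p i) (d i) (p j) (d j) (p k) (d k) w ≠ 0) →
        concur (p i) (d i) (p j) (d j) (p k) (d k) (dir τ) ≠ 0 := by
  let A : Set ℝ := ⋃ i, ⋃ j, ⋃ _h : ∃ w, det3 (u i) (u j) w ≠ 0, {τ | det3 (u i) (u j) (dir τ) = 0}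
  let B : Set ℝ := ⋃ i, ⋃ j, ⋃ k, ⋃ _h : ∃ w, concur (p i) (d i) (p j) (d j) (p k) (d k) w ≠ 0,
    {τ | concur (p i) (d i) (p j) (d j) (p k) (d k) (dir τ) = 0}
  have hA : A.Finite := finite_iUnion fun i => finite_iUnion fun j => finite_iUnion fun h =>
    finite_zeros_det3 h
  have hB : B.Finite := finite_iUnion fun i => finite_iUnion fun j => finite_iUnion fun k =>
    finite_iUnion fun h => finite_zeros_concur h
  obtain ⟨τ, hτ⟩ := (hA.union hB).infinite_compl.nonempty
  refine ⟨τ, fun i j h e => hτ (Or.inl ?_), fun i j k h e => hτ (Or.inr ?_)⟩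
  · simp only [A, mem_iUnion]; exact ⟨i, j, h, e⟩
  · simp only [B, mem_iUnion]; exact ⟨i, j, k, h, e⟩

/-! ## Parametrized closed polygons -/

section Polygon

variable {n : ℕ} (v : ZMod n → Space)

/-- The points of the edges of a polygon. -/
def edgePt (i : ZMod n) (α : ℝ) : Space := v i + α • (v (i + 1) - v i)

/-- The periodic parametrization of a polygon. -/
def polyLine (x : ℝ) : Space := edgePt v (⌊x⌋ : ZMod n) (Int.fract x)

theorem polyLine_eq {k : ℤ} {x : ℝ} (hx : x ∈ Icc (k : ℝ) (k + 1)) :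
    polyLine v x = edgePt v k (x - k) := by
  rcases hx.2.lt_or_eq with h | h
  · have : ⌊x⌋ = k := Int.floor_eq_iff.2 ⟨hx.1, h⟩
    rw [polyLine, Int.fract, this]
  · have h' : x = ((k + 1 : ℤ) : ℝ) := by push_cast; exact h
    rw [polyLine, h', Int.floor_intCast, Int.fract_intCast]
    simp [edgePt]

theorem continuous_edgePt (i : ZMod n) : Continuous (edgePt v i) := by
  unfold edgePt; fun_prop

/-- On each interval [k, k + 1], right end included, the parametrization is affine, and these closed
intervals form a locally finite cover. -/
theorem continuous_polyLine : Continuous (polyLine v) := by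
  have hl : LocallyFinite fun k : ℤ => Icc (k : ℝ) (k + 1) := by
    refine locallyFinite_Icc_of_tendsto (f := fun k : ℤ => (k : ℝ)) (g := fun k : ℤ => (k : ℝ) + 1)
      ?_ ?_
    · exact tendsto_intCast_atTop_atTop
    · exact Filter.tendsto_atBot_add_const_right _ 1 (tendsto_intCast_atBot_iff.2 Filter.tendsto_id)
  refine hl.continuous ?_ (fun k => isClosed_Icc) fun k => ?_
  · exact eq_univ_of_forall fun x => mem_iUnion.2
      ⟨⌊x⌋, Int.floor_le x, (Int.lt_floor_add_one x).le⟩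
  · refine ContinuousOn.congr (f := fun x => edgePt v k (x - k)) ?_ fun x hx => polyLine_eq v hx
    exact ((continuous_edgePt v k).comp (continuous_sub_right _)).continuousOn

theorem polyLine_add_card (x : ℝ) : polyLine v (x + n) = polyLine v x := by
  have : x + (n : ℝ) = x + ((n : ℤ) : ℝ) := by simp
  rw [polyLine, polyLine, this, Int.floor_add_intCast, Int.fract_add_intCast]
  simp

/-- A closed polygon as a map from the circle. -/
def polyCircle : UnitAddCircle → Space :=
  Function.Periodic.lift (f := fun x : ℝ => polyLine v (n * x)) (c := 1) fun x => by
    simp only [mul_add, mul_one, polyLine_add_card]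

theorem polyCircle_coe (x : ℝ) : polyCircle v x = polyLine v (n * x) := rfl

theorem continuous_polyCircle : Continuous (polyCircle v) := by
  refine (QuotientAddGroup.isQuotientMap_mk _).continuous_iff.2 ?_
  exact (continuous_polyLine v).comp (continuous_const.mul continuous_id)

/-- The edge on which a parameter lies. -/
def edgeIdx (n : ℕ) (t : UnitAddCircle) : ZMod n := (⌊n * rep 0 t⌋ : ZMod n)

/-- The position of a parameter on its edge. -/
def edgePos (n : ℕ) (t : UnitAddCircle) : ℝ := Int.fract (n * rep 0 t)

theorem polyCircle_eq (t : UnitAddCircle) :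
    polyCircle v t = edgePt v (edgeIdx n t) (edgePos n t) := by
  conv_lhs => rw [← coe_rep_zero t]
  rw [polyCircle_coe]
  rfl

theorem edgePos_mem (t : UnitAddCircle) : edgePos n t ∈ Ico (0 : ℝ) 1 :=
  ⟨Int.fract_nonneg _, Int.fract_lt_one _⟩

theorem edge_injective (hn : 0 < n) {s t : UnitAddCircle} (h : edgeIdx n s = edgeIdx n t)
    (h' : edgePos n s = edgePos n t) : s = t := by
  have hn' : (0 : ℝ) < n := by exact_mod_cast hn
  have hb : ∀ t, 0 ≤ ⌊n * rep 0 t⌋ ∧ ⌊n * rep 0 t⌋ < n := fun t => by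
    have := rep_mem 0 t
    constructor
    · exact Int.floor_nonneg.2 (mul_nonneg hn'.le this.1)
    · rw [Int.floor_lt]
      push_cast
      nlinarith [this.2]
  have e : ⌊n * rep 0 s⌋ = ⌊n * rep 0 t⌋ := by
    have := (ZMod.intCast_eq_intCast_iff _ _ _).1 h
    rwa [Int.ModEq, Int.emod_eq_of_lt (hb s).1 (hb s).2, Int.emod_eq_of_lt (hb t).1 (hb t).2] at this
  have e2 : (n : ℝ) * rep 0 s = n * rep 0 t := by
    rw [← Int.floor_add_fract (n * rep 0 s), ← Int.floor_add_fract (n * rep 0 t), e]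
    exact congrArg _ h'
  exact rep_injective 0 (mul_left_cancel₀ hn'.ne' e2)

theorem exists_edge (hn : 0 < n) (i : ZMod n) {α : ℝ} (hα : α ∈ Ico (0 : ℝ) 1) :
    ∃ t, edgeIdx n t = i ∧ edgePos n t = α := by
  have : NeZero n := ⟨hn.ne'⟩
  have hn' : (0 : ℝ) < n := by exact_mod_cast hn
  have hi : (i.val : ℝ) + 1 ≤ n := by exact_mod_cast i.val_lt
  have h : (i.val + α) / n ∈ Ico (0 : ℝ) 1 := by
    constructor
    · have := hα.1; positivity
    · rw [div_lt_one hn']; linarith [hα.2]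
  have e : n * rep 0 (((i.val + α) / n : ℝ) : UnitAddCircle) = i.val + α := by
    rw [rep_zero_eq h, mul_div_cancel₀ _ hn'.ne']
  refine ⟨(((i.val + α) / n : ℝ) : UnitAddCircle), ?_, ?_⟩
  · rw [edgeIdx, e, Int.floor_natCast_add, Int.floor_eq_zero_iff.2 hα]
    simp
  · rw [edgePos, e, Int.fract_natCast_add, Int.fract_eq_self.2 hα]

theorem range_polyCircle (hn : 0 < n) :
    range (polyCircle v) = ⋃ i : ZMod n, segment ℝ (v i) (v (i + 1)) := by
  have hseg : ∀ i, segment ℝ (v i) (v (i + 1)) = edgePt v i '' Icc 0 1 := fun i =>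
    segment_eq_image' ℝ _ _
  ext x
  simp only [mem_range, mem_iUnion, hseg]
  constructor
  · rintro ⟨t, rfl⟩
    exact ⟨_, _, Ico_subset_Icc_self (edgePos_mem t), (polyCircle_eq v t).symm⟩
  · rintro ⟨i, α, hα, rfl⟩
    rcases hα.2.lt_or_eq with h | rfl
    · obtain ⟨t, h1, h2⟩ := exists_edge hn i ⟨hα.1, h⟩
      exact ⟨t, by rw [polyCircle_eq, h1, h2]⟩
    · obtain ⟨t, h1, h2⟩ := exists_edge hn (i + 1) (α := 0) (by simp)
      exact ⟨t, by rw [polyCircle_eq, h1, h2]; simp [edgePt]⟩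

variable {v}

/-- The assumptions on the vertices of a polygonal knot. -/
structure IsSimplePolygon (v : ZMod n → Space) : Prop where
  three_le : 3 ≤ n
  injective : Function.Injective v
  simple : ∀ i j : ZMod n, i ≠ j →
    segment ℝ (v i) (v (i + 1)) ∩ segment ℝ (v j) (v (j + 1)) ⊆
      {v i, v (i + 1)} ∩ {v j, v (j + 1)}

namespace IsSimplePolygon

theorem edge_ne_zero (h : IsSimplePolygon v) (i : ZMod n) : v (i + 1) - v i ≠ 0 := by
  have : Fact (1 < n) := ⟨by linarith [h.three_le]⟩
  rw [sub_ne_zero, h.injective.ne_iff]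
  simp

theorem edgePt_mem (i : ZMod n) {α : ℝ} (hα : α ∈ Icc (0 : ℝ) 1) :
    edgePt v i α ∈ segment ℝ (v i) (v (i + 1)) := by
  rw [segment_eq_image']; exact ⟨α, hα, rfl⟩

/-- Distinct edges meet only in common vertices. As the parameters stay below 1, such a vertex is
the initial vertex of both edges, and the vertices are distinct. -/
theorem edgePt_injective (h : IsSimplePolygon v) {i j : ZMod n} {α β : ℝ}
    (hα : α ∈ Ico (0 : ℝ) 1) (hβ : β ∈ Ico (0 : ℝ) 1) (he : edgePt v i α = edgePt v j β) :
    i = j ∧ α = β := by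
  by_cases hij : i = j
  · subst hij
    exact ⟨rfl, smul_left_injective ℝ (h.edge_ne_zero i) (add_left_cancel he)⟩
  · exfalso
    have key : ∀ i α, α ∈ Ico (0 : ℝ) 1 → edgePt v i α ∈ ({v i, v (i + 1)} : Set Space) →
        edgePt v i α = v i := by
      rintro i α hα (h' | h')
      · exact h'
      · have e : (α - 1) • (v (i + 1) - v i) = 0 := by
          have h' : v i + α • (v (i + 1) - v i) = v (i + 1) := h'
          rw [sub_smul, one_smul, sub_eq_zero]
          exact eq_sub_of_add_eq' h'
        rcases smul_eq_zero.1 e with h1 | h1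
        · linarith [hα.2]
        · exact absurd h1 (h.edge_ne_zero i)
    have m := h.simple i j hij ⟨edgePt_mem i (Ico_subset_Icc_self hα),
      he ▸ edgePt_mem j (Ico_subset_Icc_self hβ)⟩
    have e1 := key i α hα m.1
    have e2 := key j β hβ (he ▸ m.2)
    exact hij (h.injective (e1.symm.trans (he.trans e2)))

theorem polyCircle_injective (h : IsSimplePolygon v) : Function.Injective (polyCircle v) := by
  intro s t hst
  rw [polyCircle_eq, polyCircle_eq] at hst
  obtain ⟨h1, h2⟩ := h.edgePt_injective (edgePos_mem s) (edgePos_mem t) hst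
  exact edge_injective (by linarith [h.three_le]) h1 h2

end IsSimplePolygon

end Polygon

/-! ### Regular projections of polygons and their diagrams. -/

section PolygonDiagram

theorem proj_add (τ : ℝ) (x y : Space) : proj τ (x + y) = proj τ x + proj τ y := by
  simp [proj]; constructor <;> ring

theorem proj_smul (τ c : ℝ) (x : Space) : proj τ (c • x) = c • proj τ x := by
  simp [proj]; constructor <;> ring

theorem proj_sub (τ : ℝ) (x y : Space) : proj τ (x - y) = proj τ x - proj τ y := by
  simp [proj]; constructor <;> ring

theorem continuous_proj (τ : ℝ) : Continuous (proj τ) := by unfold proj; fun_prop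

theorem det2_smul_self (c : ℝ) (p : Plane) : det2 (c • p) p = 0 := by simp [det2]; ring

theorem space_ext {x y : Space} (h0 : x 0 = y 0) (h1 : x 1 = y 1) (h2 : x 2 = y 2) : x = y := by
  rw [← vec_eta x, ← vec_eta y, h0, h1, h2]

theorem eq_add_smul_dir {τ : ℝ} {x y : Space} (h : proj τ x = proj τ y) :
    y = x + (y 2 - x 2) • dir τ := by
  obtain ⟨h0, h1⟩ := Prod.mk.inj h
  refine space_ext ?_ ?_ ?_ <;> simp [dir, vec] <;> linarith

theorem exists_smul_of_det3 {u d : Space} (hd : d ≠ 0) (h : ∀ w, det3 u d w = 0) :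
    ∃ c : ℝ, u = c • d := by
  have h0 := h (vec 1 0 0)
  have h1 := h (vec 0 1 0)
  have h2 := h (vec 0 0 1)
  simp [det3] at h0 h1 h2
  have : d 0 ≠ 0 ∨ d 1 ≠ 0 ∨ d 2 ≠ 0 := by
    by_contra hc
    push Not at hc
    exact hd (space_ext hc.1 hc.2.1 hc.2.2)
  rcases this with hc | hc | hc
  · refine ⟨u 0 / d 0, space_ext ?_ ?_ ?_⟩ <;> simp <;> field_simp <;> linarith
  · refine ⟨u 1 / d 1, space_ext ?_ ?_ ?_⟩ <;> simp <;> field_simp <;> linarith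
  · refine ⟨u 2 / d 2, space_ext ?_ ?_ ?_⟩ <;> simp <;> field_simp <;> linarith

variable {n : ℕ} {v : ZMod n → Space}

/-- The projection along `dir τ` of a polygon is regular. -/
structure IsRegularProjection (v : ZMod n → Space) (τ : ℝ) : Prop where
  proj_edge_ne_zero : ∀ i, proj τ (v (i + 1) - v i) ≠ 0
  transverse : ∀ i j α β, α ∈ Ico (0 : ℝ) 1 → β ∈ Ico (0 : ℝ) 1 → edgePt v i α ≠ edgePt v j β →
    proj τ (edgePt v i α) = proj τ (edgePt v j β) →
    0 < α ∧ det2 (proj τ (v (i + 1) - v i)) (proj τ (v (j + 1) - v j)) ≠ 0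
  no_triple : ∀ i j k α β γ, α ∈ Ico (0 : ℝ) 1 → β ∈ Ico (0 : ℝ) 1 → γ ∈ Ico (0 : ℝ) 1 →
    edgePt v i α ≠ edgePt v j β → edgePt v i α ≠ edgePt v k γ → edgePt v j β ≠ edgePt v k γ →
    proj τ (edgePt v i α) = proj τ (edgePt v j β) → proj τ (edgePt v i α) ≠ proj τ (edgePt v k γ)

/-- For a generic τ, difference vectors whose projections are parallel to that of an edge are
already parallel to the edge in space. A crossing at a vertex, or of parallel projected edges, would
then make its two points equal. A triple point would make `concur` vanish at `dir τ` without
vanishing identically. -/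
theorem IsSimplePolygon.exists_isRegularProjection (h : IsSimplePolygon v) :
    ∃ τ, IsRegularProjection v τ := by
  have : NeZero n := ⟨by linarith [h.three_le]⟩
  -- The basis vectors join the list so that an edge cannot project to 0: its determinants with the
  -- projected basis vectors would vanish, making the edge parallel to two of them.
  obtain ⟨τ, hτ, hc⟩ := exists_generic_dir
    (Sum.elim (fun p : ZMod n × ZMod n => v p.1 - v p.2)
      (fun k : Fin 3 => EuclideanSpace.single k (1 : ℝ))) v (fun i => v (i + 1) - v i)
  have par : ∀ i j k, det2 (proj τ (v i - v j)) (proj τ (v (k + 1) - v k)) = 0 →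
      ∃ c : ℝ, v i - v j = c • (v (k + 1) - v k) := by
    intro i j k h0
    refine exists_smul_of_det3 (h.edge_ne_zero k) ?_
    by_contra hw
    push Not at hw
    exact hτ (Sum.inl (i, j)) (Sum.inl (k + 1, k)) hw ((det2_proj τ _ _).symm.trans h0)
  have edge : ∀ i, proj τ (v (i + 1) - v i) ≠ 0 := by
    intro i h0
    refine h.edge_ne_zero i ?_
    have key : ∀ k w, det3 (v (i + 1) - v i) (EuclideanSpace.single k (1 : ℝ)) w = 0 := by
      intro k
      by_contra hw
      push Not at hw
      refine hτ (Sum.inl (i + 1, i)) (Sum.inr k) hw ((det2_proj τ _ _).symm.trans ?_)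
      simp only [Sum.elim_inl]
      rw [h0]; simp [det2]
    have k0 := fun w => key 0 w
    have k1 := fun w => key 1 w
    have a1 := k0 (vec 0 1 0)
    have a2 := k0 (vec 0 0 1)
    have a3 := k1 (vec 0 0 1)
    simp [det3, Fin.ext_iff] at a1 a2 a3
    refine space_ext ?_ ?_ ?_ <;> simp <;> linarith
  have smul0 : ∀ (c : ℝ) k, proj τ (c • (v (k + 1) - v k)) = 0 → c = 0 := by
    intro c k h0
    rw [proj_smul] at h0
    exact (smul_eq_zero.1 h0).resolve_right (edge k)
  have trans : ∀ i j α β, α ∈ Ico (0 : ℝ) 1 → β ∈ Ico (0 : ℝ) 1 → edgePt v i α ≠ edgePt v j β →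
      proj τ (edgePt v i α) = proj τ (edgePt v j β) →
      0 < α ∧ det2 (proj τ (v (i + 1) - v i)) (proj τ (v (j + 1) - v j)) ≠ 0 := by
    intro i j α β hα hβ hne he
    have he' : proj τ (v i - v j) = proj τ (β • (v (j + 1) - v j) - α • (v (i + 1) - v i)) := by
      simp only [edgePt, proj_add] at he
      rw [proj_sub, proj_sub, sub_eq_sub_iff_add_eq_add, he, add_comm]
    constructor
    · refine lt_of_le_of_ne hα.1 fun h0 => hne ?_
      rw [← h0, zero_smul, sub_zero] at he'
      obtain ⟨c, hc⟩ := par i j j (by rw [he', proj_smul, det2_smul_self])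
      have : c - β = 0 := smul0 _ j (by
        rw [sub_smul, proj_sub, ← he', ← hc, sub_self])
      rw [← h0, edgePt, edgePt, zero_smul, add_zero, ← sub_eq_zero.1 this, ← hc]
      abel
    · intro h0
      refine hne ?_
      obtain ⟨c, hc⟩ := par (i + 1) i j h0
      rw [hc, smul_smul, ← sub_smul] at he'
      obtain ⟨c', hc'⟩ := par i j j (by rw [he', proj_smul, det2_smul_self])
      have : c' - (β - α * c) = 0 := smul0 _ j (by
        rw [sub_smul, proj_sub, ← he', ← hc', sub_self])
      have e : v i = v j + (β - α * c) • (v (j + 1) - v j) := by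
        rw [← sub_eq_zero.1 this, ← hc']; abel
      rw [edgePt, edgePt, hc, e, smul_smul, add_assoc, ← add_smul]
      congr 2
      ring
  refine ⟨τ, edge, trans, ?_⟩
  intro i j k α β γ hα hβ hγ h1 h2 h3 e1 e2
  have d1 := (trans i j α β hα hβ h1 e1).2
  have d2 := (trans i k α γ hα hγ h2 e2).2
  rw [det2_proj] at d1 d2
  have eB := eq_add_smul_dir e1
  have eC := eq_add_smul_dir e2
  -- The three points over a triple point lie on a line of direction `dir τ`, which serves as the
  -- transversal; its positions b and c differ because the points do.
  refine hc i j k ⟨_, concur_ne_zero rfl eB eC ?_ d1 d2⟩ (concur_eq_zero rfl eB eC)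
  intro hbc
  exact h3 (by rw [eB, eC, hbc])

theorem eventually_nhds_coe {p : UnitAddCircle → Prop} {x : ℝ}
    (h : ∀ᶠ y : ℝ in 𝓝 x, p (y : UnitAddCircle)) : ∀ᶠ u in 𝓝 (x : UnitAddCircle), p u :=
  (QuotientAddGroup.isOpenMap_coe (N := AddSubgroup.zmultiples (1 : ℝ))).nhds_le x h

/-- The parametrization of the line containing the projection of an edge. -/
def edgeCurve (v : ZMod n → Space) (τ : ℝ) (t : UnitAddCircle) (x : ℝ) : Plane :=
  proj τ (v (edgeIdx n t)) + (n * x - ⌊n * rep 0 t⌋ : ℝ) • proj τ (v (edgeIdx n t + 1) - v (edgeIdx n t))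

theorem edgeCurve_eventually (τ : ℝ) {t : UnitAddCircle} (ht : 0 < edgePos n t) :
    ∀ᶠ x : ℝ in 𝓝 (rep 0 t), proj τ (polyCircle v (x : UnitAddCircle)) = edgeCurve v τ t x := by
  have hc : Continuous fun x : ℝ => (n : ℝ) * x := by fun_prop
  have hm : (n : ℝ) * rep 0 t ∈ Ioo (⌊n * rep 0 t⌋ : ℝ) (⌊n * rep 0 t⌋ + 1) := by
    refine ⟨?_, Int.lt_floor_add_one _⟩
    have := Int.floor_add_fract (n * rep 0 t)
    rw [edgePos] at ht
    linarith
  filter_upwards [hc.continuousAt.eventually_mem (isOpen_Ioo.mem_nhds hm)] with x hx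
  rw [polyCircle_coe, polyLine_eq v (Ioo_subset_Icc_self hx), edgePt, proj_add, proj_smul]
  rfl

theorem edgeCurve_rep (τ : ℝ) (t : UnitAddCircle) :
    edgeCurve v τ t (rep 0 t) = proj τ (polyCircle v t) := by
  rw [polyCircle_eq, edgePt, proj_add, proj_smul]
  rfl

theorem edgeCurve_deriv (τ : ℝ) (t : UnitAddCircle) (x : ℝ) :
    HasStrictDerivAt (edgeCurve v τ t)
      ((n : ℝ) • proj τ (v (edgeIdx n t + 1) - v (edgeIdx n t))) x := by
  have h1 : HasStrictDerivAt (fun x : ℝ => (n : ℝ) * x - ⌊n * rep 0 t⌋) (n : ℝ) x := by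
    have := ((hasStrictDerivAt_id x).const_mul (n : ℝ)).sub_const (⌊n * rep 0 t⌋ : ℝ)
    rwa [mul_one] at this
  exact (h1.smul_const _).const_add _

/-- The diagram given by a regular projection of a polygon. -/
def polyDiagram (h : IsSimplePolygon v) {τ : ℝ} (hτ : IsRegularProjection v τ) : Diagram Plane where
  curve t := proj τ (polyCircle v t)
  height t := polyCircle v t 2
  continuous_curve := (continuous_proj τ).comp (continuous_polyCircle v)
  continuous_height := (continuous_coord 2).comp (continuous_polyCircle v)
  height_ne s t hst he hh := by
    refine hst (h.polyCircle_injective ?_)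
    have := eq_add_smul_dir he
    rw [hh, sub_self, zero_smul, add_zero] at this
    exact this.symm
  finite_double := by
    have : NeZero n := ⟨by linarith [h.three_le]⟩
    have hn : 0 < n := by linarith [h.three_le]
    -- Two edges with independent projected directions cross at most once, so a double point is
    -- determined by its pair of edges.
    refine Set.Finite.of_injOn (f := fun p : UnitAddCircle × UnitAddCircle =>
      (edgeIdx n p.1, edgeIdx n p.2)) (t := univ) (fun _ _ => mem_univ _) ?_ finite_univ
    rintro ⟨s, t⟩ ⟨hst, he⟩ ⟨s', t'⟩ ⟨hst', he'⟩ hi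
    obtain ⟨i1, i2⟩ := Prod.mk.inj hi
    simp only at hst he hst' he' i1 i2
    have hne := h.polyCircle_injective.ne hst
    rw [polyCircle_eq v s, polyCircle_eq v t] at he hne
    rw [polyCircle_eq v s', polyCircle_eq v t', ← i1, ← i2] at he'
    have hd := (hτ.transverse _ _ _ _ (edgePos_mem s) (edgePos_mem t) hne he).2
    simp only [edgePt, proj_add, proj_smul] at he he'
    set p := proj τ (v (edgeIdx n s + 1) - v (edgeIdx n s))
    set q := proj τ (v (edgeIdx n t + 1) - v (edgeIdx n t))
    have e1 := congrArg Prod.fst he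
    have e2 := congrArg Prod.snd he
    have e3 := congrArg Prod.fst he'
    have e4 := congrArg Prod.snd he'
    simp only [Prod.fst_add, Prod.snd_add, Prod.smul_fst, Prod.smul_snd, smul_eq_mul] at e1 e2 e3 e4
    rw [det2] at hd
    have f1 : (edgePos n s - edgePos n s') * (p.1 * q.2 - p.2 * q.1) = 0 := by
      linear_combination q.2 * (e1 - e3) - q.1 * (e2 - e4)
    have f2 : (edgePos n t - edgePos n t') * (p.1 * q.2 - p.2 * q.1) = 0 := by
      linear_combination p.2 * (e1 - e3) - p.1 * (e2 - e4)
    exact Prod.ext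
      (edge_injective hn i1 (sub_eq_zero.1 ((mul_eq_zero.1 f1).resolve_right hd)))
      (edge_injective hn i2 (sub_eq_zero.1 ((mul_eq_zero.1 f2).resolve_right hd)))
  no_triple r s t h1 h2 := by
    by_contra hc
    push Not at hc
    have n1 := h.polyCircle_injective.ne hc.1
    have n2 := h.polyCircle_injective.ne hc.2.1
    have n3 := h.polyCircle_injective.ne hc.2.2
    have h3 := h1.trans h2
    simp only [polyCircle_eq] at n1 n2 n3 h1 h2 h3
    exact hτ.no_triple _ _ _ _ _ _ (edgePos_mem r) (edgePos_mem s) (edgePos_mem t) n1 n3 n2 h1 h3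
  transverse s t hst he := by
    have hn : 0 < n := by linarith [h.three_le]
    have hn' : (n : ℝ) ≠ 0 := by exact_mod_cast hn.ne'
    have hne := h.polyCircle_injective.ne hst
    have he' := he
    simp only [polyCircle_eq] at hne he'
    obtain ⟨p1, hd⟩ := hτ.transverse _ _ _ _ (edgePos_mem s) (edgePos_mem t) hne he'
    obtain ⟨p2, -⟩ := hτ.transverse _ _ _ _ (edgePos_mem t) (edgePos_mem s) hne.symm he'.symm
    obtain ⟨ψ, h1, h2, h3, h4⟩ := exists_chart_of_transverse
      (edgeCurve_deriv (v := v) τ s (rep 0 s)) (edgeCurve_deriv (v := v) τ t (rep 0 t))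
      (by rw [edgeCurve_rep, edgeCurve_rep]; exact he) (by
        have e : ∀ p q : Plane, ((n : ℝ) • p).1 * ((n : ℝ) • q).2 - ((n : ℝ) • p).2 * ((n : ℝ) • q).1 =
          (n : ℝ) ^ 2 * det2 p q := fun p q => by simp [det2]; ring
        rw [e]
        exact mul_ne_zero (pow_ne_zero 2 hn') hd)
    refine ⟨ψ, h1, by rw [h2, edgeCurve_rep], ?_, ?_⟩
    · rw [← coe_rep_zero s]
      refine eventually_nhds_coe ?_
      filter_upwards [edgeCurve_eventually (v := v) τ p1, h3] with x e1 e2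
      rwa [e1]
    · rw [← coe_rep_zero t]
      refine eventually_nhds_coe ?_
      filter_upwards [edgeCurve_eventually (v := v) τ p2, h4] with x e1 e2
      rwa [e1]

/-- The shear by τ and τ ^ 3 turns `dir τ` into the vertical direction, so the projection along `dir
τ` becomes the vertical one and the heights stay the same. -/
theorem polyDiagram_represents (h : IsSimplePolygon v) {τ : ℝ} (hτ : IsRegularProjection v τ)
    {K : UnitAddCircle → ThreeSphere} (hK : AmbientIsotopic (range K)
      ((fun x : Space => (x : ThreeSphere)) '' ⋃ i : ZMod n, segment ℝ (v i) (v (i + 1)))) :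
    (polyDiagram h hτ).Represents planeEmbedding K := by
  rw [← range_polyCircle v (by linarith [h.three_le]), ← range_comp] at hK
  exact (hK.trans (ambientIsotopic_shear τ (τ ^ 3) (polyCircle v))).symm

end PolygonDiagram

/-! ## A straight segment of a diagram -/

/-- A frame of the plane together with a parameter interval. -/
structure Slot where
  c : Plane
  e : Plane
  r : ℝ
  t₀ : ℝ
  τ : ℝ
  norm_e : e.1 ^ 2 + e.2 ^ 2 = 1
  r_pos : 0 < r
  τ_pos : 0 < τ
  lo : 0 < t₀ - τ
  hi : t₀ + τ < 1

namespace Slot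

variable (σ : Slot)

/-- The linear part of the frame. -/
def lin (p : Plane) : Plane :=
  (σ.r * (p.1 * σ.e.1 - p.2 * σ.e.2), σ.r * (p.1 * σ.e.2 + p.2 * σ.e.1))

/-- The similarity from the standard plane to the frame. -/
def chart : Plane ≃ₜ Plane where
  toFun p := σ.c + σ.lin p
  invFun q := (((q.1 - σ.c.1) * σ.e.1 + (q.2 - σ.c.2) * σ.e.2) / σ.r,
    (-(q.1 - σ.c.1) * σ.e.2 + (q.2 - σ.c.2) * σ.e.1) / σ.r)
  left_inv p := by
    have := σ.r_pos.ne'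
    have h := σ.norm_e
    ext
    · simp [lin]; field_simp; linear_combination p.1 * h
    · simp [lin]; field_simp; linear_combination p.2 * h
  right_inv q := by
    have := σ.r_pos.ne'
    have h := σ.norm_e
    ext
    · simp [lin]; field_simp; linear_combination (q.1 - σ.c.1) * h
    · simp [lin]; field_simp; linear_combination (q.2 - σ.c.2) * h
  continuous_toFun := by unfold lin; fun_prop
  continuous_invFun := by fun_prop

theorem chart_apply (p : Plane) : σ.chart p = σ.c + σ.lin p := rfl

theorem lin_add (p q : Plane) : σ.lin (p + q) = σ.lin p + σ.lin q := by
  simp [lin]; constructor <;> ring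

theorem chart_add (p q : Plane) : σ.chart (p + q) = σ.chart p + σ.lin q := by
  rw [chart_apply, chart_apply, lin_add, add_assoc]

theorem continuous_lin : Continuous σ.lin := by unfold lin; fun_prop

theorem lin_zero : σ.lin 0 = 0 := by simp [lin]

/-- The coordinate along the segment of a parameter of the circle. -/
def pos (t : UnitAddCircle) : ℝ := (rep 0 t - σ.t₀) / σ.τ

/-- The parameter with given coordinate. -/
def pt (x : ℝ) : UnitAddCircle := ((σ.t₀ + σ.τ * x : ℝ) : UnitAddCircle)

theorem pos_injective : Function.Injective σ.pos := fun s t h => by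
  have := σ.τ_pos.ne'
  refine rep_injective 0 ?_
  have h' := (div_left_inj' this).1 h
  linarith

theorem rep_lt_iff {s t : UnitAddCircle} : rep 0 s < rep 0 t ↔ σ.pos s < σ.pos t := by
  rw [pos, pos, div_lt_div_iff_of_pos_right σ.τ_pos, sub_lt_sub_iff_right]

theorem pos_coe {y : ℝ} (hy : y ∈ Ico (0 : ℝ) 1) :
    σ.pos (y : UnitAddCircle) = (y - σ.t₀) / σ.τ := by
  rw [pos, rep_zero_eq hy]

theorem mem_of_abs_le {x : ℝ} (hx : |x| ≤ 1) : σ.t₀ + σ.τ * x ∈ Ioo (0 : ℝ) 1 := by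
  have h := σ.τ_pos
  have := σ.lo
  have := σ.hi
  rw [abs_le] at hx
  constructor <;> nlinarith

theorem pos_pt {x : ℝ} (hx : |x| ≤ 1) : σ.pos (σ.pt x) = x := by
  have := σ.τ_pos.ne'
  rw [pt, pos_coe _ (Ioo_subset_Ico_self (σ.mem_of_abs_le hx))]
  field_simp; ring

theorem pt_pos (t : UnitAddCircle) : σ.pt (σ.pos t) = t := by
  have := σ.τ_pos.ne'
  rw [pt, pos, mul_div_cancel₀ _ this, add_sub_cancel, coe_rep_zero]

theorem continuous_pt : Continuous σ.pt := by
  have h1 : Continuous fun x : ℝ => σ.t₀ + σ.τ * x := by fun_prop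
  exact (AddCircle.continuous_mk' 1).comp h1

theorem isClosed_abs_pos_le : IsClosed {t | |σ.pos t| ≤ 1} := by
  have : {t | |σ.pos t| ≤ 1} = σ.pt '' Icc (-1) 1 := by
    ext t
    constructor
    · intro h; exact ⟨σ.pos t, abs_le.1 h, σ.pt_pos t⟩
    · rintro ⟨x, hx, rfl⟩
      have := abs_le.2 hx
      simpa [σ.pos_pt this] using this
  rw [this]
  exact (isCompact_Icc.image σ.continuous_pt).isClosed

/-- On the parameter interval the diagram `D` is the horizontal segment of the frame; the rest of
`D` does not meet the square of the frame. -/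
structure IsSlotOf (D : Diagram Plane) : Prop where
  on : ∀ t, |σ.pos t| ≤ 1 → D.curve t = σ.chart (σ.pos t, 0)
  off : ∀ t, 1 < |σ.pos t| → D.curve t ∉ σ.chart '' square

end Slot

/-- On the first edge pick a point that is not a double point. The image of the complement of the
open edge is compact and misses it, so a small square around it meets only that edge. -/
theorem exists_slot_polyDiagram {n : ℕ} {v : ZMod n → Space} (h : IsSimplePolygon v) {τ : ℝ}
    (hτ : IsRegularProjection v τ) : ∃ σ : Slot, σ.IsSlotOf (polyDiagram h hτ) := by
  set D := polyDiagram h hτ with hD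
  have hn : (0 : ℝ) < n := by
    have := h.three_le
    exact_mod_cast (by omega : 0 < n)
  have hn1 : (1 : ℝ) / n ≤ 1 := by
    rw [div_le_one hn]
    have := h.three_le
    exact_mod_cast (by omega : 1 ≤ n)
  set p := proj τ (v 0) with hp
  set q := proj τ (v (0 + 1) - v 0) with hq
  have hcurve : ∀ x : ℝ, x ∈ Icc (0 : ℝ) (1 / n) → D.curve (x : UnitAddCircle) = p + (n * x) • q := by
    intro x hx
    have hx' : (n : ℝ) * x ∈ Icc (((0 : ℤ) : ℝ)) ((0 : ℤ) + 1) := by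
      push_cast
      refine ⟨mul_nonneg hn.le hx.1, ?_⟩
      have := mul_le_mul_of_nonneg_left hx.2 hn.le
      rw [mul_one_div_cancel hn.ne'] at this
      linarith
    change proj τ (polyCircle v (x : UnitAddCircle)) = _
    rw [polyCircle_coe, polyLine_eq v hx', edgePt, proj_add, proj_smul]
    push_cast
    rw [sub_zero]
  obtain ⟨t₀, ht₀, hdp⟩ : ∃ t₀ ∈ Ioo (0 : ℝ) (1 / n), (t₀ : UnitAddCircle) ∉ D.doublePts := by
    have hinf : (Ioo (0 : ℝ) (1 / n)).Infinite := Ioo_infinite (by positivity)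
    have hfin : (rep 0 '' (D.doublePts : Set UnitAddCircle)).Finite :=
      (Finset.finite_toSet _).image _
    obtain ⟨t₀, h1, h2⟩ := (hinf.sdiff hfin).nonempty
    refine ⟨t₀, h1, fun h3 => h2 ⟨_, h3, ?_⟩⟩
    exact rep_zero_eq ⟨h1.1.le, h1.2.trans_le hn1⟩
  set C : Set UnitAddCircle := (arc 0 0 (1 / n))ᶜ with hC
  have hCc : IsCompact (D.curve '' C) :=
    ((isOpen_arc _ _ _).isClosed_compl.isCompact).image D.continuous_curve
  have mem_arc' : ∀ s, s ∈ arc 0 0 (1 / n) ↔ 0 < rep 0 s ∧ rep 0 s < 1 / n := fun s =>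
    mem_arc le_rfl hn1
  have ht₀C : D.curve t₀ ∉ D.curve '' C := by
    rintro ⟨s, hs, he⟩
    by_cases hst : s = t₀
    · rw [hst] at hs
      refine hs ((mem_arc' _).2 ?_)
      rw [rep_zero_eq ⟨ht₀.1.le, ht₀.2.trans_le hn1⟩]
      exact ht₀
    · exact hdp (Diagram.mem_doublePts.2 ⟨s, hst, he⟩)
  obtain ⟨η, hη, hball⟩ := Metric.isOpen_iff.1 hCc.isClosed.isOpen_compl _ ht₀C
  have hq0 : q ≠ 0 := hτ.proj_edge_ne_zero 0
  have hl2 : 0 < q.1 ^ 2 + q.2 ^ 2 := by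
    rcases lt_or_eq_of_le (add_nonneg (sq_nonneg q.1) (sq_nonneg q.2)) with h1 | h1
    · exact h1
    · exfalso
      have a1 : q.1 ^ 2 = 0 := by nlinarith [sq_nonneg q.1, sq_nonneg q.2]
      have a2 : q.2 ^ 2 = 0 := by nlinarith [sq_nonneg q.1, sq_nonneg q.2]
      exact hq0 (Prod.ext (pow_eq_zero_iff two_ne_zero |>.1 a1) (pow_eq_zero_iff two_ne_zero |>.1 a2))
  set len := √(q.1 ^ 2 + q.2 ^ 2) with hlen
  have hlpos : 0 < len := Real.sqrt_pos.2 hl2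
  have hlsq : len ^ 2 = q.1 ^ 2 + q.2 ^ 2 := Real.sq_sqrt hl2.le
  -- The edge is traversed with speed n * len, so the half-interval ω corresponds to the half-side r
  -- = n * ω * len. A rotated square of that size has coordinates at most 2 * r from its centre; the
  -- factor 4 makes this strictly less than η.
  obtain ⟨ω, hω, w1, w2, w3⟩ : ∃ ω > 0, ω < t₀ ∧ ω < 1 / n - t₀ ∧ n * ω * len * 4 ≤ η := by
    refine ⟨min (min (t₀ / 2) ((1 / n - t₀) / 2)) (η / (4 * (n * len))), ?_, ?_, ?_, ?_⟩
    · have := ht₀.1; have := sub_pos.2 ht₀.2; positivity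
    · have := ht₀.1
      linarith [min_le_left (min (t₀ / 2) ((1 / n - t₀) / 2)) (η / (4 * (n * len))),
        min_le_left (t₀ / 2) ((1 / n - t₀) / 2)]
    · have := ht₀.2
      linarith [min_le_left (min (t₀ / 2) ((1 / n - t₀) / 2)) (η / (4 * (n * len))),
        min_le_right (t₀ / 2) ((1 / n - t₀) / 2)]
    · have := min_le_right (min (t₀ / 2) ((1 / n - t₀) / 2)) (η / (4 * (n * len)))
      rw [le_div_iff₀ (by positivity)] at this
      linarith
  let σ : Slot :=
    { c := D.curve t₀
      e := (q.1 / len, q.2 / len)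
      r := n * ω * len
      t₀ := t₀
      τ := ω
      norm_e := by
        simp only
        rw [div_pow, div_pow, ← add_div, ← hlsq, div_self (by positivity)]
      r_pos := by positivity
      τ_pos := hω
      lo := by linarith
      hi := by linarith }
  have hline : ∀ t, t ∈ arc 0 0 (1 / n) → D.curve t = σ.chart (σ.pos t, 0) := by
    intro t ht
    rw [mem_arc'] at ht
    have e1 := hcurve (rep 0 t) ⟨ht.1.le, ht.2.le⟩
    rw [coe_rep_zero] at e1
    have e2 := hcurve t₀ ⟨ht₀.1.le, ht₀.2.le⟩
    rw [e1, Slot.chart_apply]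
    change _ = D.curve t₀ + _
    rw [e2]
    have hl := hlpos.ne'
    have ho := hω.ne'
    ext
    · simp [Slot.lin, Slot.pos, σ]; field_simp; ring
    · simp [Slot.lin, Slot.pos, σ]; field_simp; ring
  have hsq : ∀ x ∈ square, σ.chart x ∈ Metric.ball (D.curve t₀) η := by
    rintro x ⟨hx1, hx2⟩
    have b1 : |x.1| ≤ 1 := abs_le.2 hx1
    have b2 : |x.2| ≤ 1 := abs_le.2 hx2
    have c1 : |σ.e.1| ≤ 1 := by
      rw [← sq_le_one_iff_abs_le_one]; nlinarith [σ.norm_e, sq_nonneg σ.e.2]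
    have c2 : |σ.e.2| ≤ 1 := by
      rw [← sq_le_one_iff_abs_le_one]; nlinarith [σ.norm_e, sq_nonneg σ.e.1]
    have key : ∀ a b c d : ℝ, |a| ≤ 1 → |b| ≤ 1 → |c| ≤ 1 → |d| ≤ 1 → |a * b| + |c * d| ≤ 2 := by
      intro a b c d h1 h2 h3 h4
      rw [abs_mul, abs_mul]
      have := mul_le_one₀ h1 (abs_nonneg b) h2
      have := mul_le_one₀ h3 (abs_nonneg d) h4
      linarith
    have hr := σ.r_pos
    have hr4 : σ.r * 2 < η := by
      have : σ.r * 4 ≤ η := w3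
      linarith
    rw [Metric.mem_ball, dist_eq_norm, Slot.chart_apply]
    change ‖D.curve t₀ + σ.lin x - D.curve t₀‖ < η
    rw [add_sub_cancel_left, Prod.norm_def, max_lt_iff]
    simp only [Slot.lin, Real.norm_eq_abs, abs_mul σ.r, abs_of_pos hr]
    constructor
    · refine lt_of_le_of_lt ?_ hr4
      refine mul_le_mul_of_nonneg_left ((abs_sub _ _).trans (key _ _ _ _ b1 c1 b2 c2)) hr.le
    · refine lt_of_le_of_lt ?_ hr4
      refine mul_le_mul_of_nonneg_left ((abs_add_le _ _).trans (key _ _ _ _ b1 c2 b2 c1)) hr.le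
  refine ⟨σ, fun t ht => hline t ((mem_arc' t).2 ?_), fun t ht => ?_⟩
  · rw [Slot.pos, abs_le, le_div_iff₀ σ.τ_pos, div_le_iff₀ σ.τ_pos] at ht
    have e1 : σ.t₀ = t₀ := rfl
    have e2 : σ.τ = ω := rfl
    rw [e1, e2] at ht
    constructor <;> linarith [ht.1, ht.2]
  · by_cases hta : t ∈ arc 0 0 (1 / n)
    · rw [hline t hta]
      rintro ⟨x, hx, e⟩
      rw [σ.chart.injective e] at hx
      have := abs_le.2 hx.1
      simp only at this
      linarith
    · rintro ⟨x, hx, e⟩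
      exact hball (hsq x hx) ⟨t, hta, e.symm⟩

/-- A knot has a diagram with a straight segment. -/
theorem exists_diagram_with_slot {K : UnitAddCircle → ThreeSphere} (hK : IsTameKnot K) :
    ∃ (D : Diagram Plane) (σ : Slot), D.Represents planeEmbedding K ∧ σ.IsSlotOf D := by
  obtain ⟨L, ⟨n, v, h1, h2, h3, rfl⟩, hL⟩ := hK.tame
  have h : IsSimplePolygon v := ⟨h1, h2, h3⟩
  obtain ⟨τ, hτ⟩ := h.exists_isRegularProjection
  obtain ⟨σ, hσ⟩ := exists_slot_polyDiagram h hτ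
  exact ⟨_, σ, polyDiagram_represents h hτ hL, hσ⟩

/-- Changing the height of a diagram by a function of the point of the plane. -/
def Diagram.addHeight (D : Diagram Plane) (k : Plane → ℝ) (hk : Continuous k) : Diagram Plane where
  curve := D.curve
  height t := D.height t + k (D.curve t)
  continuous_curve := D.continuous_curve
  continuous_height := D.continuous_height.add (hk.comp D.continuous_curve)
  height_ne s t hst he := by
    rw [he]
    exact fun h => D.height_ne s t hst he (add_right_cancel h)
  finite_double := D.finite_double
  no_triple := D.no_triple
  transverse := D.transverse

theorem Diagram.addHeight_represents {D : Diagram Plane} {K : UnitAddCircle → ThreeSphere}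
    (hD : D.Represents planeEmbedding K) {k : Plane → ℝ} (hk : Continuous k) {B : ℝ}
    (hB : ∀ p, |k p| ≤ B) : (D.addHeight k hk).Represents planeEmbedding K :=
  (ambientIsotopic_vertical hk hB fun t =>
    vec (D.curve t).1 (D.curve t).2 (D.height t)).symm.trans hD

theorem Diagram.exists_abs_height_le (D : Diagram Plane) : ∃ M, ∀ t, |D.height t| ≤ M := by
  obtain ⟨M, hM⟩ := isCompact_univ.exists_bound_of_continuousOn D.continuous_height.continuousOn
  exact ⟨M, fun t => hM t trivial⟩

/-- A knot has a diagram with a straight segment along which the height is a steep valley. -/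
theorem exists_diagram_with_valley {K : UnitAddCircle → ThreeSphere} (hK : IsTameKnot K) :
    ∃ (D : Diagram Plane) (σ : Slot), D.Represents planeEmbedding K ∧ σ.IsSlotOf D ∧
      ∀ t, |σ.pos t| ≤ 1 / 2 → D.height t = 100 * σ.r * |σ.pos t| := by
  obtain ⟨D, σ, hD, hσ⟩ := exists_diagram_with_slot hK
  obtain ⟨M, hM⟩ := D.exists_abs_height_le
  let cl : ℝ → ℝ := fun x => max (-1) (min 1 x)
  have hcl : ∀ x, |cl x| ≤ 1 := fun x => abs_le.2 ⟨le_max_left _ _,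
    max_le (by norm_num) (min_le_left _ _)⟩
  have hcl' : ∀ x, |x| ≤ 1 → cl x = x := fun x hx => by
    rw [abs_le] at hx
    simp only [cl]
    rw [min_eq_right hx.2, max_eq_right hx.1]
  have ccl : Continuous cl := by fun_prop
  -- A cutoff equal to 1 where both coordinates are at most 1/2 in absolute value, and to 0 outside
  -- the square.
  let w : Plane → ℝ := fun p => max 0 (min 1 (2 - 2 * max |p.1| |p.2|))
  have hw : ∀ p, |w p| ≤ 1 := fun p => by
    rw [abs_of_nonneg (le_max_left _ _)]
    exact max_le (by norm_num) (min_le_left _ _)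
  have cw : Continuous w := by fun_prop
  -- The correction replaces the height on the middle half of the segment by the valley. The slope
  -- 100 * r is chosen to dominate the displacement caused by the curls; `cl` keeps the parameter on
  -- the segment.
  let k₀ : Plane → ℝ := fun p => w p * (100 * σ.r * |cl p.1| - D.height (σ.pt (cl p.1)))
  have ck₀ : Continuous k₀ := by
    have := D.continuous_height
    have := σ.continuous_pt
    fun_prop
  have hr := σ.r_pos
  have hk₀ : ∀ p, |k₀ p| ≤ 100 * σ.r + M := by
    intro p
    simp only [k₀]
    rw [abs_mul]
    calc _ ≤ 1 * |100 * σ.r * |cl p.1| - D.height (σ.pt (cl p.1))| := by gcongr; exact hw p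
      _ ≤ |100 * σ.r * (|cl p.1|)| + |D.height (σ.pt (cl p.1))| := by
        rw [one_mul]; exact abs_sub _ _
      _ ≤ _ := by
        refine add_le_add ?_ (hM _)
        rw [abs_of_nonneg (by positivity)]
        exact mul_le_of_le_one_right (by positivity) (hcl _)
  let k : Plane → ℝ := k₀ ∘ σ.chart.symm
  have ck : Continuous k := ck₀.comp σ.chart.symm.continuous
  refine ⟨D.addHeight k ck, σ, Diagram.addHeight_represents hD ck fun p => hk₀ _,
    ⟨hσ.on, hσ.off⟩, fun t ht => ?_⟩
  have ht1 : |σ.pos t| ≤ 1 := by linarith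
  change D.height t + k (D.curve t) = _
  rw [hσ.on t ht1]
  simp only [k, k₀, Function.comp_apply, σ.chart.symm_apply_apply, hcl' _ ht1, σ.pt_pos]
  have : w (σ.pos t, 0) = 1 := by
    simp only [w, abs_zero]
    rw [max_eq_left (abs_nonneg (σ.pos t)), min_eq_left (by linarith), max_eq_right (by norm_num)]
  rw [this]; ring

/-! ## Curls on a straight segment -/

section CurlOffset

/-- The closest point of `[-1, 1]`. -/
def clamp (x : ℝ) : ℝ := max (-1) (min 1 x)

theorem continuous_clamp : Continuous clamp := by unfold clamp; fun_prop

theorem abs_clamp_le (x : ℝ) : |clamp x| ≤ 1 :=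
  abs_le.2 ⟨le_max_left _ _, max_le (by norm_num) (min_le_left _ _)⟩

theorem clamp_of_abs_le {x : ℝ} (hx : |x| ≤ 1) : clamp x = x := by
  rw [abs_le] at hx
  rw [clamp, min_eq_right hx.2, max_eq_right hx.1]

theorem sq_clamp_of_le_abs {x : ℝ} (hx : 1 ≤ |x|) : clamp x ^ 2 = 1 := by
  rw [clamp]
  rcases le_abs.1 hx with h | h
  · rw [min_eq_left h]; norm_num
  · rw [min_eq_right (by linarith), max_eq_left (by linarith)]; norm_num

theorem abs_clamp_sub_le (x y : ℝ) : |clamp x - clamp y| ≤ |x - y| := by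
  have := (abs_max_sub_max_le_max (-1) (min 1 x) (-1) (min 1 y))
  refine this.trans ?_
  rw [sub_self, abs_zero, max_eq_right (abs_nonneg _)]
  refine (abs_min_sub_min_le_max 1 x 1 y).trans ?_
  rw [sub_self, abs_zero, max_eq_right (abs_nonneg _)]

/-- The displacement of a straight strand that creates a curl. -/
def curlOffset (u : ℝ) : Plane :=
  (2 * clamp u ^ 3 - 2 * clamp u, (1 - clamp u ^ 2) / 2)

theorem continuous_curlOffset : Continuous curlOffset := by
  have := continuous_clamp
  unfold curlOffset; fun_prop

theorem curlOffset_of_abs_le {u : ℝ} (hu : |u| ≤ 1) :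
    curlOffset u = (2 * u ^ 3 - 2 * u, (1 - u ^ 2) / 2) := by
  rw [curlOffset, clamp_of_abs_le hu]

theorem curlOffset_of_le_abs {u : ℝ} (hu : 1 ≤ |u|) : curlOffset u = 0 := by
  have h := sq_clamp_of_le_abs hu
  ext
  · simp only [curlOffset, Prod.fst_zero]
    linear_combination 2 * clamp u * h
  · simp only [curlOffset, Prod.snd_zero, h]; norm_num

theorem abs_curlOffset_le (u : ℝ) : |(curlOffset u).1| ≤ 1 ∧ |(curlOffset u).2| ≤ 1 := by
  have h := abs_le.1 (abs_clamp_le u)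
  set v := clamp u with hv
  simp only [curlOffset, ← hv, abs_le]
  refine ⟨⟨?_, ?_⟩, ?_, ?_⟩
  · nlinarith [mul_nonneg (sub_nonneg.2 h.2) (sq_nonneg (2 * v + 1)), sq_nonneg (2 * v - 1),
      mul_nonneg (neg_le_iff_add_nonneg.1 h.1) (sq_nonneg (3 * v - 2)), sq_nonneg v]
  · nlinarith [mul_nonneg (sub_nonneg.2 h.2) (sq_nonneg (3 * v + 2)), sq_nonneg (2 * v - 1),
      mul_nonneg (neg_le_iff_add_nonneg.1 h.1) (sq_nonneg (2 * v - 1)), sq_nonneg v]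
  · nlinarith
  · nlinarith

/-- Factoring out the difference of the clamped parameters leaves 2 * (a ^ 2 + a * b + b ^ 2 - 1)
and -(a + b) / 2, both bounded by 4 on [-1, 1]. -/
theorem abs_curlOffset_sub_le (x y : ℝ) :
    |(curlOffset x).1 - (curlOffset y).1| ≤ 4 * |x - y| ∧
      |(curlOffset x).2 - (curlOffset y).2| ≤ 4 * |x - y| := by
  have hx := abs_le.1 (abs_clamp_le x)
  have hy := abs_le.1 (abs_clamp_le y)
  have hd := abs_clamp_sub_le x y
  simp only [curlOffset]
  set a := clamp x
  set b := clamp y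
  have key : ∀ c, |c| ≤ 4 → |c * (a - b)| ≤ 4 * |x - y| := fun c hc => by
    rw [abs_mul]
    exact mul_le_mul hc hd (abs_nonneg _) (by norm_num)
  constructor
  · have e : 2 * a ^ 3 - 2 * a - (2 * b ^ 3 - 2 * b) = (2 * (a ^ 2 + a * b + b ^ 2 - 1)) * (a - b) := by
      ring
    rw [e]
    refine key _ (abs_le.2 ⟨?_, ?_⟩)
    · nlinarith [sq_nonneg (a + b), sq_nonneg a, sq_nonneg b]
    · nlinarith [sq_nonneg (a - b), sq_nonneg a, sq_nonneg b]
  · have e : (1 - a ^ 2) / 2 - (1 - b ^ 2) / 2 = (-(a + b) / 2) * (a - b) := by ring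
    rw [e]
    exact key _ (abs_le.2 ⟨by linarith, by linarith⟩)

end CurlOffset

/-- Places for curls of size `ε` on the segment `[-1, 1]`, away from the origin. -/
structure Sites (J : Type) where
  center : J → ℝ
  ε : ℝ
  ε_pos : 0 < ε
  ε_le : ε ≤ 1 / 128
  lo : ∀ j, 1 / 4 + ε ≤ |center j|
  hi : ∀ j, |center j| + ε ≤ 3 / 8
  sep : ∀ i j, i ≠ j → 3 * ε ≤ |center i - center j|

namespace Sites

variable {J : Type} (S : Sites J) (c : Finset J)

/-- The displacement of the segment that creates the curls at the places in `c`. -/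
def offset (x : ℝ) : Plane := ∑ j ∈ c, S.ε • curlOffset ((x - S.center j) / S.ε)

theorem one_le_abs_div {x : ℝ} {j : J} (h : S.ε ≤ |x - S.center j|) :
    1 ≤ |(x - S.center j) / S.ε| := by
  rwa [abs_div, abs_of_pos S.ε_pos, le_div_iff₀ S.ε_pos, one_mul]

theorem eq_of_near {x : ℝ} {i j : J} (hi : |x - S.center i| ≤ S.ε) (hj : |x - S.center j| ≤ S.ε) :
    i = j := by
  by_contra h
  have h1 := S.sep i j h
  have h2 := abs_sub_le (S.center i) x (S.center j)
  rw [abs_sub_comm (S.center i) x] at h2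
  linarith [S.ε_pos]

theorem continuous_offset : Continuous (S.offset c) := by
  have := continuous_curlOffset
  unfold offset; fun_prop

theorem offset_eq_zero {x : ℝ} (h : ∀ j ∈ c, S.ε ≤ |x - S.center j|) : S.offset c x = 0 :=
  Finset.sum_eq_zero fun j hj => by
    rw [curlOffset_of_le_abs (S.one_le_abs_div (h j hj)), smul_zero]

theorem offset_eq {x : ℝ} {j : J} (hj : j ∈ c) (h : |x - S.center j| ≤ S.ε) :
    S.offset c x = S.ε • curlOffset ((x - S.center j) / S.ε) := by
  refine Finset.sum_eq_single_of_mem j hj fun i _ hij => ?_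
  rw [curlOffset_of_le_abs (S.one_le_abs_div ?_), smul_zero]
  by_contra! h'
  exact hij (S.eq_of_near h'.le h)

theorem offset_insert [DecidableEq J] {x : ℝ} {j : J} (h : S.ε ≤ |x - S.center j|) :
    S.offset (insert j c) x = S.offset c x := by
  by_cases hj : j ∈ c
  · rw [Finset.insert_eq_of_mem hj]
  · rw [offset, Finset.sum_insert hj, curlOffset_of_le_abs (S.one_le_abs_div h), smul_zero, zero_add,
      offset]

theorem far {x : ℝ} (h : x ≤ -(3 / 8) ∨ 3 / 8 ≤ x ∨ |x| ≤ 1 / 4) (j : J) : S.ε ≤ |x - S.center j| := by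
  have h1 := S.lo j
  have h2 := S.hi j
  rcases h with h | h | h
  · rw [abs_sub_comm]
    have := le_abs_self (S.center j - x)
    have := neg_le_abs (S.center j)
    linarith
  · have := le_abs_self (x - S.center j)
    have := le_abs_self (S.center j)
    linarith
  · have := abs_sub_abs_le_abs_sub (S.center j) x
    rw [abs_sub_comm] at this
    linarith

theorem offset_eq_zero_of_far {x : ℝ} (h : x ≤ -(3 / 8) ∨ 3 / 8 ≤ x ∨ |x| ≤ 1 / 4) :
    S.offset c x = 0 := S.offset_eq_zero c fun j _ => S.far h j

theorem offset_of_one_lt {x : ℝ} (h : 1 < |x|) : S.offset c x = 0 := by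
  refine S.offset_eq_zero_of_far c ?_
  rcases lt_abs.1 h with h | h
  · exact Or.inr (Or.inl (by linarith))
  · exact Or.inl (by linarith)

/-- The segment with the curls at the places in `c`. -/
def picture (x : ℝ) : Plane := (x, 0) + S.offset c x

theorem picture_site {j : J} (hj : j ∈ c) {u : ℝ} (hu : |u| ≤ 1) :
    S.picture c (S.center j + S.ε * u) =
      (S.center j + S.ε * (2 * u ^ 3 - u), S.ε * ((1 - u ^ 2) / 2)) := by
  have hε := S.ε_pos
  have e : (S.center j + S.ε * u - S.center j) / S.ε = u := by field_simp; ring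
  rw [picture, S.offset_eq c hj, e, curlOffset_of_abs_le hu]
  · ext
    · simp; ring
    · simp
  · rw [add_sub_cancel_left, abs_mul, abs_of_pos hε]
    nlinarith

theorem picture_off {x : ℝ} (h : ∀ j ∈ c, S.ε ≤ |x - S.center j|) : S.picture c x = (x, 0) := by
  rw [picture, S.offset_eq_zero c h, add_zero]

/-- The local coordinate at a place. -/
theorem exists_local {x : ℝ} {j : J} (h : |x - S.center j| ≤ S.ε) :
    ∃ u, |u| ≤ 1 ∧ x = S.center j + S.ε * u := by
  have hε := S.ε_pos
  refine ⟨(x - S.center j) / S.ε, ?_, by field_simp; ring⟩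
  rwa [abs_div, abs_of_pos hε, div_le_one hε]

theorem abs_curl_le {u : ℝ} (hu : |u| ≤ 1) : |2 * u ^ 3 - u| ≤ 1 := by
  have h := abs_le.1 hu
  exact abs_le.2 (curl_mem_square h.1 h.2).1

theorem picture_near {x : ℝ} {j : J} (hj : j ∈ c) (h : |x - S.center j| ≤ S.ε) :
    |(S.picture c x).1 - S.center j| ≤ S.ε := by
  obtain ⟨u, hu, rfl⟩ := S.exists_local h
  rw [S.picture_site c hj hu, add_sub_cancel_left, abs_mul, abs_of_pos S.ε_pos]
  nlinarith [abs_curl_le hu, S.ε_pos]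

theorem picture_snd_pos {x : ℝ} {j : J} (hj : j ∈ c) (h : |x - S.center j| < S.ε) :
    0 < (S.picture c x).2 := by
  have hε := S.ε_pos
  obtain ⟨u, hu, rfl⟩ := S.exists_local h.le
  rw [S.picture_site c hj hu]
  have : |u| < 1 := by
    rw [add_sub_cancel_left, abs_mul, abs_of_pos hε] at h
    nlinarith
  have : u ^ 2 < 1 := by rwa [sq_lt_one_iff_abs_lt_one]
  simp only
  have : 0 < 1 - u ^ 2 := by linarith
  positivity

theorem picture_mem_square {x : ℝ} (hx : |x| ≤ 1) : S.picture c x ∈ square := by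
  by_cases h : ∃ j ∈ c, |x - S.center j| < S.ε
  · obtain ⟨j, hj, h⟩ := h
    have h1 := S.picture_near c hj h.le
    obtain ⟨u, hu, rfl⟩ := S.exists_local h.le
    have hε := S.ε_pos
    have := S.hi j
    have h2 := abs_le.1 ((abs_sub_abs_le_abs_sub _ _).trans h1 |> fun h =>
      (by linarith : |(S.picture c (S.center j + S.ε * u)).1| ≤ 1))
    refine ⟨h2, ?_⟩
    rw [S.picture_site c hj hu]
    have := (sq_le_one_iff_abs_le_one u).2 hu
    constructor <;> simp only <;> nlinarith [S.ε_le, sq_nonneg u]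
  · push Not at h
    rw [S.picture_off c h]
    exact ⟨abs_le.1 hx, by norm_num, by norm_num⟩

/-- Inside a curl the second coordinate is positive, so a curl does not meet the straight part;
distinct curls lie over disjoint intervals. Only self-crossings of a single curl remain, and
`curl_eq_iff` describes them. -/
theorem picture_eq_iff {x y : ℝ} (hne : x ≠ y) : S.picture c x = S.picture c y ↔
    ∃ j ∈ c, ∃ u : ℝ, u ^ 2 = 1 / 2 ∧ x = S.center j + S.ε * u ∧ y = S.center j - S.ε * u := by
  have hε := S.ε_pos
  constructor
  · intro h
    have key : ∀ x y : ℝ, S.picture c x = S.picture c y → (∃ j ∈ c, |x - S.center j| < S.ε) →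
        ∃ j ∈ c, |y - S.center j| < S.ε := by
      rintro x y h ⟨j, hj, hx⟩
      by_contra! hy
      have := S.picture_snd_pos c hj hx
      rw [h, S.picture_off c hy] at this
      exact lt_irrefl _ this
    by_cases hx : ∃ j ∈ c, |x - S.center j| < S.ε
    · obtain ⟨k, hk, hy⟩ := key x y h hx
      obtain ⟨j, hj, hx⟩ := hx
      have h1 := S.picture_near c hj hx.le
      have h2 := S.picture_near c hk hy.le
      rw [h] at h1
      obtain rfl := S.eq_of_near h1 h2
      obtain ⟨u, hu, rfl⟩ := S.exists_local hx.le
      obtain ⟨v, hv, rfl⟩ := S.exists_local hy.le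
      have huv : u ≠ v := by rintro rfl; exact hne rfl
      rw [S.picture_site c hj hu, S.picture_site c hj hv, Prod.mk.injEq, add_right_inj,
        mul_right_inj' hε.ne', mul_right_inj' hε.ne', ← Prod.mk.injEq, curl_eq_iff huv] at h
      refine ⟨j, hj, u, ?_, rfl, ?_⟩
      · rw [h.1, neg_sq]; exact h.2
      · rw [h.1]; ring
    · have hy : ¬ ∃ j ∈ c, |y - S.center j| < S.ε := fun hy => hx (key y x h.symm hy)
      push Not at hx hy
      rw [S.picture_off c hx, S.picture_off c hy] at h
      exact absurd (congrArg Prod.fst h) hne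
  · rintro ⟨j, hj, u, hu, rfl, rfl⟩
    have h1 : |u| ≤ 1 := by rw [← sq_le_one_iff_abs_le_one]; linarith
    rw [sub_eq_add_neg, ← mul_neg, S.picture_site c hj h1, S.picture_site c hj (by rwa [abs_neg])]
    ext
    · simp only; linear_combination 4 * S.ε * u * hu
    · simp

theorem abs_offset_le (x : ℝ) : |(S.offset c x).1| ≤ S.ε ∧ |(S.offset c x).2| ≤ S.ε := by
  have hε := S.ε_pos
  by_cases h : ∃ j ∈ c, |x - S.center j| ≤ S.ε
  · obtain ⟨j, hj, h⟩ := h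
    rw [S.offset_eq c hj h]
    have := abs_curlOffset_le ((x - S.center j) / S.ε)
    simp only [Prod.smul_fst, Prod.smul_snd, smul_eq_mul, abs_mul, abs_of_pos hε]
    constructor <;> nlinarith
  · push Not at h
    rw [S.offset_eq_zero c fun j hj => (h j hj).le]
    simpa using hε.le

theorem abs_offset_sub_le (x y : ℝ) :
    |(S.offset c x).1 - (S.offset c y).1| ≤ 8 * |x - y| ∧
      |(S.offset c x).2 - (S.offset c y).2| ≤ 8 * |x - y| := by
  have hε := S.ε_pos
  set f : J → ℝ → Plane := fun j x => S.ε • curlOffset ((x - S.center j) / S.ε) with hf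
  have lip : ∀ j x y, |(f j x).1 - (f j y).1| ≤ 4 * |x - y| ∧
      |(f j x).2 - (f j y).2| ≤ 4 * |x - y| := by
    intro j x y
    have h := abs_curlOffset_sub_le ((x - S.center j) / S.ε) ((y - S.center j) / S.ε)
    rw [← sub_div, sub_sub_sub_cancel_right, abs_div, abs_of_pos hε, ← mul_div_assoc,
      le_div_iff₀ hε, le_div_iff₀ hε] at h
    simp only [hf, Prod.smul_fst, Prod.smul_snd, smul_eq_mul, ← mul_sub, abs_mul, abs_of_pos hε]
    constructor <;> linarith [h.1, h.2]
  have zero : ∀ {j x}, S.ε ≤ |x - S.center j| → f j x = 0 := fun h => by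
    rw [hf]; simp only
    rw [curlOffset_of_le_abs (S.one_le_abs_div h), smul_zero]
  have main : ∀ x y, (∃ j ∈ c, |x - S.center j| < S.ε) →
      |(S.offset c x).1 - (S.offset c y).1| ≤ 8 * |x - y| ∧
      |(S.offset c x).2 - (S.offset c y).2| ≤ 8 * |x - y| := by
    rintro x y ⟨j, hj, hx⟩
    have hx' : S.offset c x = f j x := S.offset_eq c hj hx.le
    have l1 := lip j x y
    have n := abs_nonneg (x - y)
    by_cases hy : ∃ k ∈ c, |y - S.center k| < S.ε
    · obtain ⟨k, hk, hy⟩ := hy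
      have hy' : S.offset c y = f k y := S.offset_eq c hk hy.le
      by_cases hjk : j = k
      · subst hjk
        rw [hx', hy']
        constructor <;> linarith [l1.1, l1.2]
      -- For points in different curls, each displacement vanishes at the other point. The two
      -- bounds with constant 4 add up, hence the 8.
      · have z1 : f j y = 0 := zero (by
          by_contra! h; exact hjk (S.eq_of_near h.le hy.le))
        have z2 : f k x = 0 := zero (by
          by_contra! h; exact hjk (S.eq_of_near hx.le h.le))
        have l2 := lip k x y
        rw [z1] at l1
        rw [z2] at l2
        rw [hx', hy']
        simp only [Prod.fst_zero, Prod.snd_zero, sub_zero, zero_sub, abs_neg] at l1 l2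
        have t1 := abs_sub (f j x).1 (f k y).1
        have t2 := abs_sub (f j x).2 (f k y).2
        constructor <;> linarith [l1.1, l1.2, l2.1, l2.2]
    · push Not at hy
      rw [zero (hy j hj)] at l1
      rw [S.offset_eq_zero c hy, hx']
      constructor <;> linarith [l1.1, l1.2]
  by_cases hx : ∃ j ∈ c, |x - S.center j| < S.ε
  · exact main x y hx
  by_cases hy : ∃ j ∈ c, |y - S.center j| < S.ε
  · have := main y x hy
    rwa [abs_sub_comm y, abs_sub_comm (S.offset c y).1, abs_sub_comm (S.offset c y).2] at this
  · push Not at hx hy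
    rw [S.offset_eq_zero c hx, S.offset_eq_zero c hy]
    simp

end Sites

/-! ## Diagrams with curls -/

namespace Slot

variable (σ : Slot)

/-- A slot along which the height is a steep valley. -/
structure IsValleyOf (D : Diagram Plane) : Prop extends σ.IsSlotOf D where
  valley : ∀ t, |σ.pos t| ≤ 1 / 2 → D.height t = 100 * σ.r * |σ.pos t|

variable {J : Type} (S : Sites J) (c : Finset J)

/-- The coordinate `pos` jumps at the origin of the circle, but there its values on both sides are
outside the range of the curls, where the offset is 0. -/
theorem continuous_offset_pos : Continuous fun t => S.offset c (σ.pos t) := by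
  have hτ := σ.τ_pos
  have h : Continuous (AddCircle.liftIco 1 0 fun s : ℝ => S.offset c ((s - σ.t₀) / σ.τ)) := by
    refine AddCircle.liftIco_continuous ?_ ?_
    · have h1 := σ.lo
      have h2 := σ.hi
      rw [S.offset_eq_zero_of_far, S.offset_eq_zero_of_far]
      · right; left
        rw [le_div_iff₀ hτ]; linarith
      · left
        rw [div_le_iff₀ hτ]; linarith
    · have := S.continuous_offset c
      fun_prop
  convert h using 1
  funext t
  rw [pos, rep, sub_zero]
  rfl

theorem isOpen_one_lt_abs_pos : IsOpen {t | 1 < |σ.pos t|} := by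
  have := σ.isClosed_abs_pos_le.isOpen_compl
  convert this using 1
  ext t
  simp

/-- The chart of the plane adapted to a small box around a point of the slot. -/
def box (x : ℝ) {b b' : ℝ} (hb : b ≠ 0) (hb' : b' ≠ 0) : Plane ≃ₜ Plane :=
  ((Homeomorph.mulLeft₀ b hb).prodCongr (Homeomorph.mulLeft₀ b' hb')).trans
    ((Homeomorph.addLeft ((x, 0) : Plane)).trans σ.chart)

theorem box_apply (x : ℝ) {b b' : ℝ} (hb : b ≠ 0) (hb' : b' ≠ 0) (p : Plane) :
    σ.box x hb hb' p = σ.chart (x + b * p.1, b' * p.2) := by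
  change σ.chart ((x, 0) + (b * p.1, b' * p.2)) = _
  rw [Prod.mk_add_mk, zero_add]

end Slot

section Curls

variable {D : Diagram Plane} {σ : Slot} {J : Type} {S : Sites J}

/-- The curve of a diagram with curls. -/
def curlCurve (D : Diagram Plane) (σ : Slot) (S : Sites J) (c : Finset J) (t : UnitAddCircle) : Plane :=
  D.curve t + σ.lin (S.offset c (σ.pos t))

theorem continuous_curlCurve (c : Finset J) : Continuous (curlCurve D σ S c) :=
  D.continuous_curve.add (σ.continuous_lin.comp (σ.continuous_offset_pos S c))

theorem curlCurve_off {c : Finset J} {t : UnitAddCircle} (ht : 1 < |σ.pos t|) :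
    curlCurve D σ S c t = D.curve t := by
  rw [curlCurve, S.offset_of_one_lt c ht, σ.lin_zero, add_zero]

theorem curlCurve_on (hσ : σ.IsValleyOf D) {c : Finset J} {t : UnitAddCircle} (ht : |σ.pos t| ≤ 1) :
    curlCurve D σ S c t = σ.chart (S.picture c (σ.pos t)) := by
  rw [curlCurve, hσ.on t ht, ← σ.chart_add, Sites.picture]

/-- The parameter of a point near a place. -/
def sitePt (σ : Slot) (S : Sites J) (j : J) (u : ℝ) : UnitAddCircle := σ.pt (S.center j + S.ε * u)

theorem Sites.abs_site_mem {j : J} {u : ℝ} (hu : |u| ≤ 1) :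
    1 / 4 ≤ |S.center j + S.ε * u| ∧ |S.center j + S.ε * u| ≤ 3 / 8 := by
  have hε := S.ε_pos
  have h1 := S.lo j
  have h2 := S.hi j
  have h3 : |S.ε * u| ≤ S.ε := by rw [abs_mul, abs_of_pos hε]; nlinarith
  have h4 := abs_add_le (S.center j) (S.ε * u)
  have h5 := abs_sub_abs_le_abs_sub (S.center j) (-(S.ε * u))
  rw [abs_neg, sub_neg_eq_add] at h5
  constructor <;> linarith

theorem pos_sitePt (j : J) {u : ℝ} (hu : |u| ≤ 1) :
    σ.pos (sitePt σ S j u) = S.center j + S.ε * u :=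
  σ.pos_pt (by linarith [(S.abs_site_mem (j := j) hu).2])

theorem continuous_sitePt (j : J) : Continuous (sitePt σ S j) :=
  σ.continuous_pt.comp (by fun_prop)

theorem curlCurve_site (hσ : σ.IsValleyOf D) {c : Finset J} {j : J} (hj : j ∈ c) {u : ℝ}
    (hu : |u| ≤ 1) : curlCurve D σ S c (sitePt σ S j u) =
      σ.chart (S.center j + S.ε * (2 * u ^ 3 - u), S.ε * ((1 - u ^ 2) / 2)) := by
  have h := pos_sitePt (σ := σ) (S := S) j hu
  rw [curlCurve_on hσ (by rw [h]; linarith [(S.abs_site_mem (j := j) hu).2]), h,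
    S.picture_site c hj hu]

theorem height_site (hσ : σ.IsValleyOf D) (j : J) {u : ℝ} (hu : |u| ≤ 1) :
    D.height (sitePt σ S j u) = 100 * σ.r * |S.center j + S.ε * u| := by
  have h := pos_sitePt (σ := σ) (S := S) j hu
  rw [hσ.valley _ (by rw [h]; linarith [(S.abs_site_mem (j := j) hu).2]), h]

theorem abs_le_one_of_sq {u : ℝ} (hu : u ^ 2 = 1 / 2) : |u| ≤ 1 := by
  rw [← sq_le_one_iff_abs_le_one]; linarith

theorem sitePt_eq_iff {i j : J} {u v : ℝ} (hu : |u| ≤ 1) (hv : |v| ≤ 1) :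
    sitePt σ S i u = sitePt σ S j v ↔ i = j ∧ u = v := by
  constructor
  · intro h
    have h' := congrArg σ.pos h
    rw [pos_sitePt i hu, pos_sitePt j hv] at h'
    have hε := S.ε_pos
    have near : ∀ (k : J) {w : ℝ}, |w| ≤ 1 → |S.center k + S.ε * w - S.center k| ≤ S.ε := by
      intro k w hw
      rw [add_sub_cancel_left, abs_mul, abs_of_pos hε]; nlinarith
    have h1 := near i hu
    have h2 := near j hv
    rw [h'] at h1
    obtain rfl := S.eq_of_near h1 h2
    refine ⟨rfl, ?_⟩
    rwa [add_right_inj, mul_right_inj' hε.ne'] at h'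
  · rintro ⟨rfl, rfl⟩; rfl

/-- The curled segment stays in the square and the rest of D stays outside, so old crossings persist
and the only new ones are those of the curls. -/
theorem curlCurve_eq_iff (hσ : σ.IsValleyOf D) (c : Finset J) {s t : UnitAddCircle} (hst : s ≠ t) :
    curlCurve D σ S c s = curlCurve D σ S c t ↔
      (1 < |σ.pos s| ∧ 1 < |σ.pos t| ∧ D.curve s = D.curve t) ∨
      ∃ j ∈ c, ∃ u : ℝ, u ^ 2 = 1 / 2 ∧ s = sitePt σ S j u ∧ t = sitePt σ S j (-u) := by
  have mixed : ∀ s t, |σ.pos s| ≤ 1 → 1 < |σ.pos t| →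
      curlCurve D σ S c s ≠ curlCurve D σ S c t := by
    intro s t hs ht h
    rw [curlCurve_on hσ hs, curlCurve_off ht] at h
    exact hσ.off t ht ⟨_, S.picture_mem_square c hs, h⟩
  constructor
  · intro h
    by_cases hs : |σ.pos s| ≤ 1
    · by_cases ht : |σ.pos t| ≤ 1
      · right
        rw [curlCurve_on hσ hs, curlCurve_on hσ ht, σ.chart.injective.eq_iff,
          S.picture_eq_iff c (σ.pos_injective.ne hst)] at h
        obtain ⟨j, hj, u, hu, h1, h2⟩ := h
        refine ⟨j, hj, u, hu, ?_, ?_⟩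
        · rw [sitePt, ← h1, σ.pt_pos]
        · rw [sitePt, mul_neg, ← sub_eq_add_neg, ← h2, σ.pt_pos]
      · exact absurd h (mixed s t hs (not_le.1 ht))
    · by_cases ht : |σ.pos t| ≤ 1
      · exact absurd h.symm (mixed t s ht (not_le.1 hs))
      · left
        rw [not_le] at hs ht
        refine ⟨hs, ht, ?_⟩
        rwa [curlCurve_off hs, curlCurve_off ht] at h
  · rintro (⟨hs, ht, h⟩ | ⟨j, hj, u, hu, rfl, rfl⟩)
    · rw [curlCurve_off hs, curlCurve_off ht, h]
    · have h1 := abs_le_one_of_sq hu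
      rw [curlCurve_site hσ hj h1, curlCurve_site hσ hj (by rwa [abs_neg])]
      congr 1
      ext
      · simp only; linear_combination 4 * S.ε * u * hu
      · simp

/-- A place does not contain the origin, so the absolute value is monotone on it: decreasing on the
left, increasing on the right. This decides which passage of the curl is over. -/
theorem lt_iff_of_site {j : J} {u v : ℝ} (hu : |u| ≤ 1) (hv : |v| ≤ 1) :
    |S.center j + S.ε * u| < |S.center j + S.ε * v| ↔
      (if S.center j < 0 then v < u else u < v) := by
  have hε := S.ε_pos
  have hj := S.lo j
  have key : ∀ {w : ℝ}, |w| ≤ 1 → -S.ε ≤ S.ε * w ∧ S.ε * w ≤ S.ε := fun {w} hw => by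
    have := abs_le.1 hw
    constructor <;> nlinarith
  have h1 := key hu
  have h2 := key hv
  split_ifs with h
  · rw [abs_of_neg h] at hj
    rw [abs_of_nonpos (by linarith), abs_of_nonpos (by linarith), neg_lt_neg_iff, add_lt_add_iff_left,
      mul_lt_mul_iff_right₀ hε]
  · rw [abs_of_nonneg (not_lt.1 h)] at hj
    rw [abs_of_nonneg (by linarith), abs_of_nonneg (by linarith), add_lt_add_iff_left,
      mul_lt_mul_iff_right₀ hε]

theorem height_lt_iff_of_site (hσ : σ.IsValleyOf D) (j : J) {u v : ℝ} (hu : |u| ≤ 1)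
    (hv : |v| ≤ 1) : D.height (sitePt σ S j u) < D.height (sitePt σ S j v) ↔
      (if S.center j < 0 then v < u else u < v) := by
  rw [height_site hσ j hu, height_site hσ j hv, mul_lt_mul_iff_right₀ (by have := σ.r_pos; positivity),
    lt_iff_of_site hu hv]

/-- At the parameters u and -u the tangent vectors are (2, -u) and (2, u), with determinant 4 * u ≠
0. -/
theorem exists_chart_of_curl {u : ℝ} (hu : u ^ 2 = 1 / 2) :
    ∃ ψ : Plane → Plane, IsOpenEmbedding ψ ∧ ψ (0, 0) = (2 * u ^ 3 - u, (1 - u ^ 2) / 2) ∧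
      (∀ᶠ x in 𝓝 u, ∃ y : ℝ, (2 * x ^ 3 - x, (1 - x ^ 2) / 2) = ψ (y, 0)) ∧
      (∀ᶠ x in 𝓝 (-u), ∃ y : ℝ, (2 * x ^ 3 - x, (1 - x ^ 2) / 2) = ψ (0, y)) := by
  have hd : ∀ x : ℝ, HasStrictDerivAt (fun x : ℝ => ((2 * x ^ 3 - x, (1 - x ^ 2) / 2) : Plane))
      (6 * x ^ 2 - 1, -x) x := by
    intro x
    have e1 : HasStrictDerivAt (fun x : ℝ => 2 * x ^ 3 - x) (6 * x ^ 2 - 1) x := by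
      have : HasStrictDerivAt (fun x : ℝ => 2 * x ^ 3 - x) _ x :=
        ((hasStrictDerivAt_pow 3 x).const_mul 2).sub (hasStrictDerivAt_id x)
      exact this.congr_deriv (by push_cast; ring)
    have e2 : HasStrictDerivAt (fun x : ℝ => (1 - x ^ 2) / 2) (-x) x := by
      have : HasStrictDerivAt (fun x : ℝ => (1 - x ^ 2) / 2) _ x :=
        ((hasStrictDerivAt_pow 2 x).const_sub 1).div_const 2
      exact this.congr_deriv (by push_cast; ring)
    exact e1.prodMk e2
  refine exists_chart_of_transverse (hd u) (hd (-u)) ?_ ?_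
  · ext
    · simp only; linear_combination 4 * u * hu
    · simp
  · have hu0 : u ≠ 0 := by rintro rfl; norm_num at hu
    have e : (6 * u ^ 2 - 1) * -(-u) - -u * (6 * (-u) ^ 2 - 1) = 4 * u := by
      linear_combination 12 * u * hu
    simp only
    rw [e]
    positivity

theorem eventually_sitePt (hσ : σ.IsValleyOf D) {c : Finset J} {j : J} (hj : j ∈ c) {u : ℝ}
    (hu : u ^ 2 = 1 / 2) {p : ℝ → Prop} (hp : ∀ᶠ x in 𝓝 u, p x) :
    ∀ᶠ w in 𝓝 (sitePt σ S j u), ∃ x, p x ∧ curlCurve D σ S c w =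
      σ.chart (S.center j + S.ε * (2 * x ^ 3 - x), S.ε * ((1 - x ^ 2) / 2)) := by
  have hτ := σ.τ_pos.ne'
  have hε := S.ε_pos.ne'
  refine eventually_nhds_coe ?_
  set g : ℝ → ℝ := fun y => ((y - σ.t₀) / σ.τ - S.center j) / S.ε with hg
  have hgc : Continuous g := by fun_prop
  have hgu : g (σ.t₀ + σ.τ * (S.center j + S.ε * u)) = u := by
    simp only [hg]; field_simp; ring
  have h1 : ∀ᶠ y in 𝓝 (σ.t₀ + σ.τ * (S.center j + S.ε * u)), p (g y) ∧ |g y| < 1 := by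
    have : Filter.Tendsto g (𝓝 (σ.t₀ + σ.τ * (S.center j + S.ε * u))) (𝓝 u) := by
      have := hgc.tendsto (σ.t₀ + σ.τ * (S.center j + S.ε * u))
      rwa [hgu] at this
    have h2 : ∀ᶠ x : ℝ in 𝓝 u, |x| < 1 := by
      refine (continuous_abs.tendsto u).eventually (gt_mem_nhds ?_)
      rw [← sq_lt_one_iff_abs_lt_one]; linarith
    exact this.eventually (hp.and h2)
  filter_upwards [h1] with y hy
  refine ⟨g y, hy.1, ?_⟩
  rw [← curlCurve_site hσ hj hy.2.le, sitePt, Slot.pt]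
  congr 3
  simp only [hg]; field_simp; ring

/-- The diagram with curls at the places in `c`. -/
def curlDiagram (hσ : σ.IsValleyOf D) (S : Sites J) (c : Finset J) : Diagram Plane where
  curve := curlCurve D σ S c
  height := D.height
  continuous_curve := continuous_curlCurve c
  continuous_height := D.continuous_height
  height_ne s t hst he := by
    rcases (curlCurve_eq_iff hσ c hst).1 he with ⟨-, -, h⟩ | ⟨j, -, u, hu, rfl, rfl⟩
    · exact D.height_ne s t hst h
    · have h1 := abs_le_one_of_sq hu
      have h2 : |-u| ≤ 1 := by rwa [abs_neg]
      have hu0 : u ≠ 0 := by rintro rfl; norm_num at hu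
      intro h
      have a := (height_lt_iff_of_site (S := S) hσ j h1 h2).not.1 h.not_lt
      have b := (height_lt_iff_of_site (S := S) hσ j h2 h1).not.1 h.not_gt
      refine hu0 ?_
      split_ifs at a b <;> linarith
  finite_double := by
    have hs : {u : ℝ | u ^ 2 = 1 / 2}.Finite := by
      refine (Set.toFinite {√(1 / 2), -√(1 / 2)}).subset fun u hu => ?_
      have : u ^ 2 = √(1 / 2) ^ 2 := by
        rw [Real.sq_sqrt (by norm_num)]; exact hu
      exact sq_eq_sq_iff_eq_or_eq_neg.1 this
    refine (D.finite_double.union (((Finset.finite_toSet c).prod hs).image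
      fun q : J × ℝ => (sitePt σ S q.1 q.2, sitePt σ S q.1 (-q.2)))).subset ?_
    rintro ⟨s, t⟩ ⟨hst, he⟩
    rcases (curlCurve_eq_iff hσ c hst).1 he with ⟨-, -, h⟩ | ⟨j, hj, u, hu, h1, h2⟩
    · exact Or.inl ⟨hst, h⟩
    · exact Or.inr ⟨(j, u), ⟨hj, hu⟩, Prod.ext h1.symm h2.symm⟩
  no_triple r s t hrs hst := by
    by_contra! h
    obtain ⟨n1, n2, n3⟩ := h
    have off : ∀ {j : J} {u : ℝ}, u ^ 2 = 1 / 2 → ¬ 1 < |σ.pos (sitePt σ S j u)| := by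
      intro j u hu
      have := abs_le_one_of_sq hu
      rw [pos_sitePt j this]
      linarith [(S.abs_site_mem (j := j) this).2]
    have neg : ∀ {u : ℝ}, u ^ 2 = 1 / 2 → (-u) ^ 2 = 1 / 2 := fun h => by rwa [neg_sq]
    rcases (curlCurve_eq_iff hσ c n1).1 hrs with ⟨o1, o2, h1⟩ | ⟨j, -, u, hu, rfl, rfl⟩
    · rcases (curlCurve_eq_iff hσ c n2).1 hst with ⟨o3, o4, h2⟩ | ⟨k, -, v, hv, rfl, rfl⟩
      · rcases D.no_triple r s t h1 h2 with h | h | h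
        exacts [n1 h, n2 h, n3 h]
      · exact off hv o2
    · rcases (curlCurve_eq_iff hσ c n2).1 hst with ⟨o3, o4, h2⟩ | ⟨k, -, v, hv, h1, rfl⟩
      · exact off (neg hu) o3
      · rw [sitePt_eq_iff (abs_le_one_of_sq (neg hu)) (abs_le_one_of_sq hv)] at h1
        obtain ⟨rfl, rfl⟩ := h1
        exact n3 (by rw [neg_neg])
  transverse s t hst he := by
    rcases (curlCurve_eq_iff hσ c hst).1 he with ⟨hs, ht, h⟩ | ⟨j, hj, u, hu, rfl, rfl⟩
    · obtain ⟨ψ, h1, h2, h3, h4⟩ := D.transverse s t hst h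
      refine ⟨ψ, h1, by rw [curlCurve_off hs, h2], ?_, ?_⟩
      · filter_upwards [h3, σ.isOpen_one_lt_abs_pos.mem_nhds hs] with w hw hw'
        rw [curlCurve_off hw']; exact hw
      · filter_upwards [h4, σ.isOpen_one_lt_abs_pos.mem_nhds ht] with w hw hw'
        rw [curlCurve_off hw']; exact hw
    · obtain ⟨ψ, h1, h2, h3, h4⟩ := exists_chart_of_curl hu
      have hε := S.ε_pos.ne'
      refine ⟨σ.box (S.center j) hε hε ∘ ψ,
        (σ.box (S.center j) hε hε).isOpenEmbedding.comp h1, ?_, ?_, ?_⟩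
      · rw [Function.comp_apply, h2, σ.box_apply, curlCurve_site hσ hj (abs_le_one_of_sq hu)]
      · filter_upwards [eventually_sitePt hσ hj hu h3] with w hw
        obtain ⟨x, ⟨y, hy⟩, hw⟩ := hw
        exact ⟨y, by rw [hw, Function.comp_apply, ← hy, σ.box_apply]⟩
      · filter_upwards [eventually_sitePt hσ hj (u := -u) (by rwa [neg_sq]) h4] with w hw
        obtain ⟨x, ⟨y, hy⟩, hw⟩ := hw
        exact ⟨y, by rw [hw, Function.comp_apply, ← hy, σ.box_apply]⟩

end Curls

/-! ### Curls preserve the knot type and arise by Ω₁ moves. -/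

section CurlMoves

variable {D : Diagram Plane} {σ : Slot} {J : Type} {S : Sites J}

theorem Slot.lin_sub (p q : Plane) : σ.lin (p - q) = σ.lin p - σ.lin q := by
  simp [lin]; constructor <;> ring

theorem Slot.abs_lin_le (p : Plane) :
    |(σ.lin p).1| ≤ σ.r * (|p.1| + |p.2|) ∧ |(σ.lin p).2| ≤ σ.r * (|p.1| + |p.2|) := by
  have hr := σ.r_pos
  have h := σ.norm_e
  have c1 : |σ.e.1| ≤ 1 := by
    rw [← sq_le_one_iff_abs_le_one]; nlinarith [sq_nonneg σ.e.2]
  have c2 : |σ.e.2| ≤ 1 := by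
    rw [← sq_le_one_iff_abs_le_one]; nlinarith [sq_nonneg σ.e.1]
  have key : ∀ a b : ℝ, |b| ≤ 1 → |a * b| ≤ |a| := fun a b hb => by
    rw [abs_mul]; exact mul_le_of_le_one_right (abs_nonneg _) hb
  simp only [lin, abs_mul σ.r, abs_of_pos hr]
  constructor
  · exact mul_le_mul_of_nonneg_left ((abs_sub _ _).trans (add_le_add (key _ _ c1) (key _ _ c2))) hr.le
  · exact mul_le_mul_of_nonneg_left ((abs_add_le _ _).trans (add_le_add (key _ _ c2) (key _ _ c1))) hr.le

/-- The displacement is compared with the distance in space. For two points on the same slope of the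
valley, the height difference is 100 * r * |x - x'| and the displacements differ by at most 16 * r *
|x - x'|. Otherwise, with one point near the curls, the horizontal distance is at least r / 8, while
the displacements contribute at most 4 * r * ε ≤ r / 32. Both cases give the constant 1/4. -/
theorem curl_offset_lipschitz (hσ : σ.IsValleyOf D) (c : Finset J) (t t' : UnitAddCircle) :
    σ.r * (|(S.offset c (σ.pos t) - S.offset c (σ.pos t')).1| +
        |(S.offset c (σ.pos t) - S.offset c (σ.pos t')).2|) ≤
      1 / 4 * ‖vec (D.curve t).1 (D.curve t).2 (D.height t) -
        vec (D.curve t').1 (D.curve t').2 (D.height t')‖ := by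
  have hr := σ.r_pos
  have main : ∀ t t', 1 / 4 ≤ |σ.pos t| → |σ.pos t| ≤ 3 / 8 →
      σ.r * (|(S.offset c (σ.pos t) - S.offset c (σ.pos t')).1| +
        |(S.offset c (σ.pos t) - S.offset c (σ.pos t')).2|) ≤
      1 / 4 * ‖vec (D.curve t).1 (D.curve t).2 (D.height t) -
        vec (D.curve t').1 (D.curve t').2 (D.height t')‖ := by
    intro t t' hx0 hx1
    set v := vec (D.curve t).1 (D.curve t).2 (D.height t) -
        vec (D.curve t').1 (D.curve t').2 (D.height t') with hv
    have hN := norm_nonneg v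
    set x := σ.pos t with hx
    set x' := σ.pos t' with hx'
    have hA : |D.height t - D.height t'| ≤ ‖v‖ := by
      have := abs_coord_le v 2
      simpa [hv] using this
    by_cases hsame : |x'| ≤ 1 / 2 ∧ 0 ≤ x * x'
    · obtain ⟨h1, h2⟩ := hsame
      rw [hσ.valley t (by linarith), hσ.valley t' h1, ← mul_sub, abs_mul, abs_of_pos (by positivity)] at hA
      have e : |(|x| - |x'|)| = |x - x'| := by
        rcases mul_nonneg_iff.1 h2 with ⟨a, b⟩ | ⟨a, b⟩
        · rw [abs_of_nonneg a, abs_of_nonneg b]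
        · rw [abs_of_nonpos a, abs_of_nonpos b, neg_sub_neg, abs_sub_comm]
      rw [e] at hA
      obtain ⟨l1, l2⟩ := S.abs_offset_sub_le c x x'
      have n := abs_nonneg (x - x')
      simp only [Prod.fst_sub, Prod.snd_sub]
      nlinarith [mul_le_mul_of_nonneg_left (add_le_add l1 l2) hr.le, mul_nonneg hr.le n]
    · set p := σ.chart.symm (D.curve t') with hp
      have hB : σ.r ^ 2 * ((x - p.1) ^ 2 + p.2 ^ 2) ≤ ‖v‖ ^ 2 := by
        have e1 : D.curve t = σ.chart (x, 0) := hσ.on t (by linarith)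
        have e2 : D.curve t' = σ.chart p := by rw [hp, σ.chart.apply_symm_apply]
        rw [EuclideanSpace.real_norm_sq_eq, Fin.sum_univ_three, hv, e1, e2]
        simp only [Slot.chart_apply, Slot.lin, Prod.fst_add, Prod.snd_add, PiLp.sub_apply]
        simp
        have h := σ.norm_e
        have : σ.r ^ 2 * ((x - p.1) ^ 2 + p.2 ^ 2) =
            (σ.r * (x * σ.e.1) - σ.r * (p.1 * σ.e.1 - p.2 * σ.e.2)) ^ 2 +
            (σ.r * (x * σ.e.2) - σ.r * (p.1 * σ.e.2 + p.2 * σ.e.1)) ^ 2 := by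
          linear_combination -(σ.r ^ 2 * ((x - p.1) ^ 2 + p.2 ^ 2)) * h
        rw [this]
        nlinarith [sq_nonneg (D.height t - D.height t')]
      -- Here |x| is between 1/4 and 3/8. The other point is on the segment beyond 1/2 on the same
      -- side, or on the opposite side, or outside the square; the first possibility gives the
      -- constant 1/8.
      have hC : (1 / 8) ^ 2 ≤ (x - p.1) ^ 2 + p.2 ^ 2 := by
        by_cases h1 : |x'| ≤ 1
        · have : p = (x', 0) := by
            rw [hp, hσ.on t' h1, σ.chart.symm_apply_apply]
          rw [this]
          simp only
          have : 1 / 8 ≤ |x - x'| := by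
            by_cases h2 : 0 ≤ x * x'
            · have h3 : 1 / 2 < |x'| := by
                by_contra! h3; exact hsame ⟨h3, h2⟩
              have := abs_sub_abs_le_abs_sub x' x
              rw [abs_sub_comm] at this
              linarith
            · rw [not_le, mul_neg_iff] at h2
              rcases h2 with ⟨a, b⟩ | ⟨a, b⟩
              · rw [abs_of_pos a] at hx0
                have := le_abs_self (x - x')
                linarith
              · rw [abs_of_neg a] at hx0
                have := neg_le_abs (x - x')
                linarith
          have := sq_le_sq' (by linarith) this
          rw [sq_abs] at this
          linarith
        · have hps : p ∉ square := fun h =>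
            hσ.off t' (not_le.1 h1) ⟨p, h, by rw [hp, σ.chart.apply_symm_apply]⟩
          by_cases h2 : |p.2| ≤ 1
          · have h3 : 1 < |p.1| := by
              by_contra! h3; exact hps ⟨abs_le.1 h3, abs_le.1 h2⟩
            have := abs_sub_abs_le_abs_sub p.1 x
            rw [abs_sub_comm] at this
            have := sq_le_sq' (a := 1 / 8) (b := |x - p.1|) (by linarith) (by linarith)
            rw [sq_abs] at this
            nlinarith [sq_nonneg p.2]
          · have := sq_le_sq' (a := 1 / 8) (b := |p.2|) (by linarith) (by linarith)
            rw [sq_abs] at this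
            nlinarith [sq_nonneg (x - p.1)]
      have hD : σ.r * (1 / 8) ≤ ‖v‖ := by
        refine le_of_abs_le (abs_le_of_sq_le_sq ?_ hN)
        rw [mul_pow]
        exact (mul_le_mul_of_nonneg_left hC (sq_nonneg _)).trans hB
      have o1 := S.abs_offset_le c x
      have o2 := S.abs_offset_le c x'
      have s1 := abs_sub (S.offset c x).1 (S.offset c x').1
      have s2 := abs_sub (S.offset c x).2 (S.offset c x').2
      have := S.ε_le
      simp only [Prod.fst_sub, Prod.snd_sub]
      have : |(S.offset c x).1 - (S.offset c x').1| + |(S.offset c x).2 - (S.offset c x').2| ≤ 1 / 32 := by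
        linarith [o1.1, o1.2, o2.1, o2.2]
      nlinarith
  have zero : ∀ x : ℝ, ¬ (1 / 4 ≤ |x| ∧ |x| ≤ 3 / 8) → S.offset c x = 0 := by
    intro x hx
    refine S.offset_eq_zero_of_far c ?_
    by_contra! h
    exact hx ⟨h.2.2.le, abs_le.2 ⟨by linarith, by linarith⟩⟩
  by_cases h1 : 1 / 4 ≤ |σ.pos t| ∧ |σ.pos t| ≤ 3 / 8
  · exact main t t' h1.1 h1.2
  by_cases h2 : 1 / 4 ≤ |σ.pos t'| ∧ |σ.pos t'| ≤ 3 / 8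
  · have := main t' t h2.1 h2.2
    rwa [norm_sub_rev, ← neg_sub, Prod.fst_neg, Prod.snd_neg, abs_neg, abs_neg] at this
  · rw [zero _ h1, zero _ h2]
    simp

/-- Curling moves the space curve horizontally and keeps its heights, so it is a perturbation
covered by `ambientIsotopic_of_lipschitz`. -/
theorem curlDiagram_represents (hσ : σ.IsValleyOf D) (c : Finset J)
    {K : UnitAddCircle → ThreeSphere} (hD : D.Represents planeEmbedding K) :
    (curlDiagram hσ S c).Represents planeEmbedding K := by
  have h := ambientIsotopic_of_lipschitz
    (fun t => vec (D.curve t).1 (D.curve t).2 (D.height t))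
    (fun t => (σ.lin (S.offset c (σ.pos t))).1) (fun t => (σ.lin (S.offset c (σ.pos t))).2)
    (fun t t' => by
      rw [← Prod.fst_sub, ← σ.lin_sub]
      exact (σ.abs_lin_le _).1.trans (curl_offset_lipschitz hσ c t t'))
    (fun t t' => by
      rw [← Prod.snd_sub, ← σ.lin_sub]
      exact (σ.abs_lin_le _).2.trans (curl_offset_lipschitz hσ c t t'))
  have e : (fun t => planeEmbedding ((curlDiagram hσ S c).curve t, (curlDiagram hσ S c).height t)) =
      fun t => ((vec (D.curve t).1 (D.curve t).2 (D.height t) +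
        vec (σ.lin (S.offset c (σ.pos t))).1 (σ.lin (S.offset c (σ.pos t))).2 0 : Space) :
          ThreeSphere) := by
    funext t
    rw [planeEmbedding]
    congr 1
    refine space_ext ?_ ?_ ?_ <;> simp [curlDiagram, curlCurve]
  rw [Diagram.Represents, e]
  exact h.symm.trans hD

theorem isLocalMove_curlDiagram [DecidableEq J] (hσ : σ.IsValleyOf D) {c : Finset J} {j : J}
    (hj : j ∉ c) : IsLocalMove omega1 (curlDiagram hσ S c) (curlDiagram hσ S (insert j c)) := by
  have hε := S.ε_pos
  -- In `omega1` the first passage is over. This matches the descending slope; on the ascending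
  -- slope the strand is parametrized backwards (s = -1) and the chart is reflected accordingly.
  obtain ⟨s, hs, hsj⟩ : ∃ s : ℝ, s ^ 2 = 1 ∧ ∀ u v : ℝ,
      ((if S.center j < 0 then s * v < s * u else s * u < s * v) ↔ v < u) := by
    by_cases h : S.center j < 0
    · exact ⟨1, by norm_num, fun u v => by simp [h]⟩
    · exact ⟨-1, by norm_num, fun u v => by simp [h]⟩
  have hs0 : s ≠ 0 := by rintro rfl; norm_num at hs
  have habs : ∀ {u : ℝ}, |u| ≤ 1 → |s * u| ≤ 1 := fun {u} hu => by
    rw [← sq_le_one_iff_abs_le_one] at hu ⊢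
    rwa [mul_pow, hs, one_mul]
  have habs' : ∀ u : Icc (-1 : ℝ) 1, |s * u| ≤ 1 := fun u => habs (abs_le.2 u.2)
  have hb : ∀ (i : Fin 1) (u : ℝ), omega1.before i u = (u, 0) := fun i u => by
    rw [Subsingleton.elim i 0]; rfl
  have ha : ∀ (i : Fin 1) (u : ℝ), omega1.after i u = (2 * u ^ 3 - u, (1 - u ^ 2) / 2) :=
    fun i u => by rw [Subsingleton.elim i 0]; rfl
  have hl : ∀ (i : Fin 1) (u : ℝ), omega1.level i u = -u := fun i u => by
    rw [Subsingleton.elim i 0]; rfl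
  have hh : ∀ u v : Icc (-1 : ℝ) 1,
      D.height (sitePt σ S j (s * u)) < D.height (sitePt σ S j (s * v)) ↔ -(u : ℝ) < -v := by
    intro u v
    rw [height_lt_iff_of_site hσ j (habs' u) (habs' v), hsj, neg_lt_neg_iff]
  have hεs : S.ε * s ≠ 0 := mul_ne_zero hε.ne' hs0
  refine ⟨σ.box (S.center j) hεs hε.ne', fun _ u => sitePt σ S j (s * u),
    (σ.box (S.center j) hεs hε.ne').isOpenEmbedding, fun _ => ?_, fun i k u v h => ?_,
    fun i u => ?_, fun i u => ?_, fun i k u v _ _ => ?_, fun i k u v _ _ => ?_, fun t ht => ?_,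
    fun _ _ _ _ _ _ => Iff.rfl⟩
  · exact (continuous_sitePt j).comp (by fun_prop)
  · rw [sitePt_eq_iff (habs' u) (habs' v), mul_right_inj' hs0] at h
    exact ⟨Subsingleton.elim (α := Fin 1) _ _, Subtype.ext h.2⟩
  · have hp := pos_sitePt (σ := σ) (S := S) j (habs' u)
    erw [hb]
    rw [σ.box_apply]
    change curlCurve D σ S c _ = _
    rw [curlCurve_on hσ (by rw [hp]; linarith [(S.abs_site_mem (j := j) (habs' u)).2]), hp,
      S.picture_off, mul_zero, mul_assoc]
    intro k hk
    by_contra! h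
    suffices k = j from hj (this ▸ hk)
    refine S.eq_of_near h.le ?_
    rw [add_sub_cancel_left, abs_mul, abs_of_pos hε]
    exact mul_le_of_le_one_right hε.le (habs' u)
  · erw [ha]
    rw [σ.box_apply]
    change curlCurve D σ S _ _ = _
    rw [curlCurve_site hσ (Finset.mem_insert_self j c) (habs' u)]
    congr 1
    ext
    · simp only; linear_combination 2 * S.ε * s * (u : ℝ) ^ 3 * hs
    · simp only; linear_combination -S.ε * (u : ℝ) ^ 2 / 2 * hs
  · erw [hl, hl]; exact hh u v
  · erw [hl, hl]; exact hh u v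
  · have hfar : S.ε < |σ.pos t - S.center j| := by
      by_contra! h
      obtain ⟨u, hu, e⟩ := S.exists_local h
      refine ht (0 : Fin 1) ⟨s * u, abs_le.1 (habs hu)⟩ ?_
      change sitePt σ S j (s * (s * u)) = t
      rw [← mul_assoc, ← pow_two, hs, one_mul, sitePt, ← e, σ.pt_pos]
    constructor
    · change curlCurve D σ S _ _ = curlCurve D σ S _ _
      rw [curlCurve, S.offset_insert c hfar.le, curlCurve]
    · change curlCurve D σ S c t ∉ _
      rintro ⟨p, hp, e⟩
      rw [σ.box_apply] at e
      have b1 : |S.center j + S.ε * s * p.1 - S.center j| ≤ S.ε := by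
        rw [add_sub_cancel_left, mul_assoc, abs_mul, abs_of_pos hε]
        exact mul_le_of_le_one_right hε.le (habs (abs_le.2 hp.1))
      by_cases h1 : |σ.pos t| ≤ 1
      · rw [curlCurve_on hσ h1, σ.chart.injective.eq_iff] at e
        have e1 := congrArg Prod.fst e
        simp only at e1
        rw [e1] at b1
        by_cases h2 : ∃ k ∈ c, |σ.pos t - S.center k| < S.ε
        · obtain ⟨k, hk, h2⟩ := h2
          have := S.eq_of_near (S.picture_near c hk h2.le) b1
          exact hj (this ▸ hk)
        · push Not at h2
          rw [S.picture_off c h2] at b1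
          exact absurd b1 (not_le.2 hfar)
      · rw [not_le] at h1
        rw [curlCurve_off h1] at e
        refine hσ.off t h1 ⟨_, ⟨?_, ?_⟩, e⟩
        · have := S.hi j
          have := abs_sub_abs_le_abs_sub (S.center j + S.ε * s * p.1) (S.center j)
          exact abs_le.1 (by linarith)
        · have := S.ε_le
          have := hp.2
          constructor <;> simp only <;> nlinarith [hp.2.1, hp.2.2]

end CurlMoves

/-! ### Crossing number and alternating sum of diagrams with curls. -/

section CurlInvariants

open Classical

variable {D : Diagram Plane} {σ : Slot} {J : Type} {S : Sites J}

/-- The sign with which a curl contributes to the alternating sum. -/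
def Sites.sgn (S : Sites J) (j : J) : ℤ := if S.center j < 0 then 1 else -1

theorem one_lt_abs_pos_of_double (hσ : σ.IsSlotOf D) {s t : UnitAddCircle} (hst : s ≠ t)
    (h : D.curve s = D.curve t) : 1 < |σ.pos t| := by
  by_contra! ht
  by_cases hs : |σ.pos s| ≤ 1
  · rw [hσ.on s hs, hσ.on t ht, σ.chart.injective.eq_iff] at h
    exact hst (σ.pos_injective (congrArg Prod.fst h))
  · refine hσ.off s (not_le.1 hs) ⟨(σ.pos t, 0), ⟨abs_le.1 ht, by norm_num, by norm_num⟩, ?_⟩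
    rw [h, hσ.on t ht]

theorem mem_doublePts_curlDiagram (hσ : σ.IsValleyOf D) (c : Finset J) {t : UnitAddCircle} :
    t ∈ (curlDiagram hσ S c).doublePts ↔ t ∈ D.doublePts ∨
      ∃ j ∈ c, ∃ u : ℝ, u ^ 2 = 1 / 2 ∧ t = sitePt σ S j u := by
  rw [Diagram.mem_doublePts, Diagram.mem_doublePts]
  constructor
  · rintro ⟨s, hst, he⟩
    rcases (curlCurve_eq_iff hσ c hst).1 he with ⟨-, -, h⟩ | ⟨j, hj, u, hu, -, rfl⟩
    · exact Or.inl ⟨s, hst, h⟩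
    · exact Or.inr ⟨j, hj, -u, by rwa [neg_sq], rfl⟩
  · rintro (⟨s, hst, h⟩ | ⟨j, hj, u, hu, rfl⟩)
    · exact ⟨s, hst, (curlCurve_eq_iff hσ c hst).2 (Or.inl
        ⟨one_lt_abs_pos_of_double hσ.toIsSlotOf hst.symm h.symm,
          one_lt_abs_pos_of_double hσ.toIsSlotOf hst h, h⟩)⟩
    · have h1 := abs_le_one_of_sq hu
      have hne : sitePt σ S j (-u) ≠ sitePt σ S j u := fun h => by
        have := ((sitePt_eq_iff (by rwa [abs_neg]) h1).1 h).2
        have : u = 0 := by linarith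
        rw [this] at hu; norm_num at hu
      exact ⟨_, hne, (curlCurve_eq_iff hσ c hne).2 (Or.inr
        ⟨j, hj, -u, by rwa [neg_sq], rfl, by rw [neg_neg]⟩)⟩

/-- Old over-passages persist because heights are unchanged. A curl on the left slope is over at its
earlier parameter, one on the right slope at its later parameter. -/
theorem mem_overPts_curlDiagram (hσ : σ.IsValleyOf D) (c : Finset J) {t : UnitAddCircle} :
    t ∈ (curlDiagram hσ S c).overPts ↔ t ∈ D.overPts ∨
      ∃ j ∈ c, ∃ u : ℝ, u ^ 2 = 1 / 2 ∧ t = sitePt σ S j u ∧ S.sgn j * u < 0 := by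
  have key : ∀ (j : J) {u : ℝ}, u ^ 2 = 1 / 2 →
      (D.height (sitePt σ S j (-u)) < D.height (sitePt σ S j u) ↔ S.sgn j * u < 0) := by
    intro j u hu
    have h1 := abs_le_one_of_sq hu
    rw [height_lt_iff_of_site hσ j (by rwa [abs_neg]) h1, Sites.sgn]
    split_ifs <;> push_cast <;> constructor <;> intro h <;> linarith
  rw [Diagram.mem_overPts, Diagram.mem_overPts]
  constructor
  · rintro ⟨s, hst, he, hh⟩
    rcases (curlCurve_eq_iff hσ c hst).1 he with ⟨-, -, h⟩ | ⟨j, hj, u, hu, rfl, rfl⟩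
    · exact Or.inl ⟨s, hst, h, hh⟩
    · have hu' : (-u) ^ 2 = 1 / 2 := by rwa [neg_sq]
      refine Or.inr ⟨j, hj, -u, hu', rfl, (key j hu').1 ?_⟩
      rw [neg_neg]; exact hh
  · rintro (⟨s, hst, h, hh⟩ | ⟨j, hj, u, hu, rfl, hs⟩)
    · exact ⟨s, hst, (curlCurve_eq_iff hσ c hst).2 (Or.inl
        ⟨one_lt_abs_pos_of_double hσ.toIsSlotOf hst.symm h.symm,
          one_lt_abs_pos_of_double hσ.toIsSlotOf hst h, h⟩), hh⟩
    · have h1 := abs_le_one_of_sq hu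
      have hne : sitePt σ S j (-u) ≠ sitePt σ S j u := fun h => by
        have := ((sitePt_eq_iff (by rwa [abs_neg]) h1).1 h).2
        have : u = 0 := by linarith
        rw [this] at hu; norm_num at hu
      exact ⟨_, hne, (curlCurve_eq_iff hσ c hne).2 (Or.inr
        ⟨j, hj, -u, by rwa [neg_sq], rfl, by rw [neg_neg]⟩), (key j hu).2 hs⟩

/-- The interval of parameters around a place. -/
def siteArc (σ : Slot) (S : Sites J) (j : J) : Set UnitAddCircle :=
  {t | |σ.pos t - S.center j| ≤ S.ε}

theorem sitePt_mem_siteArc {j : J} {u : ℝ} (hu : |u| ≤ 1) : sitePt σ S j u ∈ siteArc σ S j := by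
  have hε := S.ε_pos
  change |σ.pos (sitePt σ S j u) - S.center j| ≤ S.ε
  rw [pos_sitePt j hu, add_sub_cancel_left, abs_mul, abs_of_pos hε]
  nlinarith

theorem siteArc_disjoint {i j : J} {t : UnitAddCircle} (hi : t ∈ siteArc σ S i)
    (hj : t ∈ siteArc σ S j) : i = j := S.eq_of_near hi hj

theorem not_mem_siteArc (j : J) {t : UnitAddCircle} (ht : 1 < |σ.pos t|) : t ∉ siteArc σ S j := by
  intro h
  have h' : |σ.pos t - S.center j| ≤ S.ε := h
  have := S.hi j
  have := abs_sub_abs_le_abs_sub (σ.pos t) (S.center j)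
  linarith

theorem sq_eq_half_iff {u : ℝ} (n : ℤ) (hn : n = 1 ∨ n = -1) :
    u ^ 2 = 1 / 2 ↔ u = -(n * √(1 / 2)) ∨ u = n * √(1 / 2) := by
  have h : √(1 / 2 : ℝ) ^ 2 = 1 / 2 := Real.sq_sqrt (by norm_num)
  rw [show (1 / 2 : ℝ) = √(1 / 2) ^ 2 from h.symm, sq_eq_sq_iff_eq_or_eq_neg,
    Real.sqrt_sq (Real.sqrt_nonneg _)]
  rcases hn with rfl | rfl
  · push_cast; rw [one_mul]; exact or_comm
  · push_cast; rw [neg_one_mul, neg_neg]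

theorem Sites.sgn_cases (S : Sites J) (j : J) : S.sgn j = 1 ∨ S.sgn j = -1 := by
  unfold Sites.sgn; split_ifs <;> simp

theorem filter_doublePts_site (hσ : σ.IsValleyOf D) (c : Finset J) (j : J) :
    (curlDiagram hσ S c).doublePts.filter (· ∈ siteArc σ S j) =
      if j ∈ c then {sitePt σ S j (-(S.sgn j * √(1 / 2))), sitePt σ S j (S.sgn j * √(1 / 2))}
      else ∅ := by
  ext t
  rw [Finset.mem_filter, mem_doublePts_curlDiagram]
  have h1 : t ∈ siteArc σ S j → ¬ t ∈ D.doublePts := fun h h' => by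
    obtain ⟨s, h2, h3⟩ := Diagram.mem_doublePts.1 h'
    exact not_mem_siteArc j (one_lt_abs_pos_of_double hσ.toIsSlotOf h2 h3) h
  have h2 : ∀ {u : ℝ}, (u = -(S.sgn j * √(1 / 2)) ∨ u = S.sgn j * √(1 / 2)) → |u| ≤ 1 := fun h =>
    abs_le_one_of_sq ((sq_eq_half_iff _ (S.sgn_cases j)).2 h)
  constructor
  · rintro ⟨h | ⟨i, hi, u, hu, rfl⟩, ht⟩
    · exact absurd h (h1 ht)
    · obtain rfl := siteArc_disjoint (sitePt_mem_siteArc (abs_le_one_of_sq hu)) ht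
      rw [if_pos hi, Finset.mem_insert, Finset.mem_singleton]
      rcases (sq_eq_half_iff _ (S.sgn_cases i)).1 hu with rfl | rfl
      · exact Or.inl rfl
      · exact Or.inr rfl
  · intro h
    split_ifs at h with hj
    · rw [Finset.mem_insert, Finset.mem_singleton] at h
      rcases h with rfl | rfl
      · exact ⟨Or.inr ⟨j, hj, _, (sq_eq_half_iff _ (S.sgn_cases j)).2 (Or.inl rfl), rfl⟩,
          sitePt_mem_siteArc (h2 (Or.inl rfl))⟩
      · exact ⟨Or.inr ⟨j, hj, _, (sq_eq_half_iff _ (S.sgn_cases j)).2 (Or.inr rfl), rfl⟩,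
          sitePt_mem_siteArc (h2 (Or.inr rfl))⟩
    · simp at h

theorem filter_overPts_site (hσ : σ.IsValleyOf D) (c : Finset J) (j : J) :
    (curlDiagram hσ S c).overPts.filter (· ∈ siteArc σ S j) =
      if j ∈ c then {sitePt σ S j (-(S.sgn j * √(1 / 2)))} else ∅ := by
  ext t
  rw [Finset.mem_filter, mem_overPts_curlDiagram]
  have h1 : t ∈ siteArc σ S j → ¬ t ∈ D.overPts := fun h h' => by
    obtain ⟨s, h2, h3, -⟩ := Diagram.mem_overPts.1 h'
    exact not_mem_siteArc j (one_lt_abs_pos_of_double hσ.toIsSlotOf h2 h3) h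
  have hpos : (0 : ℝ) < √(1 / 2) := Real.sqrt_pos.2 (by norm_num)
  have hss : (S.sgn j : ℝ) * S.sgn j = 1 := by
    rcases S.sgn_cases j with h | h <;> rw [h] <;> norm_num
  constructor
  · rintro ⟨h | ⟨i, hi, u, hu, rfl, hs⟩, ht⟩
    · exact absurd h (h1 ht)
    · obtain rfl := siteArc_disjoint (sitePt_mem_siteArc (abs_le_one_of_sq hu)) ht
      rw [if_pos hi, Finset.mem_singleton]
      rcases (sq_eq_half_iff _ (S.sgn_cases i)).1 hu with rfl | rfl
      · rfl
      · rw [← mul_assoc, hss] at hs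
        linarith
  · intro h
    split_ifs at h with hj
    · rw [Finset.mem_singleton] at h
      subst h
      have hu := (sq_eq_half_iff (u := -(S.sgn j * √(1 / 2))) _ (S.sgn_cases j)).2 (Or.inl rfl)
      refine ⟨Or.inr ⟨j, hj, _, hu, rfl, ?_⟩, sitePt_mem_siteArc (abs_le_one_of_sq hu)⟩
      rw [mul_neg, ← mul_assoc, hss]
      linarith
    · simp at h

theorem filter_doublePts_off (hσ : σ.IsValleyOf D) (c : Finset J) :
    (curlDiagram hσ S c).doublePts.filter (· ∈ offSet (siteArc σ S)) = D.doublePts := by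
  ext t
  rw [Finset.mem_filter, mem_doublePts_curlDiagram]
  constructor
  · rintro ⟨h | ⟨j, hj, u, hu, rfl⟩, ht⟩
    · exact h
    · exact absurd (sitePt_mem_siteArc (abs_le_one_of_sq hu)) (ht j)
  · intro h
    refine ⟨Or.inl h, fun j => ?_⟩
    obtain ⟨s, h2, h3⟩ := Diagram.mem_doublePts.1 h
    exact not_mem_siteArc j (one_lt_abs_pos_of_double hσ.toIsSlotOf h2 h3)

theorem filter_overPts_off (hσ : σ.IsValleyOf D) (c : Finset J) :
    (curlDiagram hσ S c).overPts.filter (· ∈ offSet (siteArc σ S)) = D.overPts := by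
  ext t
  rw [Finset.mem_filter, mem_overPts_curlDiagram]
  constructor
  · rintro ⟨h | ⟨j, hj, u, hu, rfl, -⟩, ht⟩
    · exact h
    · exact absurd (sitePt_mem_siteArc (abs_le_one_of_sq hu)) (ht j)
  · intro h
    refine ⟨Or.inl h, fun j => ?_⟩
    obtain ⟨s, h2, h3, -⟩ := Diagram.mem_overPts.1 h
    exact not_mem_siteArc j (one_lt_abs_pos_of_double hσ.toIsSlotOf h2 h3)

theorem sitePt_sgn_ne (j : J) :
    sitePt σ S j (-(S.sgn j * √(1 / 2))) ≠ sitePt σ S j (S.sgn j * √(1 / 2)) := by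
  have hpos : (0 : ℝ) < √(1 / 2) := Real.sqrt_pos.2 (by norm_num)
  have h1 := (sq_eq_half_iff (u := -(S.sgn j * √(1 / 2))) _ (S.sgn_cases j)).2 (Or.inl rfl)
  have h2 := (sq_eq_half_iff (u := S.sgn j * √(1 / 2)) _ (S.sgn_cases j)).2 (Or.inr rfl)
  rw [Ne, sitePt_eq_iff (abs_le_one_of_sq h1) (abs_le_one_of_sq h2)]
  rintro ⟨-, h⟩
  rcases S.sgn_cases j with e | e <;> rw [e] at h <;> push_cast at h <;> linarith

theorem card_overPts_curlDiagram [Fintype J] (hσ : σ.IsValleyOf D) (c : Finset J) :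
    (curlDiagram hσ S c).overPts.card = D.overPts.card + c.card := by
  rw [card_split _ (siteArc σ S) fun i j t => siteArc_disjoint, filter_overPts_off]
  congr 1
  simp only [filter_overPts_site]
  rw [Finset.card_eq_sum_ones, ← Finset.sum_filter_add_sum_filter_not Finset.univ (· ∈ c)]
  rw [Finset.sum_eq_zero (s := Finset.univ.filter fun x => x ∉ c), add_zero, Finset.filter_univ_mem]
  · exact Finset.sum_congr rfl fun j hj => by rw [if_pos hj, Finset.card_singleton]
  · intro j hj
    rw [if_neg (Finset.mem_filter.1 hj).2, Finset.card_empty]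

/-- Each place contains two or no double points, so `alt_split` isolates the curls, and a curl
contributes `sgn`. The crossings of D all lie off the segment, so every place has the same crossings
of D before it; this yields the common sign in front of the sum. -/
theorem alt_curlDiagram [Fintype J] (hσ : σ.IsValleyOf D) (c : Finset J) :
    alt (rep 0) (curlDiagram hσ S c).doublePts (curlDiagram hσ S c).overPts =
      alt (rep 0) D.doublePts D.overPts +
        signIn D.doublePts {s | σ.pos s < 0} * ∑ j ∈ c, S.sgn j := by
  have hε := S.ε_pos
  have conv : ∀ j, ∀ t ∉ siteArc σ S j, ∀ y ∈ siteArc σ S j,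
      (σ.pos y < σ.pos t ↔ S.center j < σ.pos t) := by
    intro j t ht y hy
    have ht' : S.ε < |σ.pos t - S.center j| := not_le.1 ht
    have hy' := abs_le.1 (show |σ.pos y - S.center j| ≤ S.ε from hy)
    rcases lt_abs.1 ht' with h | h <;> constructor <;> intro h' <;> linarith
  have conv' : ∀ j, ∀ t ∉ siteArc σ S j, ∀ y ∈ siteArc σ S j,
      (σ.pos t < σ.pos y ↔ σ.pos t < S.center j) := by
    intro j t ht y hy
    have ht' : S.ε < |σ.pos t - S.center j| := not_le.1 ht
    have hy' := abs_le.1 (show |σ.pos y - S.center j| ≤ S.ε from hy)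
    rcases lt_abs.1 ht' with h | h <;> constructor <;> intro h' <;> linarith
  rw [alt_split (rep 0) _ _ (siteArc σ S) (fun j => sitePt σ S j 0)
    (fun j => sitePt_mem_siteArc (by norm_num)) (fun i j t => siteArc_disjoint)
    (fun j t ht y hy z hz => by
      rw [σ.rep_lt_iff, σ.rep_lt_iff, conv j t ht y hy, conv j t ht z hz])
    (fun j t ht y hy z hz => by
      rw [σ.rep_lt_iff, σ.rep_lt_iff, conv' j t ht y hy, conv' j t ht z hz])
    (fun j => by
      rw [filter_doublePts_site]
      split_ifs
      · rw [Finset.card_pair (sitePt_sgn_ne j)]; exact even_two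
      · simp)]
  rw [filter_doublePts_off, filter_overPts_off, Finset.mul_sum]
  congr 1
  rw [← Finset.sum_filter_add_sum_filter_not Finset.univ (· ∈ c),
    Finset.sum_eq_zero (s := Finset.univ.filter fun x => x ∉ c), add_zero, Finset.filter_univ_mem]
  · refine Finset.sum_congr rfl fun j hj => ?_
    congr 1
    · refine signIn_congr fun s hs => ?_
      obtain ⟨s', h2, h3⟩ := Diagram.mem_doublePts.1 hs
      have h4 := one_lt_abs_pos_of_double hσ.toIsSlotOf h2 h3
      have h5 := S.hi j
      rw [mem_ofPred_eq, mem_ofPred_eq, σ.rep_lt_iff, pos_sitePt j (by norm_num), mul_zero, add_zero]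
      have h6 := abs_le.1 (show |S.center j| ≤ 3 / 8 by linarith)
      rcases lt_abs.1 h4 with h | h <;> constructor <;> intro h' <;> linarith
    · have hpos : (0 : ℝ) < √(1 / 2) := Real.sqrt_pos.2 (by norm_num)
      have h1 := (sq_eq_half_iff (u := -(S.sgn j * √(1 / 2))) _ (S.sgn_cases j)).2 (Or.inl rfl)
      have h2 := (sq_eq_half_iff (u := S.sgn j * √(1 / 2)) _ (S.sgn_cases j)).2 (Or.inr rfl)
      rw [filter_doublePts_site, filter_overPts_site, if_pos hj, if_pos hj,
        alt_pair_single (sitePt_sgn_ne j)]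
      have h3 : rep 0 (sitePt σ S j (S.sgn j * √(1 / 2))) <
          rep 0 (sitePt σ S j (-(S.sgn j * √(1 / 2)))) ↔
            (S.sgn j * √(1 / 2) : ℝ) < -(S.sgn j * √(1 / 2)) := by
        rw [σ.rep_lt_iff, pos_sitePt j (abs_le_one_of_sq h1), pos_sitePt j (abs_le_one_of_sq h2),
          add_lt_add_iff_left, mul_lt_mul_iff_right₀ hε]
      rcases S.sgn_cases j with e | e
      · rw [if_neg, e]
        rw [h3, e]
        push_cast; linarith
      · rw [if_pos, e]
        rw [h3, e]
        push_cast; linarith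
  · intro j hj
    rw [filter_overPts_site, if_neg (Finset.mem_filter.1 hj).2, alt_empty, mul_zero]

end CurlInvariants

/-! ### Grids of diagrams with two kinds of curls. -/

section CurlGrid

/-- Places for `n` curls on each side of the origin. -/
def sites (n : ℕ) : Sites (Bool × Fin n) where
  -- Consecutive centres are 3 * ε apart, starting 2 * ε beyond 1/4. The n places on one side take
  -- up less than 3 * (n + 1) * ε = 3/128, which fits below 3/8.
  center j := (if j.1 then -1 else 1) * (1 / 4 + (3 * (j.2 : ℕ) + 2) * (1 / (128 * (n + 1))))
  ε := 1 / (128 * (n + 1))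
  ε_pos := by positivity
  ε_le := by
    rw [div_le_div_iff₀ (by positivity) (by norm_num)]
    have : (0 : ℝ) ≤ n := n.cast_nonneg
    linarith
  lo j := by
    have h : (0 : ℝ) < 1 / (128 * (n + 1)) := by positivity
    have e : |(if j.1 then -1 else 1 : ℝ)| = 1 := by split_ifs <;> norm_num
    rw [abs_mul, e, one_mul, abs_of_pos (by positivity)]
    nlinarith [(j.2 : ℕ).cast_nonneg (α := ℝ)]
  hi j := by
    have h : (0 : ℝ) < 1 / (128 * (n + 1)) := by positivity
    have e : |(if j.1 then -1 else 1 : ℝ)| = 1 := by split_ifs <;> norm_num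
    rw [abs_mul, e, one_mul, abs_of_pos (by positivity)]
    have h1 : ((j.2 : ℕ) : ℝ) + 1 ≤ n := by exact_mod_cast j.2.2
    have h2 : ((n : ℝ) + 1) * (1 / (128 * (n + 1))) = 1 / 128 := by field_simp
    nlinarith
  sep := by
    rintro ⟨b, k⟩ ⟨b', k'⟩ hne
    set ε : ℝ := 1 / (128 * (n + 1)) with hε
    have h : 0 < ε := by positivity
    have h1 : ((n : ℝ) + 1) * ε = 1 / 128 := by rw [hε]; field_simp
    have hn : (0 : ℝ) ≤ n := n.cast_nonneg
    have k0 := (k : ℕ).cast_nonneg (α := ℝ)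
    have k0' := (k' : ℕ).cast_nonneg (α := ℝ)
    have same : k ≠ k' → 3 * ε ≤ |(1 / 4 + (3 * (k : ℕ) + 2) * ε) - (1 / 4 + (3 * (k' : ℕ) + 2) * ε)| := by
      intro hk
      have e : (1 / 4 + (3 * (k : ℕ) + 2) * ε) - (1 / 4 + (3 * (k' : ℕ) + 2) * ε) =
          3 * ε * (((k : ℕ) : ℤ) - ((k' : ℕ) : ℤ) : ℤ) := by push_cast; ring
      rw [e, abs_mul, abs_of_pos (by positivity)]
      refine le_mul_of_one_le_right (by positivity) ?_
      rw [← Int.cast_abs]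
      have : (((k : ℕ) : ℤ) - ((k' : ℕ) : ℤ)) ≠ 0 := fun h => hk (Fin.ext (by omega))
      exact_mod_cast Int.one_le_abs this
    have opp : 3 * ε ≤ |(1 / 4 + (3 * (k : ℕ) + 2) * ε) + (1 / 4 + (3 * (k' : ℕ) + 2) * ε)| := by
      rw [abs_of_nonneg (by positivity)]
      nlinarith [mul_nonneg k0 h.le, mul_nonneg k0' h.le]
    rcases b <;> rcases b' <;> simp only [Bool.false_eq_true, if_true, if_false, one_mul, neg_one_mul]
    · exact same fun h => hne (by rw [h])
    · rwa [sub_neg_eq_add]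
    · rwa [← neg_add', abs_neg]
    · rw [neg_sub_neg, abs_sub_comm]
      exact same fun h => hne (by rw [h])

theorem sgn_sites {n : ℕ} (j : Bool × Fin n) : (sites n).sgn j = if j.1 then 1 else -1 := by
  rcases j with ⟨b, k⟩
  have h : (0 : ℝ) < 1 / 4 + (3 * (k : ℕ) + 2) * (1 / (128 * (n + 1))) := by positivity
  rcases b
  · simp only [Sites.sgn, sites, Bool.false_eq_true, if_false, one_mul]
    rw [if_neg h.not_gt]
  · simp only [Sites.sgn, sites, if_true, neg_one_mul]
    rw [if_pos (by linarith)]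

/-- The first `a` places on the left and the first `b` places on the right. -/
def firstSites (n a b : ℕ) : Finset (Bool × Fin n) :=
  Finset.univ.filter fun j => (j.2 : ℕ) < if j.1 then a else b

theorem sum_firstSites {n a b : ℕ} (ha : a ≤ n) (hb : b ≤ n) (f : Bool → ℤ) :
    ∑ j ∈ firstSites n a b, f j.1 = a * f true + b * f false := by
  rw [firstSites, Finset.sum_filter, Fintype.sum_prod_type, Fintype.sum_bool]
  simp only [Bool.false_eq_true, if_true, if_false]
  rw [← Finset.sum_filter, ← Finset.sum_filter, Finset.sum_const, Finset.sum_const,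
    Fin.card_filter_val_lt, Fin.card_filter_val_lt, min_eq_right ha, min_eq_right hb, nsmul_eq_mul,
    nsmul_eq_mul]

theorem firstSites_succ_left {n a b : ℕ} (ha : a < n) :
    firstSites n (a + 1) b = insert (true, ⟨a, ha⟩) (firstSites n a b) ∧
      (true, ⟨a, ha⟩) ∉ firstSites n a b := by
  constructor
  · ext ⟨c, k⟩
    rcases c <;> simp [firstSites, Fin.ext_iff]
    omega
  · simp [firstSites]

theorem firstSites_succ_right {n a b : ℕ} (hb : b < n) :
    firstSites n a (b + 1) = insert (false, ⟨b, hb⟩) (firstSites n a b) ∧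
      (false, ⟨b, hb⟩) ∉ firstSites n a b := by
  constructor
  · ext ⟨c, k⟩
    rcases c <;> simp [firstSites, Fin.ext_iff]
    omega
  · simp [firstSites]

/-- With a curls on the left and b on the right, the crossing number is that of D plus a + b and the
alternating sum is A ± (a - b). Once the latter is known to be nonnegative the index is linear in a
and b, and the half-sum and half-difference each depend on only one of them. -/
theorem exists_curl_grid {K : UnitAddCircle → ThreeSphere} (hK : IsTameKnot K) (N : ℕ) :
    ∃ (G : ℕ → ℕ → Diagram Plane) (c₁ c₂ : ℝ),
      (∀ i j, (G i j).Represents planeEmbedding K) ∧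
      (∀ i j, i < N → j ≤ N → IsLocalMove omega1 (G i j) (G (i + 1) j)) ∧
      (∀ i j, i ≤ N → j < N → IsLocalMove omega1 (G i j) (G i (j + 1))) ∧
      ∀ i j, i ≤ N → j ≤ N →
        (((G i j).overPts.card : ℝ) + (G i j).index) / 2 = c₁ + i ∧
        (((G i j).overPts.card : ℝ) - (G i j).index) / 2 = c₂ + j := by
  classical
  obtain ⟨D, σ, hD, hs, hv⟩ := exists_diagram_with_valley hK
  have hσ : σ.IsValleyOf D := ⟨hs, hv⟩
  set A := alt (rep 0) D.doublePts D.overPts with hA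
  -- This many initial curls on one side outweigh both A and up to N curls on the other side, so
  -- that the absolute value in the index can be dropped throughout the grid.
  set M := A.natAbs + N with hM
  set n := M + N with hn
  set E : ℕ → ℕ → Diagram Plane := fun a b => curlDiagram hσ (sites n) (firstSites n a b) with hE
  have moveL : ∀ a b, a < n → IsLocalMove omega1 (E a b) (E (a + 1) b) := fun a b ha => by
    obtain ⟨h1, h2⟩ := firstSites_succ_left (b := b) ha
    simp only [hE]
    rw [h1]
    exact isLocalMove_curlDiagram hσ h2
  have moveR : ∀ a b, b < n → IsLocalMove omega1 (E a b) (E a (b + 1)) := fun a b hb => by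
    obtain ⟨h1, h2⟩ := firstSites_succ_right (a := a) hb
    simp only [hE]
    rw [h1]
    exact isLocalMove_curlDiagram hσ h2
  have hcard : ∀ a b, a ≤ n → b ≤ n → ((E a b).overPts.card : ℝ) = D.overPts.card + a + b := by
    intro a b ha hb
    have h1 := card_overPts_curlDiagram (S := sites n) hσ (firstSites n a b)
    have h2 := sum_firstSites ha hb fun _ => 1
    simp only [Finset.sum_const, nsmul_eq_mul, mul_one] at h2
    have h3 : (firstSites n a b).card = a + b := by exact_mod_cast h2
    simp only [hE]
    rw [h1, h3]
    push_cast; ring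
  have hindex : ∀ a b, a ≤ n → b ≤ n →
      (E a b).index = |A + signIn D.doublePts {s | σ.pos s < 0} * (a - b)| := by
    intro a b ha hb
    have h2 := sum_firstSites ha hb fun x => if x then 1 else -1
    simp only [Bool.false_eq_true, if_true, if_false, mul_one, mul_neg_one] at h2
    simp only [hE, Diagram.index]
    rw [alt_curlDiagram]
    simp only [sgn_sites]
    rw [h2]
    rfl
  have hrep : ∀ a b, (E a b).Represents planeEmbedding K := fun a b =>
    curlDiagram_represents hσ _ hD
  rcases signIn_cases D.doublePts {s | σ.pos s < 0} with h | h
  · refine ⟨fun i j => E (M + i) j, ((D.overPts.card : ℝ) + A) / 2 + M, ((D.overPts.card : ℝ) - A) / 2,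
      fun i j => hrep _ _, fun i j hi hj => moveL _ _ (by omega), fun i j hi hj => moveR _ _ (by omega),
      fun i j hi hj => ?_⟩
    have h1 := hcard (M + i) j (by omega) (by omega)
    have h2 := hindex (M + i) j (by omega) (by omega)
    rw [h, abs_of_nonneg (by push_cast; omega)] at h2
    simp only
    rw [h1, h2]
    push_cast
    constructor <;> ring
  -- When the common sign is -1 it is the curls on the right that increase the sum, so the two sides
  -- exchange roles.
  · refine ⟨fun i j => E j (M + i), ((D.overPts.card : ℝ) + A) / 2 + M, ((D.overPts.card : ℝ) - A) / 2,
      fun i j => hrep _ _, fun i j hi hj => moveR _ _ (by omega), fun i j hi hj => moveL _ _ (by omega),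
      fun i j hi hj => ?_⟩
    have h1 := hcard j (M + i) (by omega) (by omega)
    have h2 := hindex j (M + i) (by omega) (by omega)
    rw [h, abs_of_nonneg (by push_cast; omega)] at h2
    simp only
    rw [h1, h2]
    push_cast
    constructor <;> ring

end CurlGrid

/-! ## From the plane to the sphere -/

section Sphere

theorem norm_vec_one_pos (p : Plane) : 0 < ‖vec p.1 p.2 1‖ := by
  have := abs_coord_le (vec p.1 p.2 1) 2
  simp at this
  linarith

/-- The central projection of the plane to the upper hemisphere. -/
def gnomonic (p : Plane) : TwoSphere :=
  ⟨‖vec p.1 p.2 1‖⁻¹ • vec p.1 p.2 1, by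
    rw [mem_sphere_zero_iff_norm, norm_smul, norm_inv, norm_norm,
      inv_mul_cancel₀ (norm_vec_one_pos p).ne']⟩

/-- The inverse on the open upper hemisphere divides the first two coordinates by the third. -/
theorem isOpenEmbedding_gnomonic : IsOpenEmbedding gnomonic := by
  have hc : Continuous fun p : Plane => vec p.1 p.2 1 :=
    continuous_vec continuous_fst continuous_snd continuous_const
  have hcoord : ∀ i : Fin 3, Continuous fun q : TwoSphere => (q : Space) i := fun i =>
    (continuous_coord i).comp continuous_subtype_val
  let e : OpenPartialHomeomorph Plane TwoSphere :=
    { toFun := gnomonic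
      invFun := fun q => ((q : Space) 0 / (q : Space) 2, (q : Space) 1 / (q : Space) 2)
      source := univ
      target := {q | 0 < (q : Space) 2}
      map_source' := fun p _ => by
        change 0 < (‖vec p.1 p.2 1‖⁻¹ • vec p.1 p.2 1 : Space) 2
        simp
      map_target' := fun _ _ => trivial
      left_inv' := fun p _ => by
        have := (norm_vec_one_pos p).ne'
        change ((‖vec p.1 p.2 1‖⁻¹ • vec p.1 p.2 1 : Space) 0 /
          (‖vec p.1 p.2 1‖⁻¹ • vec p.1 p.2 1 : Space) 2,
          (‖vec p.1 p.2 1‖⁻¹ • vec p.1 p.2 1 : Space) 1 /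
          (‖vec p.1 p.2 1‖⁻¹ • vec p.1 p.2 1 : Space) 2) = p
        set n := ‖vec p.1 p.2 1‖
        ext
        · simp
          field_simp
        · simp
          field_simp
      right_inv' := fun q hq => by
        have hq' : (0 : ℝ) < (q : Space) 2 := hq
        have hn : ‖(q : Space)‖ = 1 := mem_sphere_zero_iff_norm.1 q.2
        have e1 : vec ((q : Space) 0 / (q : Space) 2) ((q : Space) 1 / (q : Space) 2) 1 =
            ((q : Space) 2)⁻¹ • (q : Space) := by
          refine space_ext ?_ ?_ ?_
          · simp; field_simp
          · simp; field_simp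
          · simp; field_simp
        refine Subtype.ext ?_
        change ‖vec ((q : Space) 0 / (q : Space) 2) ((q : Space) 1 / (q : Space) 2) 1‖⁻¹ •
          vec ((q : Space) 0 / (q : Space) 2) ((q : Space) 1 / (q : Space) 2) 1 = (q : Space)
        rw [e1, norm_smul, hn, mul_one, norm_inv, Real.norm_of_nonneg hq'.le, inv_inv, smul_smul,
          mul_inv_cancel₀ hq'.ne', one_smul]
      open_source := isOpen_univ
      open_target := isOpen_lt continuous_const (hcoord 2)
      continuousOn_toFun := by
        refine Continuous.continuousOn ?_
        refine Continuous.subtype_mk ?_ _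
        exact (hc.norm.inv₀ fun p => (norm_vec_one_pos p).ne').smul hc
      continuousOn_invFun := by
        have h2 : ∀ q ∈ {q : TwoSphere | 0 < (q : Space) 2}, (q : Space) 2 ≠ 0 := fun q hq => ne_of_gt hq
        exact ((hcoord 0).continuousOn.div (hcoord 2).continuousOn h2).prodMk
          ((hcoord 1).continuousOn.div (hcoord 2).continuousOn h2) }
  exact e.isOpenEmbedding rfl

/-- `E` is the image of the planar diagram `D` under the central projection. -/
structure IsLift (D : Diagram Plane) (E : Diagram TwoSphere) : Prop where
  curve : ∀ t, E.curve t = gnomonic (D.curve t)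
  height : ∀ s t, D.curve s = D.curve t → (E.height s < E.height t ↔ D.height s < D.height t)

/-- Raise the curve so that z ≥ 1 and apply the cone map (x, y, z) ↦ (z * x, z * y, z). The result
is z * ν times the central projection of (x, y), with ν the norm of (x, y, 1), so its spherical
height is the logarithm of z * ν. At a double point ν is the same for both strands, so over and
under are kept. -/
theorem exists_isLift (D : Diagram Plane) : ∃ E, IsLift D E ∧ ∀ K : UnitAddCircle → ThreeSphere,
    D.Represents planeEmbedding K → E.Represents sphereEmbedding K := by
  obtain ⟨M, hM⟩ := D.exists_abs_height_le
  have hg := isOpenEmbedding_gnomonic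
  set C := M + 1 with hC
  have hz : ∀ t, 1 ≤ D.height t + C := fun t => by
    have := neg_le_of_abs_le (hM t)
    linarith
  set ν : UnitAddCircle → ℝ := fun t => ‖vec (D.curve t).1 (D.curve t).2 1‖ with hν
  have hνpos : ∀ t, 0 < ν t := fun t => norm_vec_one_pos _
  have hzν : ∀ t, 0 < (D.height t + C) * ν t := fun t =>
    mul_pos (by linarith [hz t]) (hνpos t)
  have hνc : Continuous ν :=
    (continuous_vec (continuous_fst.comp D.continuous_curve)
      (continuous_snd.comp D.continuous_curve) continuous_const).norm
  have hlt : ∀ s t, D.curve s = D.curve t →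
      (Real.log ((D.height s + C) * ν s) < Real.log ((D.height t + C) * ν t) ↔
        D.height s < D.height t) := by
    intro s t h
    have e : ν s = ν t := by simp only [hν, h]
    rw [Real.log_lt_log_iff (hzν s) (hzν t), e, mul_lt_mul_iff_left₀ (hνpos t), add_lt_add_iff_right]
  let E : Diagram TwoSphere :=
    { curve := fun t => gnomonic (D.curve t)
      height := fun t => Real.log ((D.height t + C) * ν t)
      continuous_curve := hg.continuous.comp D.continuous_curve
      continuous_height :=
        ((D.continuous_height.add continuous_const).mul hνc).log fun t => (hzν t).ne'
      height_ne := fun s t hst he => by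
        have he' := hg.injective he
        rcases lt_or_gt_of_ne (D.height_ne s t hst he') with h | h
        · exact ne_of_lt ((hlt s t he').2 h)
        · exact ne_of_gt ((hlt t s he'.symm).2 h)
      finite_double := D.finite_double.subset fun p hp => ⟨hp.1, hg.injective hp.2⟩
      no_triple := fun r s t h1 h2 => D.no_triple r s t (hg.injective h1) (hg.injective h2)
      transverse := fun s t hst he => by
        obtain ⟨ψ, h1, h2, h3, h4⟩ := D.transverse s t hst (hg.injective he)
        refine ⟨gnomonic ∘ ψ, hg.comp h1, by rw [Function.comp_apply, h2], ?_, ?_⟩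
        · filter_upwards [h3] with u hu
          obtain ⟨x, hx⟩ := hu
          exact ⟨x, by rw [Function.comp_apply, ← hx]⟩
        · filter_upwards [h4] with u hu
          obtain ⟨x, hx⟩ := hu
          exact ⟨x, by rw [Function.comp_apply, ← hx]⟩ }
  refine ⟨E, ⟨fun _ => rfl, hlt⟩, fun K hK => ?_⟩
  have h1 := Diagram.addHeight_represents hK (continuous_const (y := C)) (B := |C|) fun _ => le_rfl
  have h2 := ambientIsotopic_cone (fun t => vec (D.curve t).1 (D.curve t).2 (D.height t + C)) hz
  have e : (fun t => sphereEmbedding (E.curve t, E.height t)) = fun t =>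
      ((vec ((D.height t + C) * (D.curve t).1) ((D.height t + C) * (D.curve t).2)
        (D.height t + C) : Space) : ThreeSphere) := by
    funext t
    change ((Real.exp (Real.log ((D.height t + C) * ν t)) • ((ν t)⁻¹ •
      vec (D.curve t).1 (D.curve t).2 1) : Space) : ThreeSphere) = _
    rw [Real.exp_log (hzν t), smul_smul, mul_assoc, mul_inv_cancel₀ (hνpos t).ne', mul_one]
    congr 1
    refine space_ext ?_ ?_ ?_ <;> simp
  rw [Diagram.Represents, e]
  exact h2.symm.trans h1

variable {D D' : Diagram Plane} {E E' : Diagram TwoSphere}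

theorem IsLift.curve_eq_iff (h : IsLift D E) {s t : UnitAddCircle} :
    E.curve s = E.curve t ↔ D.curve s = D.curve t := by
  rw [h.curve, h.curve, isOpenEmbedding_gnomonic.injective.eq_iff]

theorem IsLift.invariants (h : IsLift D E) :
    E.overPts.card = D.overPts.card ∧ E.index = D.index := by
  have h1 : E.doublePts = D.doublePts := by
    ext t; simp only [Diagram.mem_doublePts, h.curve_eq_iff]
  have h2 : E.overPts = D.overPts := by
    ext t
    simp only [Diagram.mem_overPts, h.curve_eq_iff]
    exact exists_congr fun s => and_congr_right fun _ => and_congr_right fun hc => h.height s t hc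
  rw [Diagram.index, Diagram.index, h1, h2]
  exact ⟨rfl, rfl⟩

/-- The same arcs serve, with the chart followed by the central projection, which is an open
embedding. -/
theorem IsLift.isLocalMove {M : LocalMove} (h : IsLift D E) (h' : IsLift D' E')
    (hM : IsLocalMove M D D') : IsLocalMove M E E' := by
  have hg := isOpenEmbedding_gnomonic
  obtain ⟨ψ, a, hψ, hac, ha, hD, hD', hh, hh', hoff, hhoff⟩ := hM
  refine ⟨gnomonic ∘ ψ, a, hg.comp hψ, hac, ha, fun i u => by rw [h.curve, hD]; rfl,
    fun i u => by rw [h'.curve, hD']; rfl, fun i j u v hne he => ?_, fun i j u v hne he => ?_,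
    fun t ht => ⟨?_, ?_⟩, fun s t hs ht hne he => ?_⟩
  · rw [h.height _ _ (by rw [hD, hD, he])]; exact hh i j u v hne he
  · rw [h'.height _ _ (by rw [hD', hD', he])]; exact hh' i j u v hne he
  · rw [h.curve, h'.curve, (hoff t ht).1]
  · rw [h.curve, image_comp]
    exact fun hm => (hoff t ht).2 (hg.injective.mem_set_image.1 hm)
  · rw [h.curve_eq_iff] at he
    rw [h.height s t he, h'.height s t (by rw [(hoff s hs).1, (hoff t ht).1, he])]
    exact hhoff s t hs ht hne he

end Sphere

/-! ## Grids in the Reidemeister graphs -/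

/-- The vertex of the Reidemeister graph given by a diagram. -/
def Diagram.toVertex {S : Type*} [TopologicalSpace S] {ι : S × ℝ → ThreeSphere}
    {K : UnitAddCircle → ThreeSphere} (D : Diagram S) (hD : D.Represents ι K) : Vertex ι K :=
  ⟨Quotient.mk (diagramSetoid S) D, D, rfl, hD⟩

/-- The graph has no loops, so the case of isotopic diagrams is kept as an equality;
`not_hyperbolic_of_grid` tolerates it. -/
theorem IsLocalMove.adj_or_eq {S : Type*} [TopologicalSpace S] {ι : S × ℝ → ThreeSphere}
    {K : UnitAddCircle → ThreeSphere} {D E : Diagram S} (h : IsLocalMove omega1 D E)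
    (hD : D.Represents ι K) (hE : E.Represents ι K) :
    (graphOn ι K).Adj (D.toVertex hD) (E.toVertex hE) ∨ D.toVertex hD = E.toVertex hE := by
  rw [or_iff_not_imp_right]
  intro hne
  exact (SimpleGraph.fromRel_adj _ _ _).2
    ⟨hne, Or.inl ⟨D, E, rfl, rfl, omega1, Or.inl rfl, Or.inl h⟩⟩

theorem not_hyperbolic_of_diagram_grid {S : Type*} [TopologicalSpace S] (ι : S × ℝ → ThreeSphere)
    (K : UnitAddCircle → ThreeSphere)
    (grid : ∀ N : ℕ, ∃ (G : ℕ → ℕ → Diagram S) (c₁ c₂ : ℝ),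
      (∀ i j, (G i j).Represents ι K) ∧
      (∀ i j, i < N → j ≤ N → IsLocalMove omega1 (G i j) (G (i + 1) j)) ∧
      (∀ i j, i ≤ N → j < N → IsLocalMove omega1 (G i j) (G i (j + 1))) ∧
      ∀ i j, i ≤ N → j ≤ N →
        (((G i j).overPts.card : ℝ) + (G i j).index) / 2 = c₁ + i ∧
        (((G i j).overPts.card : ℝ) - (G i j).index) / 2 = c₂ + j) :
    ¬ IsGromovHyperbolic (graphOn ι K) := by
  refine not_hyperbolic_of_grid (fun v => classMax v.1) (fun v => classMin v.1)
    (fun u v h => (graphOn_lipschitz ι K h).1) (fun u v h => (graphOn_lipschitz ι K h).2) fun N => ?_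
  obtain ⟨G, c₁, c₂, hr, hL, hR, hF⟩ := grid N
  refine ⟨fun i j => (G i j).toVertex (hr i j), c₁, c₂, fun i j hi hj => ?_, fun i j hi hj => ?_, hF⟩
  · exact (hL i j hi hj).adj_or_eq (hr i j) (hr (i + 1) j)
  · exact (hR i j hi hj).adj_or_eq (hr i j) (hr i (j + 1))

end KnotDiagrams

end

theorem proposition4p1 (K : UnitAddCircle → KnotDiagrams.ThreeSphere)
    (hK : KnotDiagrams.IsTameKnot K) :
    ¬ KnotDiagrams.IsGromovHyperbolic (KnotDiagrams.planarGraph K) ∧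
      ¬ KnotDiagrams.IsGromovHyperbolic (KnotDiagrams.sphericalGraph K) := by
  refine ⟨KnotDiagrams.not_hyperbolic_of_diagram_grid _ K (KnotDiagrams.exists_curl_grid hK),
    KnotDiagrams.not_hyperbolic_of_diagram_grid _ K fun N => ?_⟩
  obtain ⟨G, c₁, c₂, hr, hL, hR, hF⟩ := KnotDiagrams.exists_curl_grid hK N
  choose E hE hEr using fun i j => KnotDiagrams.exists_isLift (G i j)
  refine ⟨E, c₁, c₂, fun i j => hEr i j K (hr i j),
    fun i j hi hj => (hE i j).isLocalMove (hE (i + 1) j) (hL i j hi hj),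
    fun i j hi hj => (hE i j).isLocalMove (hE i (j + 1)) (hR i j hi hj), fun i j hi hj => ?_⟩
  rw [(hE i j).invariants.1, (hE i j).invariants.2]
  exact hF i j hi hj
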